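/- Fix $a>0$ and put $q=\sqrt3\,\pi/a$. Let $\Lambda=\mathbb Z v_1\oplus\mathbb Z v_2\oplus\mathbb Z v_3\subset\mathbb R^3$ with $v_1=\frac a{\sqrt3}(1,-1,-1)$, $v_2=\frac a{\sqrt3}(1,1,1)$, $v_3=\frac a{\sqrt3}(-1,1,-1)$, let $\Omega=\{\sum_j x_jv_j:0\le x_j\le1\}$ be its period cell, and let $q_1=q(1,0,-1)$, $q_2=q(1,1,0)$, $q_3=q(0,1,-1)$ be the dual basis, $q_\ell\cdot v_j=2\pi\delta_{\ell j}$. Put $K=-\frac14(q_1+q_2+q_3)$ and $$R=\begin{pmatrix}0&-1&0\\1&0&0\\0&0&-1\end{pmatrix},\qquad T=\begin{pmatrix}-1&0&0\\0&0&-1\\0&1&0\end{pmatrix},\qquad \mathcal R F(x)=F(R^{*}x),\quad \mathcal T F(x)=F(T^{*}x).$$ A potential $V\in C^\infty(\mathbb R^3,\mathbb R)$ is *admissible* if it is $\Lambda$-periodic, even, $\mathcal R$-invariant and $\mathcal T$-invariant. Its Fourier coefficients are $V_{m_1,m_2,m_3}=\frac1{|\Omega|}\int_\Omega V(x)e^{-i(m_1q_1+m_2q_2+m_3q_3)\cdot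 x}\,dx$ (they are real). For $k\in\mathbb R^3$ let $L^2_{k,\Lambda}$ be the space of locally square integrable $F:\mathbb R^3\to\mathbb C$ with $F(x+v)=e^{ik\cdot v}F(x)$ for $v\in\Lambda$, with $\langle F,G\rangle=\int_\Omega\overline F\,G$, and for $\sigma^4=1$ let $L^2_{K,\sigma}=\{F\in L^2_{K,\Lambda}:\mathcal RF=\sigma F\}$. Let $\mu_1(k)\le\mu_2(k)\le\dots$ be the eigenvalues of a Schrödinger operator $H=-\Delta+W$ ($W$ admissible) on $k$-pseudo-periodic functions, repeated according to multiplicity (the energy bands). **H1** at $(K,\mu)$: $\mu$ is an eigenvalue of multiplicity three of $H$ on $K$-pseudo-periodic functions, its eigenspace $\mathcal E_\mu$ is orthogonal to $L^2_{K,1}$, and $\dim(\mathcal E_\mu\cap L^2_{K,i})=1$. The *Fermi velocity* at $(K,\mu)$ is the number $\upsilon_{\mathcal F}\ge0$ such that orthonormal bases $\Phi_1,\Phi_2,\Phi_3$ of $\mathcal E_\mu$ with $\Phi_\ell\in L^2_{K,i^\ell}$ and $\Phi_3(x)=\overline{\Phi_1(-x)}$ exist, and for every such basis $\langle\Phi_1,2i\nabla\Phi_2\rangle=\upsilon_1\omega_1$,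 $\langle\Phi_2,2i\nabla\Phi_3\rangle=\upsilon_2\omega_1$, $\langle\Phi_3,2i\nabla\Phi_1\rangle=\upsilon_3\omega_2$ with $\omega_1=\frac1{\sqrt2}(1,-i,0)$, $\omega_2=(0,0,1)$, $\upsilon_\ell\in\mathbb C$ and $|\upsilon_1|=|\upsilon_2|=|\upsilon_3|=\upsilon_{\mathcal F}$. **H2**: the Fermi velocity is nonzero. **Theorem.** Let $V$ be an admissible potential with $V_{1,0,0}>0$. Then there are $\varepsilon_0>0$ and $C$ such that for every $\varepsilon\in(0,\varepsilon_0)$ there is $\mu_*=\mu_*^\varepsilon\in\mathbb R$ such that $H^\varepsilon=-\Delta+\varepsilon V$ satisfies H1 and H2 at $(K,\mu_*)$, its Fermi velocity $\upsilon_{\mathcal F}^\varepsilon>0$ exists, and $$\bigl|\mu_*-\bigl(|K|^2+\varepsilon(V_{0,0,0}-V_{1,0,0})\bigr)\bigr|\le C\varepsilon^2,\qquad |\upsilon_{\mathcal F}^\varepsilon-q|\le C\varepsilon .$$ Moreover the lowest three bands meet at the three-fold Weyl point $(K,\mu_*)$: $\mu_1(K)=\mu_2(K)=\mu_3(K)=\mu_*$,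 and, as $\kappa\to0$, $\kappa\neq 0$, $$\mu_{j}(K+\kappa)=\mu_*+\xi_j(\kappa)\,\upsilon_{\mathcal F}^\varepsilon\,|\kappa|+o(|\kappa|),\qquad j=1,2,3,$$ where $\xi_1\le\xi_2\le\xi_3$ are the three real roots (with multiplicity) of $\xi^3-\xi-2\,\dfrac{\kappa_x\kappa_y\kappa_z}{|\kappa|^3}=0$. -/

import Mathlib

open MeasureTheory InnerProductSpace
open scoped ContDiff Matrix

noncomputable section

namespace ThreefoldWeyl

/-- Euclidean three-space. -/
abbrev E3 := EuclideanSpace ℝ (Fin 3)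

/-! ### Lattice, dual lattice, rotations -/

/-- The basis vectors `v₁, v₂, v₃` of the lattice with lattice constant `a`. -/
def latVec (a : ℝ) : Fin 3 → E3 :=
  ![(a / √3) • !₂[1, -1, -1], (a / √3) • !₂[1, 1, 1], (a / √3) • !₂[-1, 1, -1]]

/-- The scale `q = √3 π / a` of the dual lattice. -/
def qScale (a : ℝ) : ℝ := √3 * Real.pi / a

/-- The dual basis vectors `q₁, q₂, q₃`, with `q_ℓ · v_j = 2π δ_{ℓj}`. -/
def dualVec (a : ℝ) : Fin 3 → E3 :=
  ![qScale a • !₂[1, 0, -1], qScale a • !₂[1, 1, 0], qScale a • !₂[0, 1, -1]]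

/-- The lattice `Λ = ℤv₁ ⊕ ℤv₂ ⊕ ℤv₃`. -/
def lattice (a : ℝ) : Set E3 := {v | ∃ n : Fin 3 → ℤ, v = ∑ j, (n j : ℝ) • latVec a j}

/-- The fundamental period cell `Ω = {x₁v₁ + x₂v₂ + x₃v₃ : 0 ≤ xᵢ ≤ 1}`. -/
def cell (a : ℝ) : Set E3 :=
  {y | ∃ x : Fin 3 → ℝ, (∀ j, 0 ≤ x j ∧ x j ≤ 1) ∧ y = ∑ j, x j • latVec a j}

/-- The high symmetry point `K = -(q₁ + q₂ + q₃)/4`. -/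
def ptK (a : ℝ) : E3 := (-(1 / 4) : ℝ) • (dualVec a 0 + dualVec a 1 + dualVec a 2)

/-- The rotation matrix `R`. -/
def matR : Matrix (Fin 3) (Fin 3) ℝ := !![0, -1, 0; 1, 0, 0; 0, 0, -1]

/-- The rotation matrix `T`. -/
def matT : Matrix (Fin 3) (Fin 3) ℝ := !![-1, 0, 0; 0, 0, -1; 0, 1, 0]

/-- The action `F ↦ F(M* x)` of a real matrix on functions; it is `𝓡` for `M = R` and `𝓣` for
`M = T`. -/
def pull {β : Type*} (M : Matrix (Fin 3) (Fin 3) ℝ) (F : E3 → β) : E3 → β :=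
  fun x => F (Matrix.toEuclideanLin Mᵀ x)

/-! ### Admissible potentials and Fourier coefficients -/

/-- Admissible potentials: smooth, real, `Λ`-periodic, even, `𝓡`- and `𝓣`-invariant. -/
structure IsAdmissible (a : ℝ) (V : E3 → ℝ) : Prop where
  smooth : ContDiff ℝ ∞ V
  periodic : ∀ x, ∀ v ∈ lattice a, V (x + v) = V x
  even : ∀ x, V (-x) = V x
  invR : pull matR V = V
  invT : pull matT V = V

/-- The Fourier coefficient `V_{m₁,m₂,m₃} = |Ω|⁻¹ ∫_Ω V(x) e^{-i q·x} dx`,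
`q = m₁q₁ + m₂q₂ + m₃q₃`. -/
def fourierCoeff (a : ℝ) (V : E3 → ℝ) (m : Fin 3 → ℤ) : ℂ :=
  ((volume.real (cell a))⁻¹ : ℝ) *
    ∫ x in cell a, (V x : ℂ) *
      Complex.exp (-Complex.I * (inner ℝ (∑ j, (m j : ℝ) • dualVec a j) x : ℝ))

/-! ### Pseudo-periodic functions -/

/-- `F(x + v) = e^{i k·v} F(x)` for all `x` and all `v ∈ Λ`. -/
def IsPseudoPeriodic (a : ℝ) (k : E3) (F : E3 → ℂ) : Prop :=
  ∀ x, ∀ v ∈ lattice a, F (x + v) = Complex.exp (Complex.I * (inner ℝ k v : ℝ)) * F x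

/-- The space `L²_{k,Λ}` of locally square integrable `k`-pseudo-periodic functions. -/
def pseudoL2 (a : ℝ) (k : E3) : Submodule ℂ (E3 → ℂ) where
  carrier := {F | (∀ s : Set E3, IsCompact s → MemLp F 2 (volume.restrict s)) ∧
    IsPseudoPeriodic a k F}
  zero_mem' := ⟨fun _ _ => MemLp.zero, fun _ _ _ => by simp⟩
  add_mem' := fun {F G} hF hG => ⟨fun s hs => (hF.1 s hs).add (hG.1 s hs), fun x v hv => by
    simp only [Pi.add_apply, hF.2 x v hv, hG.2 x v hv, mul_add]⟩
  smul_mem' := fun c F hF => ⟨fun s hs => (hF.1 s hs).const_smul c, fun x v hv => by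
    simp only [Pi.smul_apply, smul_eq_mul, hF.2 x v hv]; ring⟩

/-- The subspace `L²_{K,σ} = {F ∈ L²_{K,Λ} : 𝓡F = σF}`. -/
def sector (a : ℝ) (σ : ℂ) : Submodule ℂ (E3 → ℂ) where
  carrier := {F | F ∈ pseudoL2 a (ptK a) ∧ pull matR F = σ • F}
  zero_mem' := ⟨Submodule.zero_mem _, by ext; simp [pull]⟩
  add_mem' := fun {F G} hF hG => ⟨Submodule.add_mem _ hF.1 hG.1, by
    rw [smul_add, ← hF.2, ← hG.2]; rfl⟩
  smul_mem' := fun c F hF => ⟨Submodule.smul_mem _ c hF.1, by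
    rw [smul_comm, ← hF.2]; rfl⟩

/-- The inner product `⟨F, G⟩ = ∫_Ω conj(F) G`. -/
def cellInner (a : ℝ) (F G : E3 → ℂ) : ℂ :=
  ∫ x in cell a, (starRingEnd ℂ) (F x) * G x

/-- The vector `⟨F, 2i∇G⟩ ∈ ℂ³`. -/
def gradInner (a : ℝ) (F G : E3 → ℂ) : Fin 3 → ℂ := fun j =>
  cellInner a F fun x => 2 * Complex.I * fderiv ℝ G x (EuclideanSpace.single j 1)

/-! ### The Floquet-Bloch eigenvalue problem -/

/-- The eigenspace of `H = -Δ + V` with quasi-momentum `k` and eigenvalue `μ`: all `C²`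
functions with `-ΔF + VF = μF` on `ℝ³` that are `k`-pseudo-periodic. -/
def eigenspace (a : ℝ) (V : E3 → ℝ) (k : E3) (μ : ℝ) : Submodule ℂ (E3 → ℂ) where
  carrier := {F | ContDiff ℝ 2 F ∧ IsPseudoPeriodic a k F ∧
    ∀ x, -(Laplacian.laplacian F x) + (V x : ℂ) * F x = (μ : ℂ) * F x}
  zero_mem' := ⟨contDiff_const, fun _ _ _ => by simp, fun x => by
    have h : Laplacian.laplacian (0 : E3 → ℂ) = 0 := laplacian_const (c := (0 : ℂ))
    simp [h]⟩
  add_mem' := fun {F G} hF hG => ⟨hF.1.add hG.1, fun x v hv => by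
    simp only [Pi.add_apply, hF.2.1 x v hv, hG.2.1 x v hv, mul_add], fun x => by
    rw [hF.1.contDiffAt.laplacian_add hG.1.contDiffAt, Pi.add_apply]
    linear_combination hF.2.2 x + hG.2.2 x⟩
  smul_mem' := fun c F hF => ⟨hF.1.const_smul c, fun x v hv => by
    simp only [Pi.smul_apply, smul_eq_mul, hF.2.1 x v hv]; ring, fun x => by
    rw [laplacian_smul c hF.1.contDiffAt, Pi.smul_apply, smul_eq_mul, smul_eq_mul]
    linear_combination c * hF.2.2 x⟩

/-- The span of all eigenfunctions with quasi-momentum `k` and eigenvalue in `I`. Its dimension is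
the number of eigenvalues in `I`, counted with multiplicity. -/
def spectralSpan (a : ℝ) (V : E3 → ℝ) (k : E3) (I : Set ℝ) : Submodule ℂ (E3 → ℂ) :=
  ⨆ ν ∈ I, eigenspace a V k ν

/-- `μ` is the value `μ_b(k)` of the `b`-th energy band, `b ≥ 1`: the `b`-th entry of the list
`μ₁(k) ≤ μ₂(k) ≤ …` of all eigenvalues, each repeated according to its multiplicity. -/
def IsBandValue (a : ℝ) (V : E3 → ℝ) (k : E3) (b : ℕ) (μ : ℝ) : Prop :=
  Module.rank ℂ (spectralSpan a V k (Set.Iio μ)) < (b : Cardinal) ∧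
    (b : Cardinal) ≤ Module.rank ℂ (spectralSpan a V k (Set.Iic μ))

/-! ### The assumptions H1 and H2, the Fermi velocity -/

/-- Assumption H1: `μ` is a three-fold eigenvalue at `K`, the eigenspace is orthogonal to `L²_{K,1}`
and meets `L²_{K,i}` in dimension one. -/
structure AssumptionH1 (a : ℝ) (V : E3 → ℝ) (μ : ℝ) : Prop where
  threefold : Module.finrank ℂ (eigenspace a V (ptK a) μ) = 3
  orthogonal : ∀ F ∈ eigenspace a V (ptK a) μ, ∀ G ∈ sector a 1, cellInner a F G = 0
  simple : Module.finrank ℂ ↥(eigenspace a V (ptK a) μ ⊓ sector a Complex.I) = 1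

/-- An orthonormal basis `Φ₁, Φ₂, Φ₃` of the eigenspace with `Φ_ℓ ∈ L²_{K,i^ℓ}` and
`Φ₃(x) = conj(Φ₁(-x))`; here `Φ_ℓ` is `Φ (ℓ - 1)`. -/
structure IsAdaptedBasis (a : ℝ) (V : E3 → ℝ) (μ : ℝ) (Φ : Fin 3 → E3 → ℂ) : Prop where
  mem_sector : ∀ ℓ : Fin 3, Φ ℓ ∈ sector a (Complex.I ^ ((ℓ : ℕ) + 1))
  span_eq : Submodule.span ℂ (Set.range Φ) = eigenspace a V (ptK a) μ
  orthonormal : ∀ ℓ m : Fin 3, cellInner a (Φ ℓ) (Φ m) = if ℓ = m then 1 else 0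
  conj_eq : ∀ x, Φ 2 x = (starRingEnd ℂ) (Φ 0 (-x))

/-- The eigenvector `ω₁ = (1, -i, 0)/√2` of `R`. -/
def omega1 : Fin 3 → ℂ := ((√2 : ℝ) : ℂ)⁻¹ • ![1, -Complex.I, 0]

/-- The eigenvector `ω₂ = (0, 0, 1)` of `R`. -/
def omega2 : Fin 3 → ℂ := ![0, 0, 1]

/-- `v` is the Fermi velocity of `H = -Δ + V` at `(K, μ)`: adapted bases exist, and for each of them
`⟨Φ₁, 2i∇Φ₂⟩ = υ₁ω₁`, `⟨Φ₂, 2i∇Φ₃⟩ = υ₂ω₁`, `⟨Φ₃, 2i∇Φ₁⟩ = υ₃ω₂` with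
`|υ₁| = |υ₂| = |υ₃| = v`. -/
def IsFermiVelocity (a : ℝ) (V : E3 → ℝ) (μ v : ℝ) : Prop :=
  (∃ Φ, IsAdaptedBasis a V μ Φ) ∧
    ∀ Φ, IsAdaptedBasis a V μ Φ → ∃ υ₁ υ₂ υ₃ : ℂ,
      gradInner a (Φ 0) (Φ 1) = υ₁ • omega1 ∧
      gradInner a (Φ 1) (Φ 2) = υ₂ • omega1 ∧
      gradInner a (Φ 2) (Φ 0) = υ₃ • omega2 ∧
      ‖υ₁‖ = v ∧ ‖υ₂‖ = v ∧ ‖υ₃‖ = v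

/-- Assumption H2: the Fermi velocity does not vanish. -/
def AssumptionH2 (a : ℝ) (V : E3 → ℝ) (μ : ℝ) : Prop :=
  ∃ v, IsFermiVelocity a V μ v ∧ v ≠ 0

/-! ### Three-fold Weyl points -/

/-- `ξ` lists in increasing order, with multiplicity, the roots of `ξ³ - ξ + 2sκ^arg`, where
`κ^arg = κ_x κ_y κ_z / |κ|³`. -/
def IsConeRoots (s : ℝ) (κ : E3) (ξ : Fin 3 → ℝ) : Prop :=
  Monotone ξ ∧ ∀ t : ℝ, (t - ξ 0) * (t - ξ 1) * (t - ξ 2) =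
    t ^ 3 - t + 2 * s * (κ 0 * κ 1 * κ 2 / ‖κ‖ ^ 3)

/-- The bands `b, b+1, b+2` of `H = -Δ + V` meet at `(K, μ)` in a three-fold Weyl point with
velocity `v` and sign `s`: `μ_b(K) = μ_{b+1}(K) = μ_{b+2}(K) = μ`, and, as `κ → 0`,
`μ_{b+j}(K + κ) = μ + ξ_j v|κ| + o(|κ|)` for `j = 0, 1, 2`, with `ξ₀ ≤ ξ₁ ≤ ξ₂` the roots of
`ξ³ - ξ + 2sκ^arg = 0`. -/
def IsThreefoldWeylPoint (a : ℝ) (V : E3 → ℝ) (s : ℝ) (b : ℕ) (μ v : ℝ) : Prop :=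
  0 < v ∧ (∀ j : Fin 3, IsBandValue a V (ptK a) (b + j) μ) ∧
    ∀ η > 0, ∃ δ > 0, ∀ κ : E3, κ ≠ 0 → ‖κ‖ < δ →
      ∃ ξ m : Fin 3 → ℝ, IsConeRoots s κ ξ ∧
        ∀ j : Fin 3, IsBandValue a V (ptK a + κ) (b + j) (m j) ∧
          |m j - (μ + ξ j * v * ‖κ‖)| ≤ η * ‖κ‖

end ThreefoldWeyl

end

noncomputable section

namespace ThreefoldWeyl

/-! ### Diagonal plus bounded operators on `ℓ²` -/

/-! On the Fourier side a function of quasi-momentum k is a square summable family indexed by the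
momenta p in k + Λ*, and H becomes multiplication by |p|² plus a convolution, bounded because V is
smooth. Eigenvectors in ℓ² decay fast enough to be the coefficients of C² eigenfunctions, so all
counting of eigenvalues can be done in ℓ² (`rank_spectralSpan`). The unbounded operator enters only
through its graph `HRel`. Min-max takes two forms: a subspace of trial vectors bounds the number of
eigenvalues from below (`le_rank_seqSpan`), and finitely many functionals bound it from above
(`rank_seqSpan_le`).

At K four momenta have the least energy 3q²/4, and all others have energy at least 11q²/4. For small
ε there are thus exactly four eigenvalues below 7q²/4, and a vector in the span of their
eigenvectors is determined by its four low entries (`eq_of_lowMap_eq`, `exists_lowMap_eq`). The maps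
R and T permute these entries, so this span is a copy of the permutation representation on ℂ⁴, which
splits into the constants and a three-dimensional complement. Hence there is a threefold eigenvalue
μ and a simple one μ₀ (`exists_isLowTriple`). The eigenvalue equation at the mode K gives μ = 3q²/4
+ ε(V₀₀₀ - V₁₀₀) + O(ε²) and μ₀ = 3q²/4 + ε(V₀₀₀ + 3V₁₀₀) + O(ε²). Since V₁₀₀ > 0, the triple level
lies at the bottom and is isolated.

The triple eigenspace has a real basis f₀, f₁, f₂ which R and T permute up to sign. These signs kill
every matrix element of the momentum between f_i and f_k in direction j unless i, k, j are distinct,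
and the remaining ones all equal one number v/2 (`IsLowTriple.momEl_eq`). The low modes contribute
q/2 to it and the tails O(ε²), so v is close to q. In this basis R is an explicit signed permutation
with eigenvalues i, -1, -i. This yields H1, and every adapted basis equals an explicit one up to
phases, so that v is the Fermi velocity.

Near K one has H(K+κ) = H(K) + 2κ·p + |κ|². On the triple eigenspace 2κ·p is v|κ| times a symmetric
matrix with characteristic polynomial ξ³ - ξ - 2κ_xκ_yκ_z/|κ|³. Its eigenvectors as trial vectors
give the upper bounds (`IsWeylData.le_rank`). The lower bounds come from the functionals dual to the
first j of them, with the coupling to the other states absorbed by the gap (`IsWeylData.rank_le`).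
-/

/-- The Hilbert space of square summable families. -/
abbrev Ell2 (ι : Type*) := lp (fun _ : ι => ℂ) 2

section Abstract

variable {ι : Type*} {d : ι → ℝ} {B : Ell2 ι →L[ℂ] Ell2 ι}

/-- The graph of the operator `d + B`, where `d` acts by multiplication. -/
def HRel (d : ι → ℝ) (B : Ell2 ι →L[ℂ] Ell2 ι) (u v : Ell2 ι) : Prop :=
  ∀ m, (d m : ℂ) * u m + B u m = v m

theorem HRel.zero : HRel d B 0 0 := fun m => by simp

theorem HRel.add {u v u' v' : Ell2 ι} (h : HRel d B u v) (h' : HRel d B u' v') :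
    HRel d B (u + u') (v + v') := fun m => by
  simp only [map_add, lp.coeFn_add, Pi.add_apply, ← h m, ← h' m]; ring

theorem HRel.smul {u v : Ell2 ι} (c : ℂ) (h : HRel d B u v) : HRel d B (c • u) (c • v) :=
  fun m => by
    simp only [map_smul, lp.coeFn_smul, Pi.smul_apply, smul_eq_mul, ← h m]; ring

theorem HRel.sub {u v u' v' : Ell2 ι} (h : HRel d B u v) (h' : HRel d B u' v') :
    HRel d B (u - u') (v - v') := fun m => by
  simp only [map_sub, lp.coeFn_sub, Pi.sub_apply, ← h m, ← h' m]; ring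

theorem HRel.sum {α : Type*} (s : Finset α) {u v : α → Ell2 ι}
    (h : ∀ i ∈ s, HRel d B (u i) (v i)) : HRel d B (∑ i ∈ s, u i) (∑ i ∈ s, v i) := by
  classical
  induction s using Finset.induction_on with
  | empty => simpa using HRel.zero
  | insert i s hi ih =>
    rw [Finset.sum_insert hi, Finset.sum_insert hi]
    exact (h i (by simp)).add (ih fun j hj => h j (by simp [hj]))

theorem HRel.unique {u v v' : Ell2 ι} (h : HRel d B u v) (h' : HRel d B u v') : v = v' := by
  ext m; rw [← h m, ← h' m]

/-- Subtracting the bounded part leaves multiplication by the real family `d`, which is symmetric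
term by term; the symmetry of `B` then restores the full operator. -/
theorem HRel.inner_eq (hB : B.IsSymmetric) {u v u' v' : Ell2 ι}
    (h : HRel d B u v) (h' : HRel d B u' v') : inner ℂ u v' = inner ℂ v u' := by
  have e1 : inner ℂ u (v' - B u') = inner ℂ (v - B u) u' := by
    rw [lp.inner_eq_tsum, lp.inner_eq_tsum]
    congr 1; ext m
    have a1 : (v' - B u') m = d m * u' m := by
      rw [lp.coeFn_sub, Pi.sub_apply, ← h' m]; ring
    have a2 : (v - B u) m = d m * u m := by
      rw [lp.coeFn_sub, Pi.sub_apply, ← h m]; ring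
    rw [a1, a2]
    simp only [RCLike.inner_apply, map_mul, Complex.conj_ofReal]
    ring
  rw [inner_sub_right, inner_sub_left] at e1
  have e2 : inner ℂ (B u) u' = inner ℂ u (B u') := hB u u'
  rw [e2] at e1
  exact sub_left_inj.mp e1

/-- The eigenspace of `d + B` for the eigenvalue `μ`. -/
def seqEigenspace (d : ι → ℝ) (B : Ell2 ι →L[ℂ] Ell2 ι) (μ : ℝ) : Submodule ℂ (Ell2 ι) where
  carrier := {u | HRel d B u ((μ : ℂ) • u)}
  zero_mem' := by
    change HRel d B _ _
    rw [smul_zero]; exact HRel.zero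
  add_mem' := fun {u v} hu hv => by
    change HRel d B _ _
    rw [smul_add]; exact HRel.add hu hv
  smul_mem' := fun c u hu => by
    change HRel d B _ _
    rw [smul_comm]; exact HRel.smul c hu

theorem mem_seqEigenspace {μ : ℝ} {u : Ell2 ι} :
    u ∈ seqEigenspace d B μ ↔ HRel d B u ((μ : ℂ) • u) := Iff.rfl

/-- The span of all eigenvectors with eigenvalue in `I`. -/
def seqSpan (d : ι → ℝ) (B : Ell2 ι →L[ℂ] Ell2 ι) (I : Set ℝ) : Submodule ℂ (Ell2 ι) :=
  ⨆ ν ∈ I, seqEigenspace d B ν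

theorem seqEigenspace_le_seqSpan {I : Set ℝ} {μ : ℝ} (h : μ ∈ I) :
    seqEigenspace d B μ ≤ seqSpan d B I := le_biSup (seqEigenspace d B) h

theorem seqSpan_mono {I J : Set ℝ} (h : I ⊆ J) : seqSpan d B I ≤ seqSpan d B J :=
  biSup_mono h

theorem inner_eq_zero_of_seqEigenspace (hB : B.IsSymmetric) {μ ν : ℝ} (hμν : μ ≠ ν)
    {u v : Ell2 ι} (hu : u ∈ seqEigenspace d B μ) (hv : v ∈ seqEigenspace d B ν) :
    inner ℂ u v = 0 := by
  have h := HRel.inner_eq hB hu hv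
  rw [inner_smul_left, inner_smul_right, Complex.conj_ofReal] at h
  have h2 : ((ν : ℂ) - μ) * inner ℂ u v = 0 := by linear_combination h
  rcases mul_eq_zero.mp h2 with h3 | h3
  · exact absurd (by exact_mod_cast (sub_eq_zero.mp h3).symm) hμν
  · exact h3

theorem orthogonalFamily_seqEigenspace (hB : B.IsSymmetric) :
    OrthogonalFamily ℂ (fun ν : ℝ => seqEigenspace d B ν)
      fun ν => (seqEigenspace d B ν).subtypeₗᵢ :=
  fun _ _ hμν u v => inner_eq_zero_of_seqEigenspace hB hμν u.2 v.2

theorem mem_seqSpan {I : Set ℝ} {u : Ell2 ι} (hu : u ∈ seqSpan d B I) :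
    ∃ f : ℝ →₀ Ell2 ι, (∀ ν, f ν ∈ seqEigenspace d B ν) ∧ (∀ ν ∈ f.support, ν ∈ I) ∧
      ∑ ν ∈ f.support, f ν = u := by
  classical
  rw [seqSpan] at hu
  obtain ⟨f, hf, hs⟩ := (Submodule.mem_iSup_iff_exists_finsupp _ u).1 hu
  refine ⟨f, fun ν => ?_, fun ν hν => ?_, hs⟩
  · by_cases h : ν ∈ I
    · simpa [h] using hf ν
    · have := hf ν
      simp only [h, iSup_of_empty, Submodule.mem_bot] at this
      rw [this]; exact Submodule.zero_mem _
  · by_contra h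
    have := hf ν
    simp only [h, not_false_eq_true, iSup_neg, Submodule.mem_bot] at this
    exact (Finsupp.mem_support_iff.1 hν) this

/-- On the span of the eigenvectors with eigenvalues `≤ μ` the form of `d + B` is `≤ μ`. -/
theorem exists_hRel_of_mem_seqSpan_Iic (hB : B.IsSymmetric) {μ : ℝ} {u : Ell2 ι}
    (hu : u ∈ seqSpan d B (Set.Iic μ)) :
    ∃ v ∈ seqSpan d B (Set.Iic μ), HRel d B u v ∧ (inner ℂ u v).re ≤ μ * ‖u‖ ^ 2 := by
  obtain ⟨f, hf, hI, rfl⟩ := mem_seqSpan hu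
  refine ⟨∑ ν ∈ f.support, (ν : ℂ) • f ν, Submodule.sum_mem _ fun ν hν =>
    Submodule.smul_mem _ _ (seqEigenspace_le_seqSpan (hI ν hν) (hf ν)),
    HRel.sum _ fun ν _ => hf ν, ?_⟩
  -- Eigenspaces of different eigenvalues are orthogonal, so the norm and the form both split over
  -- the finitely many eigenvalues involved.
  have hn : ‖∑ ν ∈ f.support, f ν‖ ^ 2 = ∑ ν ∈ f.support, ‖f ν‖ ^ 2 :=
    (orthogonalFamily_seqEigenspace hB).norm_sum (fun ν => ⟨f ν, hf ν⟩) f.support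
  have hi : inner ℂ (∑ ν ∈ f.support, f ν) (∑ ν ∈ f.support, (ν : ℂ) • f ν) =
      ∑ ν ∈ f.support, (ν : ℂ) * (‖f ν‖ : ℂ) ^ 2 := by
    rw [sum_inner]
    refine Finset.sum_congr rfl fun ν hν => ?_
    rw [inner_sum, Finset.sum_eq_single_of_mem ν hν, inner_smul_right,
      inner_self_eq_norm_sq_to_K]
    · rfl
    · intro ν' _ hne
      rw [inner_smul_right, inner_eq_zero_of_seqEigenspace hB hne.symm (hf ν) (hf ν'), mul_zero]
  rw [hi, hn, Complex.re_sum, Finset.mul_sum]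
  refine Finset.sum_le_sum fun ν hν => ?_
  have : ((ν : ℂ) * (‖f ν‖ : ℂ) ^ 2).re = ν * ‖f ν‖ ^ 2 := by
    rw [← Complex.ofReal_pow, ← Complex.ofReal_mul, Complex.ofReal_re]
  rw [this]
  exact mul_le_mul_of_nonneg_right (hI ν hν) (by positivity)

/-- If the form of `d + B` is `> μ` on the common kernel of `n` functionals, there are at most `n`
eigenvalues `≤ μ`. -/
theorem rank_seqSpan_le (hB : B.IsSymmetric) {μ : ℝ} {n : ℕ} (L : Ell2 ι →ₗ[ℂ] (Fin n → ℂ))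
    (hL : ∀ u v, HRel d B u v → L u = 0 → u ≠ 0 → μ * ‖u‖ ^ 2 < (inner ℂ u v).re) :
    Module.rank ℂ (seqSpan d B (Set.Iic μ)) ≤ n := by
  -- A spectral vector killed by all functionals would have form at most μ and greater than μ at
  -- once.
  have hinj : Function.Injective (L.comp (seqSpan d B (Set.Iic μ)).subtype) := by
    rw [← LinearMap.ker_eq_bot, LinearMap.ker_eq_bot']
    intro u hu
    by_contra hne
    obtain ⟨v, -, hv, hle⟩ := exists_hRel_of_mem_seqSpan_Iic hB u.2
    exact absurd (hL u v hv hu fun h => hne (Subtype.ext h)) (not_lt.2 hle)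
  have := LinearMap.lift_rank_le_of_injective _ hinj
  simpa using this

/-! ### Compact resolvent -/

/-- Multiplication by a bounded family. -/
def diagOp (b : ι → ℝ) (C : ℝ) (hb : ∀ m, |b m| ≤ C) : Ell2 ι →L[ℂ] Ell2 ι :=
  LinearMap.mkContinuous
    { toFun := fun u => ⟨fun m => (b m : ℂ) * u m, by
        refine Memℓp.mono' (g := fun m => C * u m) ?_ ?_
        · simpa using! (lp.memℓp u).const_mul (C : ℂ)
        · intro m
          rw [norm_mul, norm_mul, Complex.norm_real, Complex.norm_real]
          exact mul_le_mul_of_nonneg_right ((hb m).trans (le_abs_self C)) (norm_nonneg _)⟩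
      map_add' := fun u v => by ext m; exact mul_add _ _ _
      map_smul' := fun c u => by ext m; exact mul_left_comm _ _ _ }
    |C| fun u => by
      have h : ‖((|C| : ℝ) : ℂ) • u‖ = |C| * ‖u‖ := by
        rw [norm_smul, Complex.norm_real, Real.norm_eq_abs, abs_abs]
      rw [← h]
      refine lp.norm_mono (by simp) fun m => ?_
      simp only [LinearMap.coe_mk, AddHom.coe_mk, lp.coeFn_smul, Pi.smul_apply, smul_eq_mul,
        norm_mul, Complex.norm_real, Real.norm_eq_abs, abs_abs]
      exact mul_le_mul_of_nonneg_right ((hb m).trans (le_abs_self C)) (norm_nonneg _)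

@[simp] theorem diagOp_apply (b : ι → ℝ) (C : ℝ) (hb : ∀ m, |b m| ≤ C) (u : Ell2 ι) (m : ι) :
    diagOp b C hb u m = b m * u m := rfl

theorem norm_diagOp_le (b : ι → ℝ) (C : ℝ) (hC : 0 ≤ C) (hb : ∀ m, |b m| ≤ C) :
    ‖diagOp b C hb‖ ≤ C :=
  (LinearMap.mkContinuous_norm_le _ (abs_nonneg C) _).trans (abs_of_nonneg hC).le

/-- Norm limit of finite rank truncations: only finitely many entries of `b` exceed a given
threshold. -/
theorem isCompactOperator_diagOp (b : ι → ℝ) (C : ℝ) (hb : ∀ m, |b m| ≤ C)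
    (h0 : Filter.Tendsto b Filter.cofinite (nhds 0)) : IsCompactOperator (diagOp b C hb) := by
  classical
  let F : Finset ι → (Ell2 ι →L[ℂ] Ell2 ι) := fun s =>
    ∑ m ∈ s, (b m : ℂ) • ((lp.singleContinuousLinearMap ℂ (fun _ : ι => ℂ) 2 m).comp
      (lp.evalCLM ℂ (fun _ : ι => ℂ) 2 m))
  have hF : ∀ s u m, F s u m = if m ∈ s then (b m : ℂ) * u m else 0 := by
    intro s u m
    simp only [F, sum_apply, smul_apply,
      ContinuousLinearMap.comp_apply, lp.coeFn_sum, Finset.sum_apply, lp.coeFn_smul,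
      Pi.smul_apply, lp.singleContinuousLinearMap_apply, smul_eq_mul]
    by_cases hm : m ∈ s
    · rw [Finset.sum_eq_single_of_mem m hm]
      · simp [hm, lp.evalCLM]
      · intro j _ hj
        rw [lp.single_apply_ne 2 j _ hj.symm, mul_zero]
    · rw [if_neg hm]
      refine Finset.sum_eq_zero fun j hj => ?_
      rw [lp.single_apply_ne 2 j _ (fun h => hm (by rw [h]; exact hj)), mul_zero]
  have hcF : ∀ s, IsCompactOperator (F s) := by
    intro s
    induction s using Finset.induction_on with
    | empty => simpa [F] using! isCompactOperator_zero
    | insert i s hi ih =>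
      have hsum : F (insert i s) = (b i : ℂ) •
          ((lp.singleContinuousLinearMap ℂ (fun _ : ι => ℂ) 2 i).comp
            (lp.evalCLM ℂ (fun _ : ι => ℂ) 2 i)) + F s := Finset.sum_insert hi
      rw [hsum]
      exact IsCompactOperator.add (IsCompactOperator.smul (IsCompactOperator.comp_clm
        (isCompactOperator_of_locallyCompactSpace_rng
          (lp.singleContinuousLinearMap ℂ (fun _ : ι => ℂ) 2 i))
        (lp.evalCLM ℂ (fun _ : ι => ℂ) 2 i)) (b i : ℂ)) ih
  refine isCompactOperator_of_tendsto (F := F) (l := Filter.atTop) ?_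
    (Filter.Eventually.of_forall hcF)
  rw [Metric.tendsto_nhds]
  intro η hη
  have hfin : {m | ¬ |b m| < η / 2}.Finite := by
    have := (Metric.tendsto_nhds.1 h0) (η / 2) (by positivity)
    simpa [Real.dist_eq] using this
  filter_upwards [Filter.eventually_ge_atTop hfin.toFinset] with s hs
  rw [dist_eq_norm]
  refine lt_of_le_of_lt (ContinuousLinearMap.opNorm_le_bound _ (by positivity : (0:ℝ) ≤ η / 2)
    fun u => ?_) (half_lt_self hη)
  have h : ‖((η / 2 : ℝ) : ℂ) • u‖ = η / 2 * ‖u‖ := by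
    rw [norm_smul, Complex.norm_real, Real.norm_eq_abs, abs_of_pos (by positivity)]
  rw [← h]
  refine lp.norm_mono (by simp) fun m => ?_
  simp only [sub_apply, lp.coeFn_sub, Pi.sub_apply, hF, diagOp_apply,
    lp.coeFn_smul, Pi.smul_apply, smul_eq_mul, norm_mul, Complex.norm_real, Real.norm_eq_abs,
    abs_of_pos (half_pos hη)]
  by_cases hm : m ∈ s
  · simp only [hm, if_true, sub_self, norm_zero]; positivity
  · have hm' : |b m| < η / 2 := by
      by_contra hcon
      exact hm (hs (hfin.mem_toFinset.2 hcon))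
    simp only [hm, if_false, zero_sub, norm_neg, norm_mul, Complex.norm_real, Real.norm_eq_abs]
    exact mul_le_mul_of_nonneg_right hm'.le (norm_nonneg _)

end Abstract

section

/-! ### Resolvent, min-max lower bound and selection of a band -/

section Abstract

variable {ι : Type*} {d : ι → ℝ} {B : Ell2 ι →L[ℂ] Ell2 ι}

/-- The form of a diagonal operator bounded below is bounded below. -/
theorem HRel.le_re_inner {u v : Ell2 ι} (h : HRel d B u v) {c : ℝ} (hd : ∀ m, u m ≠ 0 → c ≤ d m) :
    (c - ‖B‖) * ‖u‖ ^ 2 ≤ (inner ℂ u v).re := by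
  have h1 : c * ‖u‖ ^ 2 ≤ (inner ℂ u (v - B u)).re := by
    have e1 := lp.hasSum_inner (𝕜 := ℂ) u (v - B u)
    have e2 := Complex.hasSum_re e1
    have e3 : HasSum (fun m => ‖u m‖ ^ 2) (‖u‖ ^ 2) := by
      have := lp.hasSum_norm (p := 2) (by norm_num) u
      simpa using this
    refine hasSum_le (fun m => ?_) (e3.mul_left c) e2
    have a1 : (v - B u) m = d m * u m := by
      rw [lp.coeFn_sub, Pi.sub_apply, ← h m]; ring
    rw [a1]
    have : (inner ℂ (u m) ((d m : ℂ) * u m)).re = d m * ‖u m‖ ^ 2 := by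
      rw [RCLike.inner_apply, mul_assoc, Complex.mul_conj, Complex.normSq_eq_norm_sq,
        ← Complex.ofReal_mul, Complex.ofReal_re]
    rw [this]
    by_cases h0 : u m = 0
    · simp [h0]
    · exact mul_le_mul_of_nonneg_right (hd m h0) (by positivity)
  have h2 : -(‖B‖ * ‖u‖ ^ 2) ≤ (inner ℂ u (B u)).re := by
    have : |(inner ℂ u (B u)).re| ≤ ‖u‖ * (‖B‖ * ‖u‖) :=
      (Complex.abs_re_le_norm _).trans ((norm_inner_le_norm _ _).trans
        (mul_le_mul_of_nonneg_left (B.le_opNorm u) (norm_nonneg _)))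
    have := (abs_le.1 this).1
    nlinarith
  rw [inner_sub_right, Complex.sub_re] at h1
  linarith

/-- The resolvent of `d + B` at a point far below the spectrum. -/
theorem exists_resolvent (hd : Filter.Tendsto d Filter.cofinite Filter.atTop)
    {c : ℝ} (hc : ∀ m, 1 + 2 * ‖B‖ ≤ d m + c) :
    ∃ A : Ell2 ι →L[ℂ] Ell2 ι, IsCompactOperator A ∧
      (∀ g, HRel d B (A g) (g - (c : ℂ) • A g)) ∧
      ∀ u v, HRel d B u v → A (v + (c : ℂ) • u) = u := by
  have hM : 0 ≤ ‖B‖ := norm_nonneg B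
  have hpos : ∀ m, 0 < d m + c := fun m => by linarith [hc m]
  have hb : ∀ m, |(d m + c)⁻¹| ≤ (1 + 2 * ‖B‖)⁻¹ := fun m => by
    rw [abs_of_pos (inv_pos.2 (hpos m))]
    exact inv_anti₀ (by positivity) (hc m)
  let S := diagOp (fun m => (d m + c)⁻¹) (1 + 2 * ‖B‖)⁻¹ hb
  have hS : ‖S‖ ≤ (1 + 2 * ‖B‖)⁻¹ := norm_diagOp_le _ _ (by positivity) hb
  have hSc : IsCompactOperator S := isCompactOperator_diagOp _ _ hb
    (tendsto_inv_atTop_zero.comp (Filter.tendsto_atTop_add_const_right _ c hd))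
  -- Neumann series: with S = (d + c)⁻¹ the resolvent is S(1 + BS)⁻¹, and ‖BS‖ is at most ‖B‖/(1 +
  -- 2‖B‖). Compactness is inherited from S.
  have hlt : ‖-(B * S)‖ < 1 := by
    rw [norm_neg]
    calc ‖B * S‖ ≤ ‖B‖ * (1 + 2 * ‖B‖)⁻¹ :=
          (norm_mul_le _ _).trans (mul_le_mul_of_nonneg_left hS hM)
      _ < 1 := by
          rw [← div_eq_mul_inv, div_lt_one (by positivity)]; linarith
  obtain ⟨w, hw⟩ := isUnit_one_sub_of_norm_lt_one hlt
  rw [sub_neg_eq_add] at hw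
  let N : Ell2 ι →L[ℂ] Ell2 ι := ↑w⁻¹
  have hN1 : ∀ g, N g + B (S (N g)) = g := fun g => by
    have : (↑w * ↑w⁻¹ : Ell2 ι →L[ℂ] Ell2 ι) g = g := by rw [Units.mul_inv]; rfl
    rw [hw] at this
    exact this
  have hN2 : ∀ g, N (g + B (S g)) = g := fun g => by
    have : (↑w⁻¹ * ↑w : Ell2 ι →L[ℂ] Ell2 ι) g = g := by rw [Units.inv_mul]; rfl
    rw [hw] at this
    exact this
  refine ⟨S * N, hSc.comp_clm N, fun g m => ?_, fun u v h => ?_⟩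
  · change (d m : ℂ) * S (N g) m + B (S (N g)) m = (g - (c : ℂ) • S (N g)) m
    have e1 : (N g + B (S (N g))) m = g m := by rw [hN1]
    have e2 : ((d m : ℂ) + c) * S (N g) m = N g m := by
      have hne : (d m : ℂ) + c ≠ 0 := by exact_mod_cast (hpos m).ne'
      change ((d m : ℂ) + c) * ((((d m + c)⁻¹ : ℝ) : ℂ) * N g m) = N g m
      push_cast
      rw [← mul_assoc, mul_inv_cancel₀ hne, one_mul]
    rw [lp.coeFn_add, Pi.add_apply, ← e2] at e1
    simp only [lp.coeFn_sub, Pi.sub_apply, lp.coeFn_smul, Pi.smul_apply, smul_eq_mul]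
    linear_combination e1
  · have hg : S (v + (c : ℂ) • u - B u) = u := by
      ext m
      have hne : (d m : ℂ) + c ≠ 0 := by exact_mod_cast (hpos m).ne'
      change (((d m + c)⁻¹ : ℝ) : ℂ) * (v m + (c : ℂ) * u m - B u m) = u m
      rw [← h m]
      push_cast
      field_simp
      ring
    have := hN2 (v + (c : ℂ) • u - B u)
    rw [hg, sub_add_cancel] at this
    change S (N _) = u
    rw [this, hg]

/-- The variational characterization of the number of eigenvalues `≤ μ`, lower bound. -/
theorem le_rank_seqSpan (hB : B.IsSymmetric)
    (hd : Filter.Tendsto d Filter.cofinite Filter.atTop) (hd0 : ∀ m, 0 ≤ d m) {μ : ℝ}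
    (U : Submodule ℂ (Ell2 ι)) [FiniteDimensional ℂ U]
    (hU : ∀ u ∈ U, ∃ v, HRel d B u v ∧ (inner ℂ u v).re ≤ μ * ‖u‖ ^ 2) :
    (Module.finrank ℂ U : Cardinal) ≤ Module.rank ℂ (seqSpan d B (Set.Iic μ)) := by
  by_contra! hlt
  set S := seqSpan d B (Set.Iic μ) with hSdef
  have hfin : FiniteDimensional ℂ S :=
    Module.rank_lt_aleph0_iff.1 (hlt.trans (Cardinal.natCast_lt_aleph0))
  have hlt' : Module.finrank ℂ S < Module.finrank ℂ U := by
    rw [← Module.finrank_eq_rank] at hlt; exact_mod_cast hlt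
  -- With d ≥ 0 this shift makes the form of d + B + c at least 1 + ‖B‖, so the resolvent exists and
  -- is positive.
  obtain ⟨c, hc⟩ : ∃ c : ℝ, c = 1 + 2 * ‖B‖ := ⟨_, rfl⟩
  have hM : 0 ≤ ‖B‖ := norm_nonneg B
  obtain ⟨A, hAc, hA1, hA2⟩ := exists_resolvent hd (c := c) fun m => by linarith [hd0 m]
  -- a trial vector orthogonal to `S`
  obtain ⟨u, hu0, hu⟩ : ∃ u : U, u ≠ 0 ∧ (u : Ell2 ι) ∈ Sᗮ := by
    let P : U →ₗ[ℂ] S := (S.orthogonalProjectionOnto : Ell2 ι →ₗ[ℂ] S).comp U.subtype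
    have : LinearMap.ker P ≠ ⊥ := LinearMap.ker_ne_bot_of_finrank_lt hlt'
    obtain ⟨u, hu, h0⟩ := Submodule.exists_mem_ne_zero_of_ne_bot this
    refine ⟨u, h0, ?_⟩
    exact Submodule.orthogonalProjectionOnto_eq_zero_iff.1 hu
  obtain ⟨v, hv, hle⟩ := hU u u.2
  have hu0' : (u : Ell2 ι) ≠ 0 := fun h => hu0 (Subtype.ext h)
  have hun : 0 < ‖(u : Ell2 ι)‖ ^ 2 := by positivity
  have hμc : 0 < μ + c := by
    have := hv.le_re_inner (c := 0) fun m _ => hd0 m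
    nlinarith
  -- positivity and symmetry of the resolvent
  have hApos : ∀ g, ‖A g‖ ^ 2 ≤ (inner ℂ (A g) g).re := fun g => by
    have := (hA1 g).le_re_inner (c := 0) fun m _ => hd0 m
    rw [inner_sub_right, inner_smul_right, inner_self_eq_norm_sq_to_K] at this
    have e : ((c : ℂ) * ((‖A g‖ : ℝ) : ℂ) ^ 2).re = c * ‖A g‖ ^ 2 := by
      rw [← Complex.ofReal_pow, ← Complex.ofReal_mul, Complex.ofReal_re]
    rw [Complex.sub_re] at this
    erw [e] at this
    nlinarith [sq_nonneg ‖A g‖]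
  have hAs : A.IsSymmetric := fun g g' => by
    change inner ℂ (A g) g' = inner ℂ g (A g')
    have := HRel.inner_eq hB (hA1 g) (hA1 g')
    rw [inner_sub_right, inner_sub_left, inner_smul_right, inner_smul_left,
      Complex.conj_ofReal] at this
    exact sub_left_inj.1 this
  have hinv : ∀ g ∈ Sᗮ, A g ∈ Sᗮ := by
    intro g hg
    rw [Submodule.mem_orthogonal] at hg ⊢
    intro s hs
    obtain ⟨f, hf, hI, rfl⟩ := mem_seqSpan hs
    rw [sum_inner]
    refine Finset.sum_eq_zero fun ν hν => ?_
    have h1 : inner ℂ (f ν) g = 0 := hg _ (seqEigenspace_le_seqSpan (hI ν hν) (hf ν))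
    have h2 := HRel.inner_eq hB (hf ν) (hA1 g)
    rw [inner_sub_right, inner_smul_right, inner_smul_left, Complex.conj_ofReal, h1] at h2
    have h3 : ((ν + c : ℝ) : ℂ) * inner ℂ (f ν) (A g) = 0 := by
      push_cast; linear_combination -h2
    -- The eigenvalue -c lies below the lower bound of the form, so its eigenvectors vanish.
    rcases mul_eq_zero.1 h3 with h4 | h4
    · have h5 : ν + c = 0 := by exact_mod_cast h4
      have h6 := HRel.le_re_inner (hf ν) (c := 0) fun m _ => hd0 m
      rw [inner_smul_right, inner_self_eq_norm_sq_to_K] at h6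
      have e : ((ν : ℂ) * ((‖f ν‖ : ℝ) : ℂ) ^ 2).re = ν * ‖f ν‖ ^ 2 := by
        rw [← Complex.ofReal_pow, ← Complex.ofReal_mul, Complex.ofReal_re]
      erw [e] at h6
      have : f ν = 0 := by
        by_contra hne
        have : 0 < ‖f ν‖ ^ 2 := by positivity
        nlinarith
      rw [this, inner_zero_left]
    · exact h4
  let T : Sᗮ →L[ℂ] Sᗮ := A.restrict hinv
  have hTc : IsCompactOperator T := hAc.restrict' hinv
  have hTs : T.IsSymmetric := hAs.restrict_invariant hinv
  have hnt : Nontrivial Sᗮ := ⟨⟨⟨u, hu⟩, 0, fun h => hu0' (congrArg Subtype.val h)⟩⟩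
  -- A nonzero compact symmetric operator has an eigenvalue of modulus equal to its norm. If z = ‖T‖
  -- were at least (μ + c)⁻¹, then z⁻¹ - c ≤ μ would be an eigenvalue of d + B with an eigenvector
  -- both in S and orthogonal to S.
  have hT : ‖T‖ < (μ + c)⁻¹ := by
    by_contra! hge
    have hTpos : 0 < ‖T‖ := lt_of_lt_of_le (inv_pos.2 hμc) hge
    obtain ⟨z, hz, hzn⟩ := spectrum.exists_nnnorm_eq_spectralRadius T
    rw [T.spectralRadius_eq_nnnorm hTs.isSelfAdjoint] at hzn
    have hzn' : ‖z‖ = ‖T‖ := congrArg NNReal.toReal (ENNReal.coe_injective hzn)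
    have hz0 : z ≠ 0 := by rw [← norm_pos_iff, hzn']; exact hTpos
    have hev := (hTc.hasEigenvalue_iff_mem_spectrum hz0).2 hz
    obtain ⟨g, hg⟩ := hev.exists_hasEigenvector
    have hgA : A (g : Ell2 ι) = z • (g : Ell2 ι) := congrArg Subtype.val hg.apply_eq_smul
    have hg0 : (g : Ell2 ι) ≠ 0 := fun h => hg.2 (Subtype.ext h)
    have hgn : 0 < ‖(g : Ell2 ι)‖ ^ 2 := by positivity
    have hzr : (z.re : ℂ) = z := Complex.conj_eq_iff_re.1 (hTs.conj_eigenvalue_eq_self hev)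
    have hzpos : 0 < z.re := by
      have h1 := hApos g
      rw [hgA, inner_smul_left, inner_self_eq_norm_sq_to_K, ← hzr, Complex.conj_ofReal] at h1
      have e : ((z.re : ℂ) * ((‖(g : Ell2 ι)‖ : ℝ) : ℂ) ^ 2).re = z.re * ‖(g : Ell2 ι)‖ ^ 2 := by
        rw [← Complex.ofReal_pow, ← Complex.ofReal_mul, Complex.ofReal_re]
      erw [e] at h1
      rw [norm_smul, hzr, mul_pow] at h1
      have : 0 < ‖z‖ ^ 2 := by positivity
      nlinarith
    have hzT : z.re = ‖T‖ := by
      rw [← hzn', ← hzr, Complex.norm_real, Real.norm_eq_abs, abs_of_pos hzpos, Complex.ofReal_re]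
    have hmem : (g : Ell2 ι) ∈ seqEigenspace d B (z.re⁻¹ - c) := by
      have h1 := (hA1 g).smul z⁻¹
      rw [hgA, smul_smul, inv_mul_cancel₀ hz0, one_smul, smul_sub, smul_smul, smul_smul] at h1
      rw [mem_seqEigenspace]
      convert! h1 using 1
      rw [← sub_smul]
      congr 1
      push_cast
      rw [hzr]
      field_simp
    have hgS : (g : Ell2 ι) ∈ S := by
      refine seqEigenspace_le_seqSpan ?_ hmem
      have : z.re⁻¹ ≤ μ + c := by
        rw [hzT]; exact inv_le_of_inv_le₀ hμc hge
      simpa using by linarith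
    exact hg0 (by simpa using Submodule.inner_left_of_mem_orthogonal hgS g.2)
  -- contradiction with the trial vector
  have h1 : (inner ℂ (A (u : Ell2 ι)) u).re ≤ ‖T‖ * ‖(u : Ell2 ι)‖ ^ 2 := by
    have h2 := T.le_opNorm ⟨u, hu⟩
    have h3 : ‖A (u : Ell2 ι)‖ ≤ ‖T‖ * ‖(u : Ell2 ι)‖ := h2
    calc (inner ℂ (A (u : Ell2 ι)) u).re ≤ ‖A (u : Ell2 ι)‖ * ‖(u : Ell2 ι)‖ :=
          (Complex.re_le_norm _).trans (norm_inner_le_norm _ _)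
      _ ≤ _ := by nlinarith [norm_nonneg (u : Ell2 ι)]
  set t : ℝ := (μ + c)⁻¹ with ht
  have htpos : 0 < t := inv_pos.2 hμc
  set v' : Ell2 ι := v + (c : ℂ) • (u : Ell2 ι) with hv'
  have hAv : A v' = u := hA2 u v hv
  have hvv : (inner ℂ (u : Ell2 ι) v').re ≤ (μ + c) * ‖(u : Ell2 ι)‖ ^ 2 := by
    rw [hv', inner_add_right, inner_smul_right, inner_self_eq_norm_sq_to_K, Complex.add_re]
    have e : ((c : ℂ) * ((‖(u : Ell2 ι)‖ : ℝ) : ℂ) ^ 2).re = c * ‖(u : Ell2 ι)‖ ^ 2 := by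
      rw [← Complex.ofReal_pow, ← Complex.ofReal_mul, Complex.ofReal_re]
    erw [e]
    linarith
  -- Positivity of A tested on u - t(H + c)u with t = (μ + c)⁻¹. Expanding with A(H + c)u = u gives
  -- t‖u‖² ≤ ⟨Au, u⟩ ≤ ‖T‖‖u‖², which contradicts ‖T‖ < t.
  have h4 := (sq_nonneg _).trans (hApos ((u : Ell2 ι) - (t : ℂ) • v'))
  rw [map_sub, map_smul, hAv, inner_sub_left, inner_sub_right, inner_sub_right, inner_smul_right,
    inner_smul_right, inner_smul_left, inner_smul_left, Complex.conj_ofReal] at h4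
  have h5 : inner ℂ (A (u : Ell2 ι)) v' = ((‖(u : Ell2 ι)‖ ^ 2 : ℝ) : ℂ) := by
    have := hAs (u : Ell2 ι) v'
    change inner ℂ (A (u : Ell2 ι)) v' = inner ℂ (u : Ell2 ι) (A v') at this
    rw [this, hAv, inner_self_eq_norm_sq_to_K]
    push_cast; rfl
  have h6 : inner ℂ (u : Ell2 ι) (u : Ell2 ι) = ((‖(u : Ell2 ι)‖ ^ 2 : ℝ) : ℂ) := by
    rw [inner_self_eq_norm_sq_to_K]; push_cast; rfl
  rw [h5, h6] at h4
  simp only [Complex.sub_re, Complex.re_ofReal_mul, Complex.ofReal_re] at h4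
  have h7 : t * (t * (inner ℂ (u : Ell2 ι) v').re) ≤ t * ‖(u : Ell2 ι)‖ ^ 2 := by
    refine mul_le_mul_of_nonneg_left ?_ htpos.le
    calc t * (inner ℂ (u : Ell2 ι) v').re ≤ t * ((μ + c) * ‖(u : Ell2 ι)‖ ^ 2) :=
          mul_le_mul_of_nonneg_left hvv htpos.le
      _ = ‖(u : Ell2 ι)‖ ^ 2 := by rw [← mul_assoc, ht, inv_mul_cancel₀ hμc.ne', one_mul]
  nlinarith

/-- Selection of the `b`-th eigenvalue. -/
theorem exists_band (hB : B.IsSymmetric) {M : ℝ} {b : ℕ} (hb : 1 ≤ b)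
    (hM : (b : Cardinal) ≤ Module.rank ℂ (seqSpan d B (Set.Iic M)))
    (hfin : Module.rank ℂ (seqSpan d B (Set.Iic M)) < Cardinal.aleph0) :
    ∃ m ≤ M, Module.rank ℂ (seqSpan d B (Set.Iio m)) < (b : Cardinal) ∧
      (b : Cardinal) ≤ Module.rank ℂ (seqSpan d B (Set.Iic m)) := by
  classical
  have hfd : FiniteDimensional ℂ (seqSpan d B (Set.Iic M)) := Module.rank_lt_aleph0_iff.1 hfin
  -- finitely many eigenvalues below `M`
  have hT : {ν : ℝ | ν ≤ M ∧ seqEigenspace d B ν ≠ ⊥}.Finite := by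
    choose! x hx hx0 using fun (ν : ℝ) (h : seqEigenspace d B ν ≠ ⊥) =>
      Submodule.exists_mem_ne_zero_of_ne_bot h
    let T := {ν : ℝ | ν ≤ M ∧ seqEigenspace d B ν ≠ ⊥}
    let y : T → seqSpan d B (Set.Iic M) := fun ν =>
      ⟨x ν.1, seqEigenspace_le_seqSpan (Set.mem_Iic.2 ν.2.1) (hx ν.1 ν.2.2)⟩
    have hy : LinearIndependent ℂ y := by
      have hy' : LinearIndependent ℂ fun ν : T => x ν.1 := by
        refine linearIndependent_of_ne_zero_of_inner_eq_zero
          (fun ν => hx0 ν.1 ν.2.2) fun ν ν' hne => ?_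
        exact inner_eq_zero_of_seqEigenspace hB (fun h => hne (Subtype.ext h)) (hx ν.1 ν.2.2)
          (hx ν'.1 ν'.2.2)
      exact LinearIndependent.of_comp (seqSpan d B (Set.Iic M)).subtype hy'
    have : Finite T := hy.finite
    exact Set.toFinite T
  set T := hT.toFinset with hTdef
  have memT : ∀ ν, ν ∈ T ↔ ν ≤ M ∧ seqEigenspace d B ν ≠ ⊥ := fun ν => by simp [hTdef]
  -- below `M` the span only changes at eigenvalues
  have hstep : ∀ I : Set ℝ, I ⊆ Set.Iic M → (∀ ν ∈ I, ∀ ν' ≤ ν, ν' ∈ I) →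
      1 ≤ Module.rank ℂ (seqSpan d B I) → ∃ ν ∈ T, ν ∈ I ∧
        seqSpan d B I = seqSpan d B (Set.Iic ν) := by
    intro I hI hIl h1
    have hne : (T.filter (· ∈ I)).Nonempty := by
      by_contra hem
      rw [Finset.not_nonempty_iff_eq_empty] at hem
      have : seqSpan d B I = ⊥ := by
        refine iSup₂_eq_bot.2 fun ν hν => ?_
        by_contra hb
        have : ν ∈ T.filter (· ∈ I) := Finset.mem_filter.2 ⟨(memT ν).2 ⟨hI hν, hb⟩, hν⟩
        rw [hem] at this
        exact absurd this (Finset.notMem_empty ν)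
      rw [this, rank_bot] at h1
      exact absurd h1 (by simp)
    refine ⟨(T.filter (· ∈ I)).max' hne, (Finset.mem_filter.1 (Finset.max'_mem _ hne)).1,
      (Finset.mem_filter.1 (Finset.max'_mem _ hne)).2, le_antisymm ?_ ?_⟩
    · refine iSup₂_le fun ν hν => ?_
      by_cases hb : seqEigenspace d B ν = ⊥
      · rw [hb]; exact bot_le
      · exact seqEigenspace_le_seqSpan (Finset.le_max' _ _
          (Finset.mem_filter.2 ⟨(memT ν).2 ⟨hI hν, hb⟩, hν⟩))
    · exact seqSpan_mono fun ν hν => hIl _ (Finset.mem_filter.1 (Finset.max'_mem _ hne)).2 ν hν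
  have hb1 : (1 : Cardinal) ≤ b := by exact_mod_cast hb
  have hne : (T.filter fun ν => (b : Cardinal) ≤ Module.rank ℂ
      (seqSpan d B (Set.Iic ν))).Nonempty := by
    obtain ⟨ν, hν, -, he⟩ := hstep (Set.Iic M) subset_rfl
      (fun ν hν ν' h => h.trans hν) (hb1.trans hM)
    exact ⟨ν, Finset.mem_filter.2 ⟨hν, by rw [← he]; exact hM⟩⟩
  set m := (T.filter fun ν => (b : Cardinal) ≤ Module.rank ℂ (seqSpan d B (Set.Iic ν))).min' hne
    with hm
  have hmm := Finset.mem_filter.1 (Finset.min'_mem _ hne)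
  rw [← hm] at hmm
  refine ⟨m, ((memT m).1 hmm.1).1, ?_, hmm.2⟩
  -- If b eigenvalues already lay strictly below m, the largest eigenvalue below m would meet the
  -- condition that m satisfies minimally.
  by_contra! hge
  obtain ⟨ν, hν, hνm, he⟩ := hstep (Set.Iio m)
    (fun ν hν => (le_of_lt hν).trans ((memT m).1 hmm.1).1)
    (fun ν hν ν' h => lt_of_le_of_lt h hν) (hb1.trans hge)
  rw [he] at hge
  exact absurd (Finset.min'_le _ ν (Finset.mem_filter.2 ⟨hν, hge⟩)) (not_le.2 hνm)

end Abstract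

end

attribute [local instance] instMeasureSpaceUnitAddCircle

/-! ### Lattice coordinates and the torus -/

/-- Indices of reciprocal lattice vectors. -/
abbrev Idx := Fin 3 → ℤ

/-- The torus `ℝ³/ℤ³`. -/
abbrev T3 := UnitAddTorus (Fin 3)

instance instIsAddHaarMeasureT3 : (volume : Measure T3).IsAddHaarMeasure :=
  inferInstanceAs ((Measure.pi fun _ => AddCircle.haarAddCircle (T := 1)).IsAddHaarMeasure)

instance instIsProbabilityMeasureT3 : IsProbabilityMeasure (volume : Measure T3) :=
  inferInstanceAs (IsProbabilityMeasure (Measure.pi fun _ => AddCircle.haarAddCircle (T := 1)))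

/-- The reciprocal lattice vector `m₁q₁ + m₂q₂ + m₃q₃`. -/
def recip (a : ℝ) (m : Idx) : E3 := ∑ j, (m j : ℝ) • dualVec a j

/-- The plane wave `x ↦ e^{i p·x}`. -/
def wave (p : E3) (x : E3) : ℂ := Complex.exp (Complex.I * (inner ℝ p x : ℝ))

theorem inner_E3 (x y : E3) : inner ℝ x y = x 0 * y 0 + x 1 * y 1 + x 2 * y 2 := by
  simp [PiLp.inner_apply, Fin.sum_univ_three, mul_comm]

theorem inner_dualVec_latVec {a : ℝ} (ha : 0 < a) (i j : Fin 3) :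
    inner ℝ (dualVec a i) (latVec a j) = if i = j then 2 * Real.pi else 0 := by
  have h3 : (√3 : ℝ) ≠ 0 := by positivity
  have hq : qScale a * (a / √3) = Real.pi := by
    rw [qScale]; field_simp
  fin_cases i <;> fin_cases j <;> simp [inner_E3, dualVec, latVec] <;>
    first | ring1 | linear_combination 2 * hq

/-- The linear parametrization `x ↦ x₁v₁ + x₂v₂ + x₃v₃`. -/
def latMap (a : ℝ) (ha : 0 < a) : (Fin 3 → ℝ) ≃L[ℝ] E3 :=
  LinearEquiv.toContinuousLinearEquiv <|
    LinearEquiv.ofInjectiveOfFinrankEq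
      (∑ j, (LinearMap.proj j : (Fin 3 → ℝ) →ₗ[ℝ] ℝ).smulRight (latVec a j)) (by
        rw [← LinearMap.ker_eq_bot, LinearMap.ker_eq_bot']
        intro x hx
        ext i
        have h := congrArg (fun y => inner ℝ (dualVec a i) y) hx
        simp only [LinearMap.sum_apply, LinearMap.smulRight_apply, LinearMap.proj_apply,
          inner_sum, inner_smul_right, inner_dualVec_latVec ha, mul_ite, mul_zero,
          Finset.sum_ite_eq, Finset.mem_univ, if_true, inner_zero_right] at h
        have : (2 * Real.pi) ≠ 0 := by positivity
        exact (mul_eq_zero.1 h).resolve_right this) (by simp)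

theorem latMap_apply {a : ℝ} (ha : 0 < a) (x : Fin 3 → ℝ) :
    latMap a ha x = ∑ j, x j • latVec a j := by
  change (∑ j, (LinearMap.proj j : (Fin 3 → ℝ) →ₗ[ℝ] ℝ).smulRight (latVec a j)) x = _
  simp

theorem inner_dualVec_latMap {a : ℝ} (ha : 0 < a) (i : Fin 3) (x : Fin 3 → ℝ) :
    inner ℝ (dualVec a i) (latMap a ha x) = 2 * Real.pi * x i := by
  simp [latMap_apply, inner_sum, inner_smul_right, inner_dualVec_latVec ha, mul_comm]

theorem inner_recip_latMap {a : ℝ} (ha : 0 < a) (m : Idx) (x : Fin 3 → ℝ) :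
    inner ℝ (recip a m) (latMap a ha x) = 2 * Real.pi * ∑ j, m j * x j := by
  simp only [recip, sum_inner, inner_smul_left, inner_dualVec_latMap, Finset.mul_sum,
    RCLike.conj_to_real]
  exact Finset.sum_congr rfl fun j _ => by ring

theorem mem_lattice_iff {a : ℝ} (ha : 0 < a) {v : E3} :
    v ∈ lattice a ↔ ∃ n : Idx, v = latMap a ha fun j => n j := by
  simp only [lattice, latMap_apply]; rfl

theorem wave_add (p q x : E3) : wave (p + q) x = wave p x * wave q x := by
  rw [wave, wave, wave, ← Complex.exp_add, inner_add_left]; push_cast; ring_nf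

theorem wave_add_right (p x y : E3) : wave p (x + y) = wave p x * wave p y := by
  rw [wave, wave, wave, ← Complex.exp_add, inner_add_right]; push_cast; ring_nf

@[simp] theorem wave_zero (x : E3) : wave 0 x = 1 := by simp [wave]

theorem wave_neg (p x : E3) : wave (-p) x = (starRingEnd ℂ) (wave p x) := by
  rw [wave, wave, ← Complex.exp_conj]
  simp

theorem wave_neg_mul (p x : E3) : wave (-p) x * wave p x = 1 := by
  rw [← wave_add, neg_add_cancel, wave_zero]

@[simp] theorem norm_wave (p x : E3) : ‖wave p x‖ = 1 := by
  rw [wave, mul_comm, Complex.norm_exp_ofReal_mul_I]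

theorem continuous_wave (p : E3) : Continuous (wave p) := by
  unfold wave; fun_prop

theorem wave_recip_lattice {a : ℝ} (ha : 0 < a) (m : Idx) {v : E3} (hv : v ∈ lattice a) :
    wave (recip a m) v = 1 := by
  obtain ⟨n, rfl⟩ := (mem_lattice_iff ha).1 hv
  rw [wave, inner_recip_latMap, Complex.exp_eq_one_iff]
  refine ⟨∑ j, m j * n j, ?_⟩
  push_cast; ring

/-- Functions that are periodic under the lattice. -/
def IsLatPeriodic {β : Type*} (a : ℝ) (h : E3 → β) : Prop := ∀ x, ∀ v ∈ lattice a, h (x + v) = h x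

/-- The projection to the torus. -/
def toTorus (a : ℝ) (ha : 0 < a) (y : E3) : T3 := fun j => ((latMap a ha).symm y j : UnitAddCircle)

/-- A section of the projection to the torus. -/
def torusSection (a : ℝ) (ha : 0 < a) (t : T3) : E3 :=
  latMap a ha fun j => (AddCircle.equivIoc 1 0 (t j)).1

theorem toTorus_torusSection {a : ℝ} (ha : 0 < a) (t : T3) :
    toTorus a ha (torusSection a ha t) = t := by
  ext j
  simp only [toTorus, torusSection, ContinuousLinearEquiv.symm_apply_apply]
  exact (AddCircle.equivIoc 1 0).symm_apply_apply (t j)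

theorem toTorus_eq_iff {a : ℝ} (ha : 0 < a) {x y : E3} (h : toTorus a ha x = toTorus a ha y) :
    ∃ v ∈ lattice a, x = y + v := by
  have h1 : ∀ j, ∃ n : ℤ, (latMap a ha).symm x j = (latMap a ha).symm y j + n := fun j => by
    have := congrFun h j
    simp only [toTorus] at this
    rw [← sub_eq_zero, ← AddCircle.coe_sub, AddCircle.coe_eq_zero_iff] at this
    obtain ⟨n, hn⟩ := this
    exact ⟨n, by simp only [zsmul_eq_mul, mul_one] at hn; linarith⟩
  choose n hn using h1
  refine ⟨_, (mem_lattice_iff ha).2 ⟨n, rfl⟩, ?_⟩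
  apply (latMap a ha).symm.injective
  ext j
  rw [map_add, ContinuousLinearEquiv.symm_apply_apply, Pi.add_apply, hn]

theorem IsLatPeriodic.torusSection {β : Type*} {a : ℝ} (ha : 0 < a) {h : E3 → β}
    (hp : IsLatPeriodic a h) (y : E3) : h (torusSection a ha (toTorus a ha y)) = h y := by
  obtain ⟨v, hv, he⟩ := toTorus_eq_iff ha (toTorus_torusSection ha (toTorus a ha y))
  rw [he, hp y v hv]

theorem toTorus_add {a : ℝ} (ha : 0 < a) (x y : E3) :
    toTorus a ha (x + y) = toTorus a ha x + toTorus a ha y := by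
  ext j; simp [toTorus]

theorem isOpenQuotientMap_toTorus {a : ℝ} (ha : 0 < a) : IsOpenQuotientMap (toTorus a ha) := by
  have h1 : IsOpenQuotientMap (Pi.map fun (_ : Fin 3) (x : ℝ) => (x : UnitAddCircle)) :=
    IsOpenQuotientMap.piMap fun _ => QuotientAddGroup.isOpenQuotientMap_mk
  exact h1.comp (latMap a ha).symm.toHomeomorph.isOpenQuotientMap

/-- The function on the torus given by a continuous periodic function. -/
def torusLift (a : ℝ) (ha : 0 < a) (h : E3 → ℂ) (hc : Continuous h) (hp : IsLatPeriodic a h) :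
    C(T3, ℂ) where
  toFun t := h (torusSection a ha t)
  continuous_toFun := by
    -- The section itself is discontinuous; continuity is tested after pulling back to ℝ³, where
    -- periodicity removes the choice of section.
    rw [(isOpenQuotientMap_toTorus ha).isQuotientMap.continuous_iff]
    convert! hc using 1
    ext y
    exact hp.torusSection ha y

theorem mFourier_toTorus {a : ℝ} (ha : 0 < a) (m : Idx) (y : E3) :
    UnitAddTorus.mFourier m (toTorus a ha y) = wave (recip a m) y := by
  obtain ⟨x, rfl⟩ := (latMap a ha).surjective y
  rw [wave, inner_recip_latMap]
  simp only [UnitAddTorus.mFourier, ContinuousMap.coe_mk, toTorus,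
    ContinuousLinearEquiv.symm_apply_apply, fourier_coe_apply]
  rw [← Complex.exp_sum]
  congr 1
  push_cast
  rw [Finset.mul_sum, Finset.mul_sum]
  exact Finset.sum_congr rfl fun j _ => by ring

theorem mFourier_torusSection {a : ℝ} (ha : 0 < a) (m : Idx) (t : T3) :
    UnitAddTorus.mFourier m t = wave (recip a m) (torusSection a ha t) := by
  rw [← mFourier_toTorus ha, toTorus_torusSection]

/-! ### Integrals over the cell -/

theorem latMap_preimage_cell {a : ℝ} (ha : 0 < a) :
    latMap a ha ⁻¹' cell a = Set.Icc 0 1 := by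
  ext x
  simp only [Set.mem_preimage, cell, Set.mem_ofPred_eq, ← latMap_apply ha]
  constructor
  · rintro ⟨y, hy, he⟩
    rw [(latMap a ha).injective he]
    exact ⟨fun j => (hy j).1, fun j => (hy j).2⟩
  · exact fun h => ⟨x, fun j => ⟨h.1 j, h.2 j⟩, rfl⟩

theorem cell_eq_image {a : ℝ} (ha : 0 < a) : cell a = latMap a ha '' Set.Icc 0 1 := by
  rw [← latMap_preimage_cell ha, Set.image_preimage_eq _ (latMap a ha).surjective]

theorem isCompact_cell {a : ℝ} (ha : 0 < a) : IsCompact (cell a) := by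
  rw [cell_eq_image ha]
  exact isCompact_Icc.image (latMap a ha).continuous

/-- The image of Lebesgue measure under a linear isomorphism is a Haar measure, hence a multiple of
Lebesgue measure. The constant is left undetermined and is found later by integrating 1. -/
theorem setIntegral_cell_eq {a : ℝ} (ha : 0 < a) :
    ∃ c : ℝ, ∀ h : E3 → ℂ, ∫ x in Set.Icc (0 : Fin 3 → ℝ) 1, h (latMap a ha x) =
      c * ∫ x in cell a, h x := by
  have : (Measure.map (latMap a ha) (volume : Measure (Fin 3 → ℝ))).IsAddHaarMeasure :=
    (latMap a ha).isAddHaarMeasure_map _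
  have hs := Measure.isAddLeftInvariant_eq_smul
    (Measure.map (latMap a ha) (volume : Measure (Fin 3 → ℝ))) (volume : Measure E3)
  refine ⟨((Measure.map (latMap a ha) (volume : Measure (Fin 3 → ℝ))).addHaarScalarFactor
    (volume : Measure E3) : ℝ), fun h => ?_⟩
  have h1 := (latMap a ha).toHomeomorph.measurableEmbedding.setIntegral_map
    (μ := (volume : Measure (Fin 3 → ℝ))) h (cell a)
  have h2 : (latMap a ha).toHomeomorph ⁻¹' cell a = Set.Icc 0 1 := latMap_preimage_cell ha
  rw [h2] at h1
  change _ = ∫ x in Set.Icc (0 : Fin 3 → ℝ) 1, h (latMap a ha x) at h1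
  rw [← h1]
  change ∫ y in cell a, h y ∂(Measure.map (latMap a ha) (volume : Measure (Fin 3 → ℝ))) = _
  conv_lhs => rw [hs]
  rw [Measure.restrict_smul, integral_smul_nnreal_measure]
  rfl

theorem setIntegral_Icc_eq_torus {a : ℝ} (ha : 0 < a) {h : E3 → ℂ} (hp : IsLatPeriodic a h) :
    ∫ x in Set.Icc (0 : Fin 3 → ℝ) 1, h (latMap a ha x) = ∫ t : T3, h (torusSection a ha t) := by
  rw [UnitAddTorus.integral_preimage _ 0]
  have hset : {x : Fin 3 → ℝ | ∀ i, x i ∈ Set.Ioc ((0 : Fin 3 → ℝ) i) ((0 : Fin 3 → ℝ) i + 1)} =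
      Set.univ.pi fun i => Set.Ioc ((0 : Fin 3 → ℝ) i) ((1 : Fin 3 → ℝ) i) := by
    ext x; simp
  have hae : (Set.univ.pi fun i => Set.Ioc ((0 : Fin 3 → ℝ) i) ((1 : Fin 3 → ℝ) i)) =ᵐ[volume]
      Set.Icc (0 : Fin 3 → ℝ) 1 := Measure.univ_pi_Ioc_ae_eq_Icc
  rw [hset, setIntegral_congr_set hae]
  refine integral_congr_ae (Filter.Eventually.of_forall fun x => ?_)
  have : (fun i => ((x i : ℝ) : UnitAddCircle)) = toTorus a ha (latMap a ha x) := by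
    ext j; simp [toTorus]
  simp only [this, hp.torusSection ha]

/-- Testing on the function 1 identifies the unknown constant with |Ω|⁻¹, and this also shows |Ω| ≠
0. -/
theorem volume_real_cell_mul {a : ℝ} (ha : 0 < a) {h : E3 → ℂ} (hp : IsLatPeriodic a h) :
    0 < volume.real (cell a) ∧
      ∫ x in cell a, h x = volume.real (cell a) * ∫ t : T3, h (torusSection a ha t) := by
  obtain ⟨c, hc⟩ := setIntegral_cell_eq ha
  have h1 := hc fun _ => 1
  rw [setIntegral_Icc_eq_torus ha (h := fun _ => 1) fun _ _ _ => rfl] at h1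
  simp only [integral_const, probReal_univ, one_smul, Complex.real_smul, mul_one,
    MeasurableSet.univ, measureReal_restrict_apply, Set.univ_inter] at h1
  have h2 : c * volume.real (cell a) = 1 := by exact_mod_cast h1.symm
  have hv : volume.real (cell a) ≠ 0 := fun h => by simp [h] at h2
  refine ⟨lt_of_le_of_ne measureReal_nonneg hv.symm, ?_⟩
  rw [← setIntegral_Icc_eq_torus ha hp, hc, ← mul_assoc]
  have : (volume.real (cell a) : ℂ) * c = 1 := by rw [mul_comm]; exact_mod_cast h2
  rw [this, one_mul]

theorem volume_real_cell_pos {a : ℝ} (ha : 0 < a) : 0 < volume.real (cell a) :=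
  (volume_real_cell_mul ha (h := fun _ => 0) fun _ _ _ => rfl).1

section

/-! ### Fourier coefficients of pseudo-periodic functions -/

/-- The momenta `k + m₁q₁ + m₂q₂ + m₃q₃`. -/
def mom (a : ℝ) (k : E3) (m : Idx) : E3 := k + recip a m

theorem recip_add (a : ℝ) (m n : Idx) : recip a (m + n) = recip a m + recip a n := by
  simp [recip, add_smul, Finset.sum_add_distrib]

theorem recip_neg (a : ℝ) (m : Idx) : recip a (-m) = -recip a m := by
  simp [recip]

theorem recip_sub (a : ℝ) (m n : Idx) : recip a (m - n) = recip a m - recip a n := by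
  rw [sub_eq_add_neg, recip_add, recip_neg, sub_eq_add_neg]

@[simp] theorem recip_zero (a : ℝ) : recip a 0 = 0 := by simp [recip]

theorem isPseudoPeriodic_iff {a : ℝ} {k : E3} {F : E3 → ℂ} :
    IsPseudoPeriodic a k F ↔ ∀ x, ∀ v ∈ lattice a, F (x + v) = wave k v * F x := Iff.rfl

theorem isPseudoPeriodic_wave {a : ℝ} (ha : 0 < a) (k : E3) (m : Idx) :
    IsPseudoPeriodic a k (wave (mom a k m)) := isPseudoPeriodic_iff.2 fun x v hv => by
  rw [wave_add_right, mom, wave_add k (recip a m) v, wave_recip_lattice ha m hv, mul_one, mul_comm]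

theorem IsPseudoPeriodic.conj_mul {a : ℝ} {k : E3} {F G : E3 → ℂ} (hF : IsPseudoPeriodic a k F)
    (hG : IsPseudoPeriodic a k G) : IsLatPeriodic a fun x => (starRingEnd ℂ) (F x) * G x :=
  fun x v hv => by
    rw [isPseudoPeriodic_iff] at hF hG
    simp only
    rw [hF x v hv, hG x v hv, map_mul, ← wave_neg]
    linear_combination (starRingEnd ℂ) (F x) * G x * wave_neg_mul k v

theorem IsPseudoPeriodic.wave_neg_mul {a : ℝ} (ha : 0 < a) {k : E3} {F : E3 → ℂ}
    (hF : IsPseudoPeriodic a k F) (m : Idx) :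
    IsLatPeriodic a fun x => wave (-mom a k m) x * F x := by
  have := (isPseudoPeriodic_wave ha k m).conj_mul hF
  simpa only [← wave_neg] using this

/-- Continuous pseudo-periodic functions. -/
def contPP (a : ℝ) (k : E3) : Submodule ℂ (E3 → ℂ) where
  carrier := {F | Continuous F ∧ IsPseudoPeriodic a k F}
  zero_mem' := ⟨continuous_const, fun _ _ _ => by simp⟩
  add_mem' := fun {F G} hF hG => ⟨hF.1.add hG.1, fun x v hv => by
    simp only [Pi.add_apply, hF.2 x v hv, hG.2 x v hv, mul_add]⟩
  smul_mem' := fun c F hF => ⟨hF.1.const_smul c, fun x v hv => by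
    simp only [Pi.smul_apply, smul_eq_mul, hF.2 x v hv]; ring⟩

variable {a : ℝ} (ha : 0 < a) {k : E3}

/-- The periodic part of a pseudo-periodic function, on the torus. -/
def ppLift (k : E3) (F : contPP a k) : C(T3, ℂ) :=
  torusLift a ha (fun x => wave (-k) x * F.1 x) ((continuous_wave _).mul F.2.1) (by
    have := F.2.2.wave_neg_mul ha 0
    simpa [mom] using this)

theorem ppLift_apply (F : contPP a k) (t : T3) :
    ppLift ha k F t = wave (-k) (torusSection a ha t) * F.1 (torusSection a ha t) := rfl

/-- The Fourier transform on continuous pseudo-periodic functions. -/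
def ft (k : E3) : contPP a k →ₗ[ℂ] Ell2 Idx where
  toFun F := UnitAddTorus.mFourierBasis.repr (ContinuousMap.toLp 2 volume ℂ (ppLift ha k F))
  map_add' F G := by
    rw [← map_add, ← map_add]
    congr 2
    ext t
    simp only [ppLift_apply, ContinuousMap.add_apply, Submodule.coe_add, Pi.add_apply, mul_add]
  map_smul' c F := by
    rw [RingHom.id_apply, ← map_smul, ← map_smul]
    congr 2
    ext t
    simp only [ppLift_apply, ContinuousMap.smul_apply, Submodule.coe_smul, Pi.smul_apply,
      smul_eq_mul]
    ring

theorem ft_apply (F : contPP a k) (m : Idx) :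
    ft ha k F m = ∫ t : T3, wave (-mom a k m) (torusSection a ha t) * F.1 (torusSection a ha t) := by
  change UnitAddTorus.mFourierBasis.repr _ m = _
  rw [UnitAddTorus.mFourierBasis_repr, UnitAddTorus.mFourierCoeff_toLp,
    UnitAddTorus.mFourierCoeff]
  congr 1
  ext t
  rw [mFourier_torusSection ha, ppLift_apply, smul_eq_mul, ← mul_assoc, ← wave_add, recip_neg,
    mom]
  congr 2
  abel

/-- The characters form a Hilbert basis of L² of the torus, and continuous functions that agree
almost everywhere agree; pseudo-periodicity carries the equality from the section to all of ℝ³. -/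
theorem ft_injective : Function.Injective (ft ha k : contPP a k →ₗ[ℂ] Ell2 Idx) := by
  intro F G h
  have h1 := UnitAddTorus.mFourierBasis.repr.injective h
  have h2 := ContinuousMap.toLp_injective (volume : Measure T3) h1
  ext x
  have h3 := congrArg (fun f : C(T3, ℂ) => f (toTorus a ha x)) h2
  simp only [ppLift_apply] at h3
  obtain ⟨v, hv, he⟩ := toTorus_eq_iff ha (toTorus_torusSection ha (toTorus a ha x))
  have h4 := mul_left_cancel₀ (by simp [wave] : wave (-k) (torusSection a ha (toTorus a ha x)) ≠ 0) h3
  rw [he, isPseudoPeriodic_iff.1 F.2.2 x v hv, isPseudoPeriodic_iff.1 G.2.2 x v hv] at h4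
  exact mul_left_cancel₀ (by simp [wave]) h4

/-- Parseval's identity. The factor |Ω| appears because the torus carries a probability measure. -/
theorem cellInner_eq (F G : contPP a k) :
    cellInner a F.1 G.1 = volume.real (cell a) * inner ℂ (ft ha k F) (ft ha k G) := by
  rw [cellInner, (volume_real_cell_mul ha (F.2.2.conj_mul G.2.2)).2]
  congr 1
  change _ = inner ℂ (UnitAddTorus.mFourierBasis.repr _) (UnitAddTorus.mFourierBasis.repr _)
  rw [LinearIsometryEquiv.inner_map_map, ContinuousMap.inner_toLp]
  congr 1
  ext t
  simp only [ppLift_apply, map_mul]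
  rw [wave_neg, Complex.conj_conj, ← wave_neg]
  linear_combination (-(starRingEnd ℂ) (F.1 (torusSection a ha t)) * G.1 (torusSection a ha t)) *
    wave_neg_mul k (torusSection a ha t)

/-! ### Synthesis -/

/-- The function with given Fourier coefficients. -/
def syn (a : ℝ) (k : E3) (c : Idx → ℂ) (x : E3) : ℂ := ∑' m, c m * wave (mom a k m) x

theorem summable_mul_wave {c : Idx → ℂ} (hc : Summable fun m => ‖c m‖) (k x : E3) :
    Summable fun m => c m * wave (mom a k m) x :=
  Summable.of_norm (by simpa using hc)

theorem syn_mem_contPP {c : Idx → ℂ} (hc : Summable fun m => ‖c m‖) (ha : 0 < a) (k : E3) :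
    syn a k c ∈ contPP a k := by
  refine ⟨?_, isPseudoPeriodic_iff.2 fun x v hv => ?_⟩
  · exact continuous_tsum (fun m => continuous_const.mul (continuous_wave _)) hc
      fun m x => by simp
  · rw [syn, syn, ← tsum_mul_left]
    congr 1; ext m
    rw [isPseudoPeriodic_iff.1 (isPseudoPeriodic_wave ha k m) x v hv]; ring

theorem integral_wave_mul_wave (m n : Idx) :
    ∫ t : T3, wave (-mom a k m) (torusSection a ha t) * wave (mom a k n) (torusSection a ha t) =
      if m = n then 1 else 0 := by
  have h := orthonormal_iff_ite.1 (UnitAddTorus.orthonormal_mFourier (d := Fin 3)) m n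
  rw [UnitAddTorus.mFourierLp, UnitAddTorus.mFourierLp, ContinuousMap.inner_toLp] at h
  rw [← h]
  congr 1
  ext t
  rw [mFourier_torusSection ha, mFourier_torusSection ha, ← wave_neg, ← wave_add, ← wave_add, mom,
    mom]
  congr 1
  abel

/-- Absolute summability allows integration term by term, and orthogonality of the waves leaves one
term. -/
theorem ft_syn {c : Idx → ℂ} (hc : Summable fun m => ‖c m‖) (m : Idx) :
    ft ha k ⟨syn a k c, syn_mem_contPP hc ha k⟩ m = c m := by
  rw [ft_apply]
  have e1 : ∀ t : T3, wave (-mom a k m) (torusSection a ha t) * syn a k c (torusSection a ha t) =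
      ∑' n, c n * (wave (-mom a k m) (torusSection a ha t) *
        wave (mom a k n) (torusSection a ha t)) := fun t => by
    rw [syn, ← tsum_mul_left]; congr 1; ext n; ring
  simp only [e1]
  have hcont : ∀ n, Continuous fun t : T3 => wave (-mom a k m) (torusSection a ha t) *
      wave (mom a k n) (torusSection a ha t) := fun n => by
    have : (fun t : T3 => wave (-mom a k m) (torusSection a ha t) *
      wave (mom a k n) (torusSection a ha t)) = UnitAddTorus.mFourier (n - m) := by
      ext t
      rw [mFourier_torusSection ha, ← wave_add, recip_sub, mom, mom]
      congr 1; abel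
    rw [this]; exact ContinuousMap.continuous _
  have hs := hasSum_integral_of_summable_integral_norm (μ := (volume : Measure T3))
    (F := fun n t => c n * (wave (-mom a k m) (torusSection a ha t) *
        wave (mom a k n) (torusSection a ha t)))
    (fun n => (continuous_const.mul (hcont n)).integrable_of_hasCompactSupport
      (HasCompactSupport.of_compactSpace _)) (by simpa using hc)
  rw [← hs.tsum_eq, tsum_eq_single m]
  · rw [integral_const_mul, integral_wave_mul_wave, if_pos rfl, mul_one]
  · intro n hn
    rw [integral_const_mul, integral_wave_mul_wave, if_neg hn.symm, mul_zero]

theorem eq_syn (F : contPP a k) {c : Idx → ℂ} (hc : Summable fun m => ‖c m‖)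
    (h : ∀ m, ft ha k F m = c m) : F.1 = syn a k c := by
  have : F = ⟨syn a k c, syn_mem_contPP hc ha k⟩ := by
    apply ft_injective ha
    ext m
    rw [h, ft_syn ha hc]
  rw [this]

/-! ### Derivatives -/

theorem wave_hasFDerivAt (p x : E3) :
    HasFDerivAt (wave p) ((Complex.I * wave p x) •
      (Complex.ofRealCLM.comp (innerSL ℝ p))) x := by
  have h1 : HasFDerivAt (fun y : E3 => Complex.I * ((inner ℝ p y : ℝ) : ℂ))
      (Complex.I • (Complex.ofRealCLM.comp (innerSL ℝ p))) x :=
    ((Complex.ofRealCLM.comp (innerSL ℝ p)).hasFDerivAt (x := x)).const_mul Complex.I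
  have h2 := h1.cexp
  convert! h2 using 1
  rw [smul_smul, mul_comm]; rfl

theorem norm_wave_fderiv_le (p x : E3) :
    ‖(Complex.I * wave p x) • (Complex.ofRealCLM.comp (innerSL ℝ p))‖ ≤ ‖p‖ := by
  refine ContinuousLinearMap.opNorm_le_bound _ (norm_nonneg _) fun y => ?_
  simp only [smul_apply, ContinuousLinearMap.comp_apply, innerSL_apply_apply, smul_eq_mul, norm_mul,
    Complex.norm_I, norm_wave, one_mul, Complex.ofRealCLM_apply, Complex.norm_real]
  exact norm_inner_le_norm p y

/-- Termwise differentiation. -/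
theorem syn_hasFDerivAt {c : Idx → ℂ} (hc : Summable fun m => ‖c m‖)
    (hc1 : Summable fun m => ‖c m‖ * ‖mom a k m‖) (x : E3) :
    DifferentiableAt ℝ (syn a k c) x ∧ ∀ v, fderiv ℝ (syn a k c) x v =
      syn a k (fun m => c m * (Complex.I * (inner ℝ (mom a k m) v : ℝ))) x := by
  have hb : ∀ m x, ‖c m • ((Complex.I * wave (mom a k m) x) •
      (Complex.ofRealCLM.comp (innerSL ℝ (mom a k m))))‖ ≤ ‖c m‖ * ‖mom a k m‖ := fun m x => by
    rw [norm_smul]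
    exact mul_le_mul_of_nonneg_left (norm_wave_fderiv_le _ _) (norm_nonneg _)
  have h := hasFDerivAt_tsum (𝕜 := ℝ) (f := fun m x => c m * wave (mom a k m) x)
    (f' := fun m x => c m • ((Complex.I * wave (mom a k m) x) •
      (Complex.ofRealCLM.comp (innerSL ℝ (mom a k m))))) (x₀ := 0) hc1
    (fun m x => (wave_hasFDerivAt _ x).const_mul (c m)) hb
    (summable_mul_wave hc k 0) x
  change HasFDerivAt (syn a k c) _ x at h
  refine ⟨h.differentiableAt, fun v => ?_⟩
  have e := (ContinuousLinearMap.apply ℝ ℂ v).map_tsum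
    (Summable.of_norm_bounded hc1 fun m => hb m x)
  simp only [ContinuousLinearMap.apply_apply] at e
  rw [h.fderiv, e, syn]
  congr 1; ext m
  simp only [smul_apply, ContinuousLinearMap.comp_apply, innerSL_apply_apply, smul_eq_mul,
    Complex.ofRealCLM_apply]
  ring

/-- A directional derivative is again a synthesis, with coefficients multiplied by i(p·v), so each
derivative costs one power of the weight. -/
theorem contDiff_syn (n : ℕ) {c : Idx → ℂ}
    (hc : Summable fun m => ‖c m‖ * (1 + ‖mom a k m‖) ^ n) :
    ContDiff ℝ n (syn a k c) := by
  induction n generalizing c with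
  | zero =>
    rw [Nat.cast_zero, contDiff_zero]
    exact continuous_tsum (fun m => continuous_const.mul (continuous_wave _))
      (by simpa using hc) fun m x => by simp
  | succ n ih =>
    have h0 : Summable fun m => ‖c m‖ := Summable.of_nonneg_of_le (fun m => norm_nonneg _)
      (fun m => by
        have : 1 ≤ (1 + ‖mom a k m‖) ^ (n + 1) := one_le_pow₀ (by linarith [norm_nonneg (mom a k m)])
        nlinarith [norm_nonneg (c m)]) hc
    have h1 : Summable fun m => ‖c m‖ * ‖mom a k m‖ :=
      Summable.of_nonneg_of_le (fun m => by positivity)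
      (fun m => by
        have h2 : 1 + ‖mom a k m‖ ≤ (1 + ‖mom a k m‖) ^ (n + 1) :=
          le_self_pow₀ (by linarith [norm_nonneg (mom a k m)]) (by simp)
        have : ‖mom a k m‖ ≤ (1 + ‖mom a k m‖) ^ (n + 1) := by linarith
        exact mul_le_mul_of_nonneg_left this (norm_nonneg _)) hc
    push_cast
    rw [contDiff_succ_iff_fderiv_apply]
    refine ⟨fun x => (syn_hasFDerivAt h0 h1 x).1, by simp, fun v => ?_⟩
    have e : (fun x => fderiv ℝ (syn a k c) x v) =
        syn a k (fun m => c m * (Complex.I * (inner ℝ (mom a k m) v : ℝ))) :=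
      funext fun x => (syn_hasFDerivAt h0 h1 x).2 v
    rw [e]
    refine ih (Summable.of_nonneg_of_le (fun m => by positivity) (fun m => ?_) (hc.mul_left ‖v‖))
    rw [norm_mul, norm_mul, Complex.norm_I, one_mul, Complex.norm_real]
    have h3 : ‖inner ℝ (mom a k m) v‖ ≤ (1 + ‖mom a k m‖) * ‖v‖ :=
      (norm_inner_le_norm _ _).trans (by nlinarith [norm_nonneg v])
    calc ‖c m‖ * ‖inner ℝ (mom a k m) v‖ * (1 + ‖mom a k m‖) ^ n
        ≤ ‖c m‖ * ((1 + ‖mom a k m‖) * ‖v‖) * (1 + ‖mom a k m‖) ^ n := by gcongr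
      _ = ‖v‖ * (‖c m‖ * (1 + ‖mom a k m‖) ^ (n + 1)) := by ring

/-- The laplacian as a sum of iterated directional derivatives. -/
theorem laplacian_eq_sum {F : E3 → ℂ} (hF : ContDiff ℝ 2 F) (x : E3) :
    Laplacian.laplacian F x = ∑ j : Fin 3, fderiv ℝ
      (fun y => fderiv ℝ F y (EuclideanSpace.single j 1)) x (EuclideanSpace.single j 1) := by
  rw [laplacian_eq_iteratedFDeriv_orthonormalBasis F (EuclideanSpace.basisFun (Fin 3) ℝ)]
  refine Finset.sum_congr rfl fun j _ => ?_
  rw [iteratedFDeriv_two_apply]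
  have hd : DifferentiableAt ℝ (fderiv ℝ F) x :=
    (hF.fderiv_right (m := 1) (by norm_num)).differentiable (by norm_num) x
  rw [fderiv_clm_apply hd (differentiableAt_const _)]
  simp

end

/-! ### Integration by parts on the torus -/

section

variable {a : ℝ} (ha : 0 < a) {k : E3}

theorem IsPseudoPeriodic.fderiv {F : E3 → ℂ} (hF : IsPseudoPeriodic a k F) (v : E3) :
    IsPseudoPeriodic a k fun x => _root_.fderiv ℝ F x v := isPseudoPeriodic_iff.2 fun x w hw => by
  have h1 : (fun y => F (y + w)) = wave k w • F :=
    funext fun y => isPseudoPeriodic_iff.1 hF y w hw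
  have h2 := fderiv_comp_add_right (𝕜 := ℝ) (f := F) (x := x) w
  rw [h1, fderiv_const_smul_field] at h2
  rw [← h2]
  rfl

theorem fderiv_mem_contPP {F : E3 → ℂ} (hC : ContDiff ℝ 1 F) (hF : IsPseudoPeriodic a k F)
    (v : E3) : (fun x => fderiv ℝ F x v) ∈ contPP a k :=
  ⟨(hC.continuous_fderiv (by norm_num)).clm_apply continuous_const, hF.fderiv v⟩

theorem isLatPeriodic_iff_isPseudoPeriodic {h : E3 → ℂ} :
    IsLatPeriodic a h ↔ IsPseudoPeriodic a 0 h := by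
  simp [isPseudoPeriodic_iff, IsLatPeriodic]

/-- Haar measure is translation invariant, so the mean of h(· + rv) does not depend on r;
differentiate under the integral at r = 0. This replaces the cancellation of boundary terms on the
cell. -/
theorem integral_fderiv_eq_zero {h : E3 → ℂ} (hC : ContDiff ℝ 1 h) (hp : IsLatPeriodic a h)
    (v : E3) : ∫ t : T3, fderiv ℝ h (torusSection a ha t) v = 0 := by
  have hdp : IsLatPeriodic a fun x => fderiv ℝ h x v :=
    isLatPeriodic_iff_isPseudoPeriodic.2 ((isLatPeriodic_iff_isPseudoPeriodic.1 hp).fderiv v)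
  have hdc : Continuous fun x => fderiv ℝ h x v :=
    (hC.continuous_fderiv (by norm_num)).clm_apply continuous_const
  let g := torusLift a ha h hC.continuous hp
  let g' := torusLift a ha _ hdc hdp
  have hg : ∀ (r : ℝ) (t : T3), h (torusSection a ha t + r • v) = g (t + toTorus a ha (r • v)) := by
    intro r t
    have : t + toTorus a ha (r • v) = toTorus a ha (torusSection a ha t + r • v) := by
      rw [toTorus_add, toTorus_torusSection]
    rw [this]
    exact (hp.torusSection ha _).symm
  have hg' : ∀ y, ‖fderiv ℝ h y v‖ ≤ ‖g'‖ := fun y => by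
    have := g'.norm_coe_le_norm (toTorus a ha y)
    rwa [show g' (toTorus a ha y) = fderiv ℝ h y v from hdp.torusSection ha y] at this
  have hcont : ∀ r : ℝ, Continuous fun t : T3 => h (torusSection a ha t + r • v) := fun r => by
    simp only [hg]
    exact g.continuous.comp (continuous_id.add continuous_const)
  have hder : ∀ (t : T3) (r : ℝ), HasDerivAt (fun r : ℝ => h (torusSection a ha t + r • v))
      (fderiv ℝ h (torusSection a ha t + r • v) v) r := fun t r => by
    have h1 : HasDerivAt (fun r : ℝ => torusSection a ha t + r • v) v r := by
      simpa using ((hasDerivAt_id r).smul_const v).const_add (torusSection a ha t)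
    exact ((hC.differentiable (by norm_num) _).hasFDerivAt).comp_hasDerivAt r h1
  have hD := (hasDerivAt_integral_of_dominated_loc_of_deriv_le (𝕜 := ℝ)
    (μ := (volume : Measure T3)) (bound := fun _ => ‖g'‖) (s := Set.univ) (x₀ := (0 : ℝ))
    (F := fun r t => h (torusSection a ha t + r • v))
    (F' := fun r t => fderiv ℝ h (torusSection a ha t + r • v) v) Filter.univ_mem
    (Filter.Eventually.of_forall fun r => (hcont r).aestronglyMeasurable)
    ((hcont 0).integrable_of_hasCompactSupport (HasCompactSupport.of_compactSpace _))
    (by simp only [zero_smul, add_zero]; exact g'.continuous.aestronglyMeasurable)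
    (Filter.Eventually.of_forall fun t r _ => hg' _) (integrable_const _)
    (Filter.Eventually.of_forall fun t r _ => hder t r)).2
  have hconst : (fun r : ℝ => ∫ t : T3, h (torusSection a ha t + r • v)) =
      fun _ => ∫ t : T3, g t := by
    ext r
    simp only [hg]
    exact integral_add_right_eq_self (μ := (volume : Measure T3)) (fun t => g t) _
  rw [hconst] at hD
  simpa using hD.unique (hasDerivAt_const _ _)

/-- Integration by parts: the derivative of the periodic product of F with a conjugate wave has mean
zero. -/
theorem ft_fderiv {F : E3 → ℂ} (hC : ContDiff ℝ 1 F) (hF : IsPseudoPeriodic a k F) (v : E3)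
    (m : Idx) : ft ha k ⟨_, fderiv_mem_contPP hC hF v⟩ m =
      Complex.I * (inner ℝ (mom a k m) v : ℝ) * ft ha k ⟨F, hC.continuous, hF⟩ m := by
  have hcw : ∀ G : contPP a k, Integrable (fun t : T3 =>
      wave (-mom a k m) (torusSection a ha t) * G.1 (torusSection a ha t)) := fun G => by
    exact (torusLift a ha _ ((continuous_wave (-mom a k m)).mul G.2.1)
      (G.2.2.wave_neg_mul ha m)).continuous.integrable_of_hasCompactSupport
        (HasCompactSupport.of_compactSpace _)
  have hw : ContDiff ℝ 1 (wave (-mom a k m)) :=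
    (contDiff_const.mul (Complex.ofRealCLM.contDiff.comp
      (contDiff_const.inner ℝ contDiff_id))).cexp
  have e : ∀ x, fderiv ℝ (wave (-mom a k m) * F) x v =
      wave (-mom a k m) x * fderiv ℝ F x v -
        Complex.I * (inner ℝ (mom a k m) v : ℝ) * (wave (-mom a k m) x * F x) := fun x => by
    rw [((wave_hasFDerivAt (-mom a k m) x).mul
      (hC.differentiable (by norm_num) x).hasFDerivAt).fderiv]
    simp only [add_apply, smul_apply, ContinuousLinearMap.comp_apply,
      innerSL_apply_apply, smul_eq_mul, Complex.ofRealCLM_apply, inner_neg_left, Complex.ofReal_neg]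
    ring
  have h0 : ∫ t : T3, (wave (-mom a k m) (torusSection a ha t) *
      fderiv ℝ F (torusSection a ha t) v - Complex.I * (inner ℝ (mom a k m) v : ℝ) *
        (wave (-mom a k m) (torusSection a ha t) * F (torusSection a ha t))) = 0 := by
    rw [← integral_fderiv_eq_zero ha (hw.mul hC) (hF.wave_neg_mul ha m) v]
    congr 1
    ext t
    exact (e _).symm
  rw [integral_sub (hcw ⟨_, fderiv_mem_contPP hC hF v⟩)
    ((hcw ⟨F, hC.continuous, hF⟩).const_mul _), integral_const_mul] at h0
  rw [ft_apply, ft_apply]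
  exact sub_eq_zero.1 h0

theorem laplacian_mem_contPP {F : E3 → ℂ} (hC : ContDiff ℝ 2 F) (hF : IsPseudoPeriodic a k F) :
    Laplacian.laplacian F ∈ contPP a k := by
  have e : Laplacian.laplacian F = ∑ j : Fin 3, fun x => fderiv ℝ
      (fun y => fderiv ℝ F y (EuclideanSpace.single j 1)) x (EuclideanSpace.single j 1) := by
    ext x; rw [laplacian_eq_sum hC, Finset.sum_apply]
  rw [e]
  exact Submodule.sum_mem _ fun j _ => fderiv_mem_contPP
    ((hC.fderiv_right (m := 1) (by norm_num)).clm_apply contDiff_const) (hF.fderiv _) _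

theorem ft_laplacian {F : E3 → ℂ} (hC : ContDiff ℝ 2 F) (hF : IsPseudoPeriodic a k F) (m : Idx) :
    ft ha k ⟨_, laplacian_mem_contPP hC hF⟩ m =
      -(‖mom a k m‖ ^ 2 : ℝ) * ft ha k ⟨F, hC.continuous, hF⟩ m := by
  have hC1 : ∀ j : Fin 3, ContDiff ℝ 1 fun y => fderiv ℝ F y (EuclideanSpace.single j 1) := fun j =>
    (hC.fderiv_right (m := 1) (by norm_num)).clm_apply contDiff_const
  have e : (⟨_, laplacian_mem_contPP hC hF⟩ : contPP a k) = ∑ j : Fin 3,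
      ⟨_, fderiv_mem_contPP (hC1 j) (hF.fderiv _) (EuclideanSpace.single j 1)⟩ := by
    apply Subtype.ext
    ext x
    change Laplacian.laplacian F x = _
    rw [laplacian_eq_sum hC]
    simp
  rw [e, map_sum, lp.coeFn_sum, Finset.sum_apply]
  have h2 : ∀ j : Fin 3, ft ha k ⟨_, fderiv_mem_contPP (hC1 j) (hF.fderiv _)
      (EuclideanSpace.single j 1)⟩ m = -((mom a k m j) ^ 2 : ℝ) * ft ha k ⟨F, hC.continuous, hF⟩ m := by
    intro j
    rw [ft_fderiv ha (hC1 j) (hF.fderiv _), ft_fderiv ha (hC.of_le (by norm_num)) hF]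
    have : inner ℝ (mom a k m) (EuclideanSpace.single j (1 : ℝ)) = mom a k m j := by
      simp [EuclideanSpace.inner_single_right]
    rw [this]
    push_cast
    linear_combination ((mom a k m j : ℂ) ^ 2 * ft ha k ⟨F, hC.continuous, hF⟩ m) * Complex.I_sq
  rw [Finset.sum_congr rfl fun j _ => h2 j, ← Finset.sum_mul, EuclideanSpace.norm_sq_eq]
  simp

end

section

/-! ### Permutations and convolutions on `ℓ²` -/

section Perm

variable {ι : Type*}

theorem summable_norm_sq (u : Ell2 ι) : Summable fun m => ‖u m‖ ^ 2 := by
  simpa using (lp.memℓp u).summable (by norm_num)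

theorem memℓp_two_iff {u : ι → ℂ} : Memℓp u 2 ↔ Summable fun m => ‖u m‖ ^ 2 := by
  rw [memℓp_gen_iff (by norm_num)]
  simp

theorem norm_sq_eq_tsum (u : Ell2 ι) : ‖u‖ ^ 2 = ∑' m, ‖u m‖ ^ 2 := by
  have := lp.norm_rpow_eq_tsum (p := 2) (by norm_num) u
  simpa using this

/-- Permutation of the entries of a square summable family. -/
def permOp (σ : Equiv.Perm ι) : Ell2 ι ≃ₗᵢ[ℂ] Ell2 ι where
  toFun u := ⟨fun m => u (σ.symm m), memℓp_two_iff.2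
    ((summable_norm_sq u).comp_injective σ.symm.injective)⟩
  invFun u := ⟨fun m => u (σ m), memℓp_two_iff.2
    ((summable_norm_sq u).comp_injective σ.injective)⟩
  left_inv u := by ext m; exact congrArg u (σ.symm_apply_apply m)
  right_inv u := by ext m; exact congrArg u (σ.apply_symm_apply m)
  map_add' u v := by ext m; rfl
  map_smul' c u := by ext m; rfl
  norm_map' u := by
    rw [← sq_eq_sq₀ (norm_nonneg _) (norm_nonneg _), norm_sq_eq_tsum, norm_sq_eq_tsum]
    exact σ.symm.tsum_eq fun m => ‖u m‖ ^ 2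

@[simp] theorem permOp_apply (σ : Equiv.Perm ι) (u : Ell2 ι) (m : ι) :
    permOp σ u m = u (σ.symm m) := rfl

/-- Convolution with an absolutely summable family. -/
def convOp (κ : Idx → ℂ) : Ell2 Idx →L[ℂ] Ell2 Idx :=
  ∑' g, κ g • ((permOp (Equiv.addLeft g)).toContinuousLinearEquiv : Ell2 Idx →L[ℂ] Ell2 Idx)

/-- Translations are isometries of ℓ², so the series of operators converges absolutely in norm. -/
theorem hasSum_convOp {κ : Idx → ℂ} (hκ : Summable fun g => ‖κ g‖) (u : Ell2 Idx) :
    HasSum (fun g => κ g • permOp (Equiv.addLeft g) u) (convOp κ u) := by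
  have hs : Summable fun g => κ g •
      ((permOp (Equiv.addLeft g)).toContinuousLinearEquiv : Ell2 Idx →L[ℂ] Ell2 Idx) := by
    refine Summable.of_norm_bounded hκ fun g => ?_
    rw [norm_smul]
    refine mul_le_of_le_one_right (norm_nonneg _) ?_
    exact ContinuousLinearMap.opNorm_le_bound _ zero_le_one fun v => by
      simp
  exact hs.hasSum.mapL (ContinuousLinearMap.apply ℂ (Ell2 Idx) u)

theorem hasSum_convOp_apply {κ : Idx → ℂ} (hκ : Summable fun g => ‖κ g‖) (u : Ell2 Idx) (m : Idx) :
    HasSum (fun g => κ g * u (m - g)) (convOp κ u m) := by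
  have := (hasSum_convOp hκ u).mapL (lp.evalCLM ℂ (fun _ : Idx => ℂ) 2 m)
  convert! this using 1
  ext g
  change _ = κ g * u (-g + m)
  rw [neg_add_eq_sub]

/-- The adjoint of translation by g is translation by -g, and the reindexing g ↦ -g matches the
Hermitian symmetry of κ. -/
theorem isSymmetric_convOp {κ : Idx → ℂ} (hκ : Summable fun g => ‖κ g‖)
    (hs : ∀ g, κ (-g) = (starRingEnd ℂ) (κ g)) : (convOp κ).IsSymmetric := by
  intro u v
  change inner ℂ (convOp κ u) v = inner ℂ u (convOp κ v)
  have h1 := (hasSum_convOp hκ v).mapL (innerSL ℂ u)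
  have h2 := (hasSum_convOp hκ u).mapL (innerSL ℂ v)
  have h3 : HasSum (fun g => inner ℂ u (κ g • permOp (Equiv.addLeft g) v))
      (inner ℂ (convOp κ u) v) := by
    have h4 : HasSum (fun g => (starRingEnd ℂ) (inner ℂ v (κ (-g) • permOp (Equiv.addLeft (-g)) u)))
        ((starRingEnd ℂ) (inner ℂ v (convOp κ u))) :=
      Complex.hasSum_conj'.2 ((Equiv.neg Idx).hasSum_iff.2 h2)
    rw [inner_conj_symm] at h4
    convert! h4 using 1
    ext g
    rw [inner_conj_symm, inner_smul_left, inner_smul_right, hs, Complex.conj_conj]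
    congr 1
    rw [← (permOp (Equiv.addLeft g)).inner_map_map (permOp (Equiv.addLeft (-g)) u) v]
    congr 1
    ext m
    change u m = u (- -g + (-g + m))
    rw [neg_neg, add_neg_cancel_left]
  exact h3.unique h1

end Perm

/-! ### Summability over the reciprocal lattice -/

section Sums

variable {a : ℝ}

theorem inner_recip_latVec (ha : 0 < a) (m : Idx) (j : Fin 3) :
    inner ℝ (recip a m) (latVec a j) = 2 * Real.pi * m j := by
  simp only [recip, sum_inner, inner_smul_left, inner_dualVec_latVec ha, RCLike.conj_to_real]
  simp [mul_comm]

theorem recip_injective (ha : 0 < a) : Function.Injective (recip a) := fun m n h => by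
  ext j
  have h1 := congrArg (fun y => inner ℝ y (latVec a j)) h
  simp only [inner_recip_latVec ha] at h1
  have := mul_left_cancel₀ (by positivity : 2 * Real.pi ≠ 0) h1
  exact_mod_cast this

theorem linearIndependent_dualVec (ha : 0 < a) : LinearIndependent ℝ (dualVec a) := by
  rw [Fintype.linearIndependent_iff]
  intro g hg i
  have h := congrArg (fun y => inner ℝ y (latVec a i)) hg
  simp only [sum_inner, inner_smul_left, inner_dualVec_latVec ha, RCLike.conj_to_real,
    inner_zero_left, mul_ite, mul_zero, Finset.sum_ite_eq', Finset.mem_univ, if_true] at h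
  exact (mul_eq_zero.1 h).resolve_right (by positivity)

/-- Comparison with the sum of ‖z‖⁻⁴ over a lattice of rank 3 < 4. The origin is covered by a
separate summand, since the comparison function does not dominate there. -/
theorem summable_recip (ha : 0 < a) : Summable fun m : Idx => ((1 + ‖recip a m‖ ^ 2) ^ 2)⁻¹ := by
  let b : Module.Basis (Fin 3) ℝ E3 :=
    basisOfLinearIndependentOfCardEqFinrank (linearIndependent_dualVec ha) (by simp)
  have hb : ∀ j, b j = dualVec a j := fun j => by simp [b]
  let L := Submodule.span ℤ (Set.range b)
  have hrank : Module.finrank ℤ L = 3 := by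
    rw [ZLattice.rank ℝ L]; simp
  have hs : Summable fun z : L => ‖z‖ ^ (-4 : ℝ) :=
    ZLattice.summable_norm_rpow L (-4) (by rw [hrank]; norm_num)
  have hmem : ∀ m : Idx, recip a m ∈ L := fun m => by
    refine Submodule.sum_mem _ fun j _ => ?_
    rw [← hb, Int.cast_smul_eq_zsmul]
    exact Submodule.smul_mem _ _ (Submodule.subset_span ⟨j, rfl⟩)
  have hs2 := hs.comp_injective (i := fun m : Idx => (⟨recip a m, hmem m⟩ : L))
    fun m n h => recip_injective ha (congrArg Subtype.val h)
  have hs3 : Summable fun m : Idx => if m = 0 then (1 : ℝ) else 0 :=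
    summable_of_hasFiniteSupport ((Set.finite_singleton (0 : Idx)).subset fun m hm => by
      by_contra h; simp_all)
  refine Summable.of_nonneg_of_le (fun m => by positivity) (fun m => ?_) (hs2.add hs3)
  by_cases hm : m = 0
  · subst hm
    simp only [recip_zero, norm_zero, if_true]
    norm_num
  · simp only [Function.comp_apply, hm, if_false, add_zero]
    have hr : 0 < ‖recip a m‖ := norm_pos_iff.2 fun h => hm (recip_injective ha (by simpa using h))
    change _ ≤ ‖recip a m‖ ^ (-4 : ℝ)
    rw [Real.rpow_neg hr.le]
    refine inv_anti₀ (by positivity) ?_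
    have : ‖recip a m‖ ^ (4 : ℝ) = (‖recip a m‖ ^ 2) ^ 2 := by
      rw [← pow_mul]; exact_mod_cast Real.rpow_natCast _ 4
    rw [this]
    gcongr
    linarith

/-- A Peetre type inequality: it distributes the weight 1 + |p|² over the two factors of a
convolution. -/
theorem one_add_norm_sq_le (p q : E3) :
    1 + ‖p + q‖ ^ 2 ≤ 2 * (1 + ‖p‖ ^ 2) * (1 + ‖q‖ ^ 2) := by
  have h1 : ‖p + q‖ ^ 2 ≤ 2 * ‖p‖ ^ 2 + 2 * ‖q‖ ^ 2 := by
    have := norm_add_le p q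
    nlinarith [norm_nonneg (p + q), sq_nonneg (‖p‖ - ‖q‖)]
  nlinarith [mul_nonneg (sq_nonneg ‖p‖) (sq_nonneg ‖q‖)]

theorem one_add_recip_le (k : E3) (m : Idx) :
    1 + ‖recip a m‖ ^ 2 ≤ 2 * (1 + ‖k‖ ^ 2) * (1 + ‖mom a k m‖ ^ 2) := by
  have := one_add_norm_sq_le (-k) (mom a k m)
  rwa [mom, neg_add_cancel_left, norm_neg] at this

theorem summable_mom (ha : 0 < a) (k : E3) : Summable fun m : Idx => ((1 + ‖mom a k m‖ ^ 2) ^ 2)⁻¹ := by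
  refine Summable.of_nonneg_of_le (fun m => by positivity) (fun m => ?_)
    ((summable_recip ha).mul_left ((2 * (1 + ‖k‖ ^ 2)) ^ 2))
  rw [← div_eq_mul_inv, inv_le_comm₀ (by positivity) (by positivity), inv_div,
    div_le_iff₀ (by positivity), ← mul_pow, mul_comm]
  exact pow_le_pow_left₀ (by positivity) (one_add_recip_le k m) 2

/-- The terms of a convergent series tend to zero, so their reciprocals tend to infinity. This
growth is what makes the resolvents compact. -/
theorem tendsto_mom (ha : 0 < a) (k : E3) :
    Filter.Tendsto (fun m : Idx => ‖mom a k m‖ ^ 2) Filter.cofinite Filter.atTop := by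
  have h := (summable_mom ha k).tendsto_cofinite_zero
  have h1 : Filter.Tendsto (fun m : Idx => (1 + ‖mom a k m‖ ^ 2) ^ 2) Filter.cofinite
      Filter.atTop := by
    have := Filter.Tendsto.inv_tendsto_nhdsGT_zero (tendsto_nhdsWithin_iff.2
      ⟨h, Filter.Eventually.of_forall fun m => by simp only [Set.mem_Ioi]; positivity⟩)
    convert! this using 1
    ext m
    simp
  rw [Filter.tendsto_atTop] at h1 ⊢
  intro b
  filter_upwards [h1 ((1 + |b|) ^ 2)] with m hm
  have := (pow_le_pow_iff_left₀ (by positivity) (by positivity) (by norm_num)).1 hm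
  linarith [le_abs_self b]

end Sums

end

section

/-! ### Fourier coefficients of the potential -/

section Potential

variable {a : ℝ}

theorem contDiff_laplacian {F : E3 → ℂ} (hF : ContDiff ℝ ∞ F) :
    ContDiff ℝ ∞ (Laplacian.laplacian F) := by
  have e : Laplacian.laplacian F = fun x => ∑ j : Fin 3, fderiv ℝ
      (fun y => fderiv ℝ F y (EuclideanSpace.single j 1)) x (EuclideanSpace.single j 1) := by
    ext x; rw [laplacian_eq_sum (hF.of_le (WithTop.coe_le_coe.2 le_top))]
  rw [e]
  have h1 : ∀ G : E3 → ℂ, ContDiff ℝ ∞ G → ∀ v : E3, ContDiff ℝ ∞ fun x => fderiv ℝ G x v :=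
    fun G hG v => (hG.fderiv_right (m := ∞) (by simp)).clm_apply contDiff_const
  exact ContDiff.sum fun j _ => h1 _ (h1 _ hF _) _

/-- The Fourier coefficients of a smooth periodic function decay rapidly. -/
theorem exists_ft_decay (ha : 0 < a) (n : ℕ) {F : E3 → ℂ} (hF : ContDiff ℝ ∞ F)
    (hp : IsPseudoPeriodic a 0 F) :
    ∃ C : ℝ, ∀ m, (1 + ‖recip a m‖ ^ 2) ^ n * ‖ft ha 0 ⟨F, hF.continuous, hp⟩ m‖ ≤ C := by
  suffices h : ∃ G : contPP a 0, ∀ m, ft ha 0 G m =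
      (((1 + ‖recip a m‖ ^ 2) ^ n : ℝ) : ℂ) * ft ha 0 ⟨F, hF.continuous, hp⟩ m by
    obtain ⟨G, hG⟩ := h
    refine ⟨‖ft ha 0 G‖, fun m => ?_⟩
    have h1 := lp.norm_apply_le_norm (by norm_num) (ft ha 0 G) m
    rw [hG, norm_mul, Complex.norm_real, Real.norm_eq_abs, abs_of_pos (by positivity)] at h1
    exact h1
  induction n generalizing F with
  | zero => exact ⟨⟨F, hF.continuous, hp⟩, by simp⟩
  | succ n ih =>
    have hF2 : ContDiff ℝ 2 F := hF.of_le (WithTop.coe_le_coe.2 le_top)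
    have hL := laplacian_mem_contPP hF2 hp
    -- Applying 1 - Δ multiplies the coefficients by 1 + |p|², so n applications give n powers of
    -- the weight.
    obtain ⟨G, hG⟩ := ih (F := F - Laplacian.laplacian F) (hF.sub (contDiff_laplacian hF))
      (Submodule.sub_mem (contPP a 0) ⟨hF.continuous, hp⟩ hL).2
    refine ⟨G, fun m => ?_⟩
    rw [hG]
    have e : (⟨F - Laplacian.laplacian F, (hF.sub (contDiff_laplacian hF)).continuous,
        (Submodule.sub_mem (contPP a 0) ⟨hF.continuous, hp⟩ hL).2⟩ : contPP a 0) =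
        ⟨F, hF.continuous, hp⟩ - ⟨_, hL⟩ := rfl
    rw [e, map_sub, lp.coeFn_sub, Pi.sub_apply, ft_laplacian ha hF2 hp, mom, zero_add]
    push_cast
    ring

variable {V : E3 → ℝ}

theorem IsAdmissible.contDiff_ofReal (hV : IsAdmissible a V) :
    ContDiff ℝ ∞ fun x => (V x : ℂ) := Complex.ofRealCLM.contDiff.comp hV.smooth

theorem IsAdmissible.isPseudoPeriodic (hV : IsAdmissible a V) :
    IsPseudoPeriodic a 0 fun x => (V x : ℂ) :=
  isLatPeriodic_iff_isPseudoPeriodic.1 fun x v hv => by rw [hV.periodic x v hv]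

/-- The Fourier coefficients of the potential. -/
def vhat (ha : 0 < a) (hV : IsAdmissible a V) : Ell2 Idx :=
  ft ha 0 ⟨fun x => (V x : ℂ), hV.contDiff_ofReal.continuous, hV.isPseudoPeriodic⟩

theorem fourierCoeff_eq_vhat (ha : 0 < a) (hV : IsAdmissible a V) (m : Idx) :
    fourierCoeff a V m = vhat ha hV m := by
  have hp := hV.isPseudoPeriodic.wave_neg_mul ha m
  have hpos := volume_real_cell_pos ha
  rw [vhat, ft_apply, fourierCoeff]
  have e : ∀ x : E3, (V x : ℂ) * Complex.exp (-Complex.I *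
      (inner ℝ (∑ j, (m j : ℝ) • dualVec a j) x : ℝ)) = wave (-mom a 0 m) x * (V x : ℂ) := by
    intro x
    rw [mom, zero_add, mul_comm, wave, inner_neg_left]
    simp [recip]
  simp only [e]
  rw [(volume_real_cell_mul ha hp).2, ← mul_assoc]
  have : (((volume.real (cell a))⁻¹ : ℝ) : ℂ) * volume.real (cell a) = 1 := by
    rw [← Complex.ofReal_mul, inv_mul_cancel₀ hpos.ne', Complex.ofReal_one]
  rw [this, one_mul]

/-- Decay of order 3 is used: one power pays for the weight, and the other two make the lattice sum
converge. -/
theorem summable_weight_vhat (ha : 0 < a) (hV : IsAdmissible a V) :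
    Summable fun m => (1 + ‖recip a m‖ ^ 2) * ‖vhat ha hV m‖ := by
  obtain ⟨C, hC⟩ := exists_ft_decay ha 3 hV.contDiff_ofReal hV.isPseudoPeriodic
  refine Summable.of_nonneg_of_le (fun m => by positivity) (fun m => ?_)
    ((summable_recip ha).mul_left C)
  rw [← div_eq_mul_inv, le_div_iff₀ (by positivity)]
  calc _ = (1 + ‖recip a m‖ ^ 2) ^ 3 * ‖vhat ha hV m‖ := by ring
    _ ≤ C := hC m

theorem summable_vhat (ha : 0 < a) (hV : IsAdmissible a V) : Summable fun m => ‖vhat ha hV m‖ :=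
  Summable.of_nonneg_of_le (fun m => norm_nonneg _) (fun m => by
    nlinarith [norm_nonneg (vhat ha hV m), sq_nonneg ‖recip a m‖,
      mul_nonneg (sq_nonneg ‖recip a m‖) (norm_nonneg (vhat ha hV m))]) (summable_weight_vhat ha hV)

theorem ofReal_eq_syn (ha : 0 < a) (hV : IsAdmissible a V) (x : E3) :
    (V x : ℂ) = syn a 0 (vhat ha hV) x :=
  congrFun (eq_syn ha ⟨fun x => (V x : ℂ), hV.contDiff_ofReal.continuous, hV.isPseudoPeriodic⟩
    (summable_vhat ha hV) fun _ => rfl) x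

/-- Multiplication by the potential, on the Fourier side. -/
def potOp (ha : 0 < a) (hV : IsAdmissible a V) : Ell2 Idx →L[ℂ] Ell2 Idx := convOp (vhat ha hV)

theorem mul_mem_contPP (hV : IsAdmissible a V) {k : E3} (F : contPP a k) :
    (fun x => (V x : ℂ) * F.1 x) ∈ contPP a k :=
  ⟨hV.contDiff_ofReal.continuous.mul F.2.1, fun x v hv => by
    simp only [hV.periodic x v hv, F.2.2 x v hv]; ring⟩

/-- The convolution theorem: the Fourier series of V converges absolutely, so it may be integrated
against F term by term. -/
theorem ft_mul (ha : 0 < a) (hV : IsAdmissible a V) {k : E3} (F : contPP a k) :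
    ft ha k ⟨_, mul_mem_contPP hV F⟩ = potOp ha hV (ft ha k F) := by
  ext m
  have h1 := hasSum_convOp_apply (summable_vhat ha hV) (ft ha k F) m
  refine HasSum.unique ?_ h1
  have hc : ∀ g : Idx, Continuous fun t : T3 => wave (-mom a k g) (torusSection a ha t) *
      F.1 (torusSection a ha t) := fun g =>
    (torusLift a ha _ ((continuous_wave (-mom a k g)).mul F.2.1)
      (F.2.2.wave_neg_mul ha g)).continuous
  have hs := hasSum_integral_of_summable_integral_norm (μ := (volume : Measure T3))
    (F := fun g t => vhat ha hV g * (wave (-mom a k (m - g)) (torusSection a ha t) *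
      F.1 (torusSection a ha t)))
    (fun g => (continuous_const.mul (hc _)).integrable_of_hasCompactSupport
      (HasCompactSupport.of_compactSpace _)) (by
        simp only [norm_mul, norm_wave, one_mul, integral_const_mul]
        exact (summable_vhat ha hV).mul_right _)
  have e : ft ha k ⟨_, mul_mem_contPP hV F⟩ m = ∫ t : T3, ∑' g, vhat ha hV g *
      (wave (-mom a k (m - g)) (torusSection a ha t) * F.1 (torusSection a ha t)) := by
    rw [ft_apply]
    congr 1
    ext t
    simp only
    rw [ofReal_eq_syn ha hV, syn, ← tsum_mul_right, ← tsum_mul_left]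
    congr 1
    ext g
    have : wave (-mom a k (m - g)) (torusSection a ha t) =
        wave (-mom a k m) (torusSection a ha t) * wave (mom a 0 g) (torusSection a ha t) := by
      rw [← wave_add, mom, mom, mom, recip_sub]
      congr 1; abel
    rw [this]; ring
  rw [e]
  convert! hs using 1
  ext g
  rw [integral_const_mul, ft_apply]

theorem vhat_neg (ha : 0 < a) (hV : IsAdmissible a V) (m : Idx) :
    vhat ha hV (-m) = (starRingEnd ℂ) (vhat ha hV m) := by
  rw [vhat, ft_apply, ft_apply, ← integral_conj]
  congr 1
  ext t
  simp only [mom, zero_add, recip_neg, map_mul, Complex.conj_ofReal, wave_neg, Complex.conj_conj]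

theorem isSymmetric_potOp (ha : 0 < a) (hV : IsAdmissible a V) : (potOp ha hV).IsSymmetric :=
  isSymmetric_convOp (summable_vhat ha hV) (vhat_neg ha hV)

end Potential

/-! ### Eigenfunctions and eigenvectors -/

section Correspondence

variable {a : ℝ} {V : E3 → ℝ} {k : E3} {ε μ : ℝ}

/-- The kinetic energies. -/
def kin (a : ℝ) (k : E3) (m : Idx) : ℝ := ‖mom a k m‖ ^ 2

theorem eigenspace_le_contPP : eigenspace a V k μ ≤ contPP a k :=
  fun _ hF => ⟨hF.1.continuous, hF.2.1⟩

/-- Fourier transforms of eigenfunctions are eigenvectors. -/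
theorem ft_mem_seqEigenspace (ha : 0 < a) (hV : IsAdmissible a V) (F : contPP a k)
    (hF : F.1 ∈ eigenspace a (fun x => ε * V x) k μ) :
    ft ha k F ∈ seqEigenspace (kin a k) ((ε : ℂ) • potOp ha hV) μ := by
  intro m
  have h1 := ft_laplacian ha hF.1 hF.2.1 m
  have e : (⟨_, laplacian_mem_contPP hF.1 hF.2.1⟩ : contPP a k) =
      (ε : ℂ) • ⟨_, mul_mem_contPP hV F⟩ - (μ : ℂ) • F := by
    apply Subtype.ext
    ext x
    have := hF.2.2 x
    push_cast at this
    simp only [Submodule.coe_sub, Submodule.coe_smul, Pi.sub_apply, Pi.smul_apply, smul_eq_mul]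
    linear_combination -this
  rw [e, map_sub, map_smul, map_smul, ft_mul ha hV, lp.coeFn_sub, Pi.sub_apply, lp.coeFn_smul,
    lp.coeFn_smul, Pi.smul_apply, Pi.smul_apply, smul_eq_mul, smul_eq_mul] at h1
  rw [smul_apply, lp.coeFn_smul, lp.coeFn_smul, Pi.smul_apply, Pi.smul_apply, smul_eq_mul,
    smul_eq_mul, kin]
  linear_combination h1

/-- Eigenvectors decay rapidly. -/
theorem summable_of_mem_seqEigenspace (ha : 0 < a) (hV : IsAdmissible a V) {u : Ell2 Idx}
    (hu : u ∈ seqEigenspace (kin a k) ((ε : ℂ) • potOp ha hV) μ) :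
    Summable fun m => ‖u m‖ * (1 + ‖mom a k m‖) ^ 2 := by
  -- By the eigenvalue equation w = (1 + |p|²)u, so one power of the weight comes for free in ℓ².
  set w : Ell2 Idx := ((1 + μ : ℝ) : ℂ) • u - ((ε : ℂ) • potOp ha hV) u with hw
  have hwm : ∀ m, w m = ((1 + kin a k m : ℝ) : ℂ) * u m := fun m => by
    have := hu m
    rw [lp.coeFn_smul, Pi.smul_apply, smul_eq_mul] at this
    rw [hw, lp.coeFn_sub, Pi.sub_apply, lp.coeFn_smul, Pi.smul_apply, smul_eq_mul]
    push_cast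
    linear_combination -this
  -- one more power of the weight
  let w' : Ell2 Idx := ⟨fun m => (‖w m‖ : ℂ), memℓp_two_iff.2 (by simpa using summable_norm_sq w)⟩
  let κ : Idx → ℂ := fun g => ((2 * ((1 + ‖recip a g‖ ^ 2) * ‖vhat ha hV g‖) : ℝ) : ℂ)
  have hκn : ∀ g, ‖κ g‖ = 2 * ((1 + ‖recip a g‖ ^ 2) * ‖vhat ha hV g‖) := fun g => by
    rw [Complex.norm_real, Real.norm_eq_abs, abs_of_nonneg (by positivity)]
  have hκ : Summable fun g => ‖κ g‖ := by
    simp only [hκn]; exact (summable_weight_vhat ha hV).mul_left 2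
  have hdom : ∀ m, (1 + kin a k m) * ‖potOp ha hV u m‖ ≤ ‖convOp κ w' m‖ := fun m => by
    have h1 := hasSum_convOp_apply (summable_vhat ha hV) u m
    have h2 := Complex.hasSum_re (hasSum_convOp_apply hκ w' m)
    have hterm : ∀ g, (1 + kin a k m) * ‖vhat ha hV g * u (m - g)‖ ≤ (κ g * w' (m - g)).re := by
      intro g
      change _ ≤ (((_ : ℝ) : ℂ) * ((‖w (m - g)‖ : ℝ) : ℂ)).re
      rw [← Complex.ofReal_mul, Complex.ofReal_re, hwm, norm_mul, norm_mul, Complex.norm_real,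
        Real.norm_eq_abs, abs_of_pos (by unfold kin; positivity)]
      have h3 := one_add_norm_sq_le (recip a g) (mom a k (m - g))
      have h4 : recip a g + mom a k (m - g) = mom a k m := by
        rw [mom, mom, recip_sub]; abel
      rw [h4] at h3
      calc (1 + kin a k m) * (‖vhat ha hV g‖ * ‖u (m - g)‖)
          ≤ (2 * (1 + ‖recip a g‖ ^ 2) * (1 + ‖mom a k (m - g)‖ ^ 2)) *
            (‖vhat ha hV g‖ * ‖u (m - g)‖) := mul_le_mul_of_nonneg_right h3 (by positivity)
        _ = _ := by unfold kin; ring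
    have hk : 0 ≤ 1 + kin a k m := by unfold kin; positivity
    have hsn : Summable fun g => (1 + kin a k m) * ‖vhat ha hV g * u (m - g)‖ :=
      Summable.of_nonneg_of_le (fun g => by positivity) hterm h2.summable
    calc (1 + kin a k m) * ‖potOp ha hV u m‖ = ‖((1 + kin a k m : ℝ) : ℂ) * potOp ha hV u m‖ := by
          rw [norm_mul, Complex.norm_real, Real.norm_eq_abs, abs_of_nonneg hk]
      _ ≤ ∑' g, (1 + kin a k m) * ‖vhat ha hV g * u (m - g)‖ := by
          have h5 := h1.mul_left ((1 + kin a k m : ℝ) : ℂ)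
          unfold potOp
          rw [← h5.tsum_eq]
          refine tsum_of_norm_bounded hsn.hasSum fun g => ?_
          rw [norm_mul, Complex.norm_real, Real.norm_eq_abs, abs_of_nonneg hk]
      _ ≤ (convOp κ w' m).re := hasSum_le hterm hsn.hasSum h2
      _ ≤ ‖convOp κ w' m‖ := Complex.re_le_norm _
  -- Inserting the weighted bound for the potential term back into the equation shows that (1 +
  -- |p|²)²|u| is dominated by an ℓ² family.
  let z : Ell2 Idx := ((‖(1 + μ : ℝ)‖ : ℝ) : ℂ) • w' + ((|ε| : ℝ) : ℂ) •
    (⟨fun m => (‖convOp κ w' m‖ : ℂ), memℓp_two_iff.2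
      (by simpa using summable_norm_sq (convOp κ w'))⟩ : Ell2 Idx)
  have hz : ∀ m, (1 + kin a k m) ^ 2 * ‖u m‖ ≤ ‖z m‖ := fun m => by
    have hk : 0 ≤ 1 + kin a k m := by unfold kin; positivity
    have e1 : (1 + kin a k m) * ‖u m‖ = ‖w m‖ := by
      rw [hwm, norm_mul, Complex.norm_real, Real.norm_eq_abs, abs_of_nonneg hk]
    have e2 : ‖w m‖ ≤ ‖(1 + μ : ℝ)‖ * ‖u m‖ + |ε| * ‖potOp ha hV u m‖ := by
      have : w m = ((1 + μ : ℝ) : ℂ) * u m - (ε : ℂ) * potOp ha hV u m := rfl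
      rw [this]
      refine (norm_sub_le _ _).trans (le_of_eq ?_)
      rw [norm_mul, norm_mul, Complex.norm_real, Complex.norm_real, Real.norm_eq_abs ε]
    have e3 : ‖z m‖ = ‖(1 + μ : ℝ)‖ * ‖w m‖ + |ε| * ‖convOp κ w' m‖ := by
      have : z m = ((‖(1 + μ : ℝ)‖ * ‖w m‖ + |ε| * ‖convOp κ w' m‖ : ℝ) : ℂ) := by
        push_cast; rfl
      rw [this, Complex.norm_real, Real.norm_eq_abs, abs_of_nonneg (by positivity)]
    rw [e3, pow_two, mul_assoc, e1]
    have h6 := mul_le_mul_of_nonneg_left e2 hk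
    have h7 := mul_le_mul_of_nonneg_left (hdom m) (abs_nonneg ε)
    rw [← e1]
    nlinarith
  -- With y = (1 + |p|²)⁻¹ the weighted entry is at most 2y|z| ≤ y² + |z|², and both families on the
  -- right are summable.
  refine Summable.of_nonneg_of_le (fun m => by positivity) (fun m => ?_)
    ((summable_mom ha k).add (summable_norm_sq z))
  have hk : 0 < 1 + ‖mom a k m‖ ^ 2 := by positivity
  have h8 : ‖u m‖ ≤ ‖z m‖ * ((1 + ‖mom a k m‖ ^ 2) ^ 2)⁻¹ := by
    rw [← div_eq_mul_inv, le_div_iff₀ (by positivity), mul_comm]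
    exact hz m
  have h9 : (1 + ‖mom a k m‖) ^ 2 ≤ 2 * (1 + ‖mom a k m‖ ^ 2) := by
    nlinarith [sq_nonneg (1 - ‖mom a k m‖)]
  set y := (1 + ‖mom a k m‖ ^ 2)⁻¹ with hy
  have hy0 : 0 < y := inv_pos.2 hk
  have hyk : y * (1 + ‖mom a k m‖ ^ 2) = 1 := inv_mul_cancel₀ hk.ne'
  have h10 : ((1 + ‖mom a k m‖ ^ 2) ^ 2)⁻¹ = y ^ 2 := by rw [hy, inv_pow]
  rw [h10] at h8 ⊢
  calc ‖u m‖ * (1 + ‖mom a k m‖) ^ 2 ≤ (‖z m‖ * y ^ 2) * (2 * (1 + ‖mom a k m‖ ^ 2)) := by gcongr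
    _ = 2 * ‖z m‖ * y * (y * (1 + ‖mom a k m‖ ^ 2)) := by ring
    _ ≤ y ^ 2 + ‖z m‖ ^ 2 := by rw [hyk]; nlinarith [sq_nonneg (y - ‖z m‖)]

theorem summable_norm_of_weight {c : Idx → ℂ} {n : ℕ}
    (hc : Summable fun m => ‖c m‖ * (1 + ‖mom a k m‖) ^ n) : Summable fun m => ‖c m‖ :=
  Summable.of_nonneg_of_le (fun m => norm_nonneg _) (fun m => le_mul_of_one_le_right (norm_nonneg _)
    (one_le_pow₀ (by linarith [norm_nonneg (mom a k m)]))) hc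

/-- Eigenvectors are the Fourier transforms of eigenfunctions. -/
theorem syn_mem_eigenspace (ha : 0 < a) (hV : IsAdmissible a V) {u : Ell2 Idx}
    (hu : u ∈ seqEigenspace (kin a k) ((ε : ℂ) • potOp ha hV) μ) :
    syn a k u ∈ eigenspace a (fun x => ε * V x) k μ := by
  have hs2 := summable_of_mem_seqEigenspace ha hV hu
  have hs0 := summable_norm_of_weight hs2
  have hC : ContDiff ℝ 2 (syn a k u) := by exact_mod_cast contDiff_syn 2 hs2
  have hp := (syn_mem_contPP hs0 ha k).2
  refine ⟨hC, hp, fun x => ?_⟩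
  have hft : ft ha k ⟨syn a k u, hC.continuous, hp⟩ = u := by
    ext m; exact ft_syn ha hs0 m
  have e : (⟨_, laplacian_mem_contPP hC hp⟩ : contPP a k) =
      (ε : ℂ) • ⟨_, mul_mem_contPP hV ⟨syn a k u, hC.continuous, hp⟩⟩ -
        (μ : ℂ) • ⟨syn a k u, hC.continuous, hp⟩ := by
    apply ft_injective ha
    ext m
    rw [ft_laplacian ha hC hp, map_sub, map_smul, map_smul, ft_mul ha hV, hft, lp.coeFn_sub, Pi.sub_apply]
    have := hu m
    rw [smul_apply] at this
    rw [← this, kin]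
    ring
  have e2 := congrFun (congrArg Subtype.val e) x
  simp only [Submodule.coe_sub, Submodule.coe_smul, Pi.sub_apply, Pi.smul_apply, smul_eq_mul] at e2
  rw [e2]
  push_cast
  ring

/-- The eigenvalue problems have the same multiplicities. -/
theorem rank_spectralSpan (ha : 0 < a) (hV : IsAdmissible a V) (I : Set ℝ) :
    Module.rank ℂ (spectralSpan a (fun x => ε * V x) k I) =
      Module.rank ℂ (seqSpan (kin a k) ((ε : ℂ) • potOp ha hV) I) := by
  set V' : E3 → ℝ := fun x => ε * V x
  -- Both spans are injective images of one subspace of the continuous pseudo-periodic functions: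
  -- one under the inclusion, the other under the Fourier transform.
  let E : ℝ → Submodule ℂ (contPP a k) := fun ν => (eigenspace a V' k ν).comap (contPP a k).subtype
  have h1 : (⨆ ν ∈ I, E ν).map (contPP a k).subtype = spectralSpan a V' k I := by
    rw [Submodule.map_iSup]
    simp only [Submodule.map_iSup, spectralSpan, E]
    refine iSup_congr fun ν => iSup_congr fun _ => ?_
    rw [Submodule.map_comap_subtype, inf_eq_right.2 eigenspace_le_contPP]
  have h2 : (⨆ ν ∈ I, E ν).map (ft ha k) = seqSpan (kin a k) ((ε : ℂ) • potOp ha hV) I := by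
    rw [Submodule.map_iSup]
    simp only [Submodule.map_iSup, seqSpan, E]
    refine iSup_congr fun ν => iSup_congr fun _ => le_antisymm ?_ ?_
    · rintro _ ⟨F, hF, rfl⟩
      exact ft_mem_seqEigenspace ha hV F hF
    · intro u hu
      have hs0 := summable_norm_of_weight (summable_of_mem_seqEigenspace ha hV hu)
      exact ⟨⟨syn a k u, syn_mem_contPP hs0 ha k⟩, syn_mem_eigenspace ha hV hu, by
        ext m; exact ft_syn ha hs0 m⟩
  rw [← h1, ← h2]
  exact (LinearEquiv.rank_eq (Submodule.equivMapOfInjective _ (Submodule.injective_subtype _) _)).symm.trans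
    (LinearEquiv.rank_eq (Submodule.equivMapOfInjective _ (ft_injective ha) _))

theorem isBandValue_iff (ha : 0 < a) (hV : IsAdmissible a V) {b : ℕ} :
    IsBandValue a (fun x => ε * V x) k b μ ↔
      Module.rank ℂ (seqSpan (kin a k) ((ε : ℂ) • potOp ha hV) (Set.Iio μ)) < (b : Cardinal) ∧
        (b : Cardinal) ≤ Module.rank ℂ (seqSpan (kin a k) ((ε : ℂ) • potOp ha hV) (Set.Iic μ)) := by
  rw [IsBandValue, rank_spectralSpan ha hV, rank_spectralSpan ha hV]

end Correspondence

end

section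

/-! ### Point symmetries -/

section Symmetry

variable {a : ℝ}

theorem recip_apply (a : ℝ) (m : Idx) : recip a m =
    !₂[qScale a * (m 0 + m 1), qScale a * (m 1 + m 2), qScale a * (-m 0 - m 2)] := by
  ext j
  fin_cases j <;> simp [recip, Fin.sum_univ_three, dualVec] <;> ring

theorem mom_ptK (a : ℝ) (m : Idx) : mom a (ptK a) m =
    !₂[qScale a * (m 0 + m 1 - 1 / 2), qScale a * (m 1 + m 2 - 1 / 2),
      qScale a * (1 / 2 - m 0 - m 2)] := by
  rw [mom, recip_apply]
  ext j
  fin_cases j <;> simp [ptK, dualVec] <;> ring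

theorem toEuclideanLin_matR (x : E3) :
    Matrix.toEuclideanLin matR x = !₂[-x 1, x 0, -x 2] := by
  ext j
  fin_cases j <;> simp [matR, Matrix.toLpLin_apply, dotProduct,
    Fin.sum_univ_three]

theorem toEuclideanLin_matT (x : E3) :
    Matrix.toEuclideanLin matT x = !₂[-x 0, -x 2, x 1] := by
  ext j
  fin_cases j <;> simp [matT, Matrix.toLpLin_apply, dotProduct,
    Fin.sum_univ_three]

theorem inner_toEuclideanLin_transpose (M : Matrix (Fin 3) (Fin 3) ℝ) (x y : E3) :
    inner ℝ x (Matrix.toEuclideanLin Mᵀ y) = inner ℝ (Matrix.toEuclideanLin M x) y := by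
  simp only [PiLp.inner_apply, Matrix.toLpLin_apply, Matrix.mulVec, dotProduct,
    Fin.sum_univ_three, Matrix.transpose_apply, RCLike.inner_apply, RCLike.conj_to_real]
  ring

/-- A permutation of the momenta `K + Λ*` induced by a linear symmetry `M`, with linear part `g`. -/
structure IsSymPerm (a : ℝ) (M : Matrix (Fin 3) (Fin 3) ℝ) (σ g : Equiv.Perm Idx) : Prop where
  mom_eq : ∀ m, mom a (ptK a) (σ m) = Matrix.toEuclideanLin M (mom a (ptK a) m)
  recip_eq : ∀ m, recip a (g m) = Matrix.toEuclideanLin M (recip a m)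
  sub_eq : ∀ m n, σ m - σ n = g (m - n)
  norm_eq : ∀ x, ‖Matrix.toEuclideanLin M x‖ = ‖x‖

/-- The permutation of `K + Λ*` induced by `R`. -/
def permR : Equiv.Perm Idx where
  -- The 1 is the shift RK = K + q₁, which makes the action on K + Λ* affine.
  toFun m := ![1 - m 0 - m 1 - m 2, m 0, m 1]
  invFun m := ![m 1, m 2, 1 - m 0 - m 1 - m 2]
  left_inv m := by ext j; fin_cases j <;> simp; ring
  right_inv m := by ext j; fin_cases j <;> simp

/-- The permutation of `Λ*` induced by `R`. -/
def linR : Equiv.Perm Idx where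
  toFun m := ![-m 0 - m 1 - m 2, m 0, m 1]
  invFun m := ![m 1, m 2, -m 0 - m 1 - m 2]
  left_inv m := by ext j; fin_cases j <;> simp; ring
  right_inv m := by ext j; fin_cases j <;> simp; ring

/-- The permutation of `K + Λ*` induced by `T`. -/
def permT : Equiv.Perm Idx where
  toFun m := ![1 - m 0 - m 1 - m 2, m 2, m 0]
  invFun m := ![m 2, 1 - m 0 - m 1 - m 2, m 1]
  left_inv m := by ext j; fin_cases j <;> simp; ring
  right_inv m := by ext j; fin_cases j <;> simp; ring

/-- The permutation of `Λ*` induced by `T`. -/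
def linT : Equiv.Perm Idx where
  toFun m := ![-m 0 - m 1 - m 2, m 2, m 0]
  invFun m := ![m 2, -m 0 - m 1 - m 2, m 1]
  left_inv m := by ext j; fin_cases j <;> simp
  right_inv m := by ext j; fin_cases j <;> simp; ring

theorem isSymPerm_R (a : ℝ) : IsSymPerm a matR permR linR where
  mom_eq m := by
    rw [toEuclideanLin_matR, mom_ptK, mom_ptK]
    ext j; fin_cases j <;> simp [permR] <;> ring
  recip_eq m := by
    rw [toEuclideanLin_matR, recip_apply, recip_apply]
    ext j; fin_cases j <;> simp [linR] <;> ring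
  sub_eq m n := by ext j; fin_cases j <;> simp [permR, linR]; ring
  norm_eq x := by
    rw [toEuclideanLin_matR, EuclideanSpace.norm_eq, EuclideanSpace.norm_eq]
    congr 1
    simp [Fin.sum_univ_three]; ring

theorem isSymPerm_T (a : ℝ) : IsSymPerm a matT permT linT where
  mom_eq m := by
    rw [toEuclideanLin_matT, mom_ptK, mom_ptK]
    ext j; fin_cases j <;> simp [permT, -mul_eq_mul_left_iff] <;> ring
  recip_eq m := by
    rw [toEuclideanLin_matT, recip_apply, recip_apply]
    ext j; fin_cases j <;> simp [linT, -mul_eq_mul_left_iff] <;> ring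
  sub_eq m n := by ext j; fin_cases j <;> simp [permT, linT]; ring
  norm_eq x := by
    rw [toEuclideanLin_matT, EuclideanSpace.norm_eq, EuclideanSpace.norm_eq]
    congr 1
    simp [Fin.sum_univ_three]; ring

theorem wave_toEuclideanLin_transpose (M : Matrix (Fin 3) (Fin 3) ℝ) (p x : E3) :
    wave p (Matrix.toEuclideanLin Mᵀ x) = wave (Matrix.toEuclideanLin M p) x := by
  rw [wave, wave, inner_toEuclideanLin_transpose]

variable {M : Matrix (Fin 3) (Fin 3) ℝ} {σ g : Equiv.Perm Idx}

theorem IsSymPerm.pull_syn (h : IsSymPerm a M σ g) (c : Idx → ℂ) :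
    pull M (syn a (ptK a) c) = syn a (ptK a) fun m => c (σ.symm m) := by
  ext x
  rw [pull, syn, syn, ← σ.tsum_eq (fun m => c (σ.symm m) * wave (mom a (ptK a) m) x)]
  congr 1; ext m
  rw [wave_toEuclideanLin_transpose, h.mom_eq, Equiv.symm_apply_apply]

theorem IsSymPerm.pull_syn_zero (h : IsSymPerm a M σ g) (c : Idx → ℂ) :
    pull M (syn a 0 c) = syn a 0 fun m => c (g.symm m) := by
  ext x
  rw [pull, syn, syn, ← g.tsum_eq (fun m => c (g.symm m) * wave (mom a 0 m) x)]
  congr 1; ext m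
  rw [wave_toEuclideanLin_transpose, mom, mom, zero_add, zero_add, h.recip_eq,
    Equiv.symm_apply_apply]

theorem IsSymPerm.kin_eq (h : IsSymPerm a M σ g) (m : Idx) :
    kin a (ptK a) (σ m) = kin a (ptK a) m := by
  rw [kin, kin, h.mom_eq, h.norm_eq]

variable {V : E3 → ℝ} (ha : 0 < a) (hV : IsAdmissible a V)

/-- Invariance of V means that permuting its Fourier coefficients by the linear part gives the same
function; coefficients are unique. -/
theorem IsSymPerm.vhat_eq (h : IsSymPerm a M σ g) (hM : pull M V = V) (m : Idx) :
    vhat ha hV (g m) = vhat ha hV m := by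
  have hs := summable_vhat ha hV
  have hs' : Summable fun m => ‖vhat ha hV (g.symm m)‖ := hs.comp_injective g.symm.injective
  have e : syn a 0 (vhat ha hV) = syn a 0 fun m => vhat ha hV (g.symm m) := by
    rw [← h.pull_syn_zero]
    ext x
    rw [← ofReal_eq_syn, pull, ← ofReal_eq_syn]
    exact congrArg _ (congrFun hM x).symm
  have h1 := ft_syn ha (k := 0) hs (g m)
  have h2 := ft_syn ha (k := 0) hs' (g m)
  simp only [e, Equiv.symm_apply_apply] at h1 h2
  rw [← h1, ← h2]

theorem vhat_neg' (m : Idx) : vhat ha hV (-m) = vhat ha hV m := by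
  have hs := summable_vhat ha hV
  have hs' : Summable fun m => ‖vhat ha hV (-m)‖ := hs.comp_injective neg_injective
  have e : syn a 0 (vhat ha hV) = syn a 0 fun m => vhat ha hV (-m) := by
    ext x
    rw [← ofReal_eq_syn, ← hV.even, ofReal_eq_syn ha hV, syn, syn, ← (Equiv.neg Idx).tsum_eq]
    congr 1; ext m
    rw [Equiv.neg_apply, mom, mom, zero_add, zero_add, recip_neg, wave, wave, inner_neg_left,
      inner_neg_right, neg_neg]
  have h1 := ft_syn ha (k := 0) hs m
  have h2 := ft_syn ha (k := 0) hs' m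
  simp only [e] at h1 h2
  rw [← h1, ← h2]

theorem conj_vhat (m : Idx) : (starRingEnd ℂ) (vhat ha hV m) = vhat ha hV m := by
  rw [← vhat_neg, vhat_neg']

/-- The kernel depends only on differences of indices; the affine map σ acts on these through its
linear part g, which preserves the coefficients of V. -/
theorem IsSymPerm.potOp_permOp (h : IsSymPerm a M σ g) (hM : pull M V = V) (u : Ell2 Idx) :
    potOp ha hV (permOp σ u) = permOp σ (potOp ha hV u) := by
  ext m
  have h1 := hasSum_convOp_apply (summable_vhat ha hV) (permOp σ u) m
  have h2 := hasSum_convOp_apply (summable_vhat ha hV) u (σ.symm m)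
  refine (g.hasSum_iff.2 h1).unique ?_
  convert! h2 using 1
  ext n
  simp only [Function.comp_apply, h.vhat_eq ha hV hM, permOp_apply]
  have := h.sub_eq (σ.symm m) (σ.symm m - n)
  rw [Equiv.apply_symm_apply, sub_sub_cancel] at this
  rw [show σ.symm (m - g n) = σ.symm m - n by rw [← this, sub_sub_cancel, Equiv.symm_apply_apply]]

theorem potOp_star (u : Ell2 Idx) : potOp ha hV (star u) = star (potOp ha hV u) := by
  ext m
  have h1 := hasSum_convOp_apply (summable_vhat ha hV) (star u) m
  have h2 := Complex.hasSum_conj'.2 (hasSum_convOp_apply (summable_vhat ha hV) u m)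
  refine h1.unique ?_
  convert! h2 using 1
  ext n
  rw [map_mul, conj_vhat]
  rfl

variable {ε : ℝ}

theorem IsSymPerm.hRel_permOp (h : IsSymPerm a M σ g) (hM : pull M V = V) {u v : Ell2 Idx}
    (huv : HRel (kin a (ptK a)) ((ε : ℂ) • potOp ha hV) u v) :
    HRel (kin a (ptK a)) ((ε : ℂ) • potOp ha hV) (permOp σ u) (permOp σ v) := fun m => by
  have := huv (σ.symm m)
  rw [smul_apply, lp.coeFn_smul, Pi.smul_apply] at this ⊢
  have hk := h.kin_eq (σ.symm m)
  rw [Equiv.apply_symm_apply] at hk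
  rw [h.potOp_permOp ha hV hM, permOp_apply, permOp_apply, permOp_apply, ← this, hk]

theorem hRel_star {k : E3} {u v : Ell2 Idx}
    (huv : HRel (kin a k) ((ε : ℂ) • potOp ha hV) u v) :
    HRel (kin a k) ((ε : ℂ) • potOp ha hV) (star u) (star v) := fun m => by
  have := congrArg (starRingEnd ℂ) (huv m)
  rw [smul_apply, lp.coeFn_smul, Pi.smul_apply, smul_eq_mul] at this ⊢
  rw [potOp_star]
  simpa using! this

theorem IsSymPerm.permOp_mem_seqEigenspace (h : IsSymPerm a M σ g) (hM : pull M V = V) {ν : ℝ}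
    {u : Ell2 Idx} (hu : u ∈ seqEigenspace (kin a (ptK a)) ((ε : ℂ) • potOp ha hV) ν) :
    permOp σ u ∈ seqEigenspace (kin a (ptK a)) ((ε : ℂ) • potOp ha hV) ν := by
  have := h.hRel_permOp ha hV hM hu
  rwa [map_smul] at this

theorem star_mem_seqEigenspace {ν : ℝ} {k : E3}
    {u : Ell2 Idx} (hu : u ∈ seqEigenspace (kin a k) ((ε : ℂ) • potOp ha hV) ν) :
    star u ∈ seqEigenspace (kin a k) ((ε : ℂ) • potOp ha hV) ν := by
  have := hRel_star ha hV hu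
  rwa [star_smul, show star (ν : ℂ) = ν from Complex.conj_ofReal ν] at this

theorem IsSymPerm.permOp_mem_seqSpan (h : IsSymPerm a M σ g) (hM : pull M V = V) {I : Set ℝ}
    {u : Ell2 Idx} (hu : u ∈ seqSpan (kin a (ptK a)) ((ε : ℂ) • potOp ha hV) I) :
    permOp σ u ∈ seqSpan (kin a (ptK a)) ((ε : ℂ) • potOp ha hV) I := by
  obtain ⟨f, hf, hI, rfl⟩ := mem_seqSpan hu
  rw [map_sum]
  exact Submodule.sum_mem _ fun ν hν => seqEigenspace_le_seqSpan (hI ν hν)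
    (h.permOp_mem_seqEigenspace ha hV hM (hf ν))

theorem star_mem_seqSpan {I : Set ℝ} {k : E3}
    {u : Ell2 Idx} (hu : u ∈ seqSpan (kin a k) ((ε : ℂ) • potOp ha hV) I) :
    star u ∈ seqSpan (kin a k) ((ε : ℂ) • potOp ha hV) I := by
  obtain ⟨f, hf, hI, rfl⟩ := mem_seqSpan hu
  rw [star_sum]
  exact Submodule.sum_mem _ fun ν hν => seqEigenspace_le_seqSpan (hI ν hν)
    (star_mem_seqEigenspace ha hV (hf ν))

end Symmetry

end

section

/-! ### The four lowest modes at `K` -/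

section LowModes

/-- The four shortest momenta of `K + Λ*`. -/
def low : Fin 4 → Idx := ![![0, 0, 0], ![1, 0, 0], ![0, 1, 0], ![0, 0, 1]]

theorem low_injective : Function.Injective low := by decide

/-- Up to sign each coordinate of a momentum at K is q(n - 1/2) with n an integer, whose square is
q²(n(n - 1) + 1/4). The integer part is a sum of products of consecutive integers, and this produces
the spectral gap. -/
theorem kin_ptK (a : ℝ) (m : Idx) : kin a (ptK a) m = qScale a ^ 2 *
    ((((m 0 + m 1) * (m 0 + m 1 - 1) + (m 1 + m 2) * (m 1 + m 2 - 1) +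
      (m 0 + m 2) * (m 0 + m 2 - 1) : ℤ) : ℝ) + 3 / 4) := by
  rw [kin, mom_ptK, EuclideanSpace.norm_sq_eq, Fin.sum_univ_three]
  simp only [Real.norm_eq_abs, sq_abs]
  push_cast
  simp
  ring

theorem kin_low (a : ℝ) (i : Fin 4) : kin a (ptK a) (low i) = 3 / 4 * qScale a ^ 2 := by
  rw [kin_ptK]
  fin_cases i <;> simp [low] <;> ring

/-- Each x(x - 1) is 0 or at least 2. If all three vanish, the pair sums of m lie in {0, 1}; their
total is even, which leaves only the four low indices. -/
theorem le_kin_of_ne_low (a : ℝ) {m : Idx} (hm : ∀ i, m ≠ low i) :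
    11 / 4 * qScale a ^ 2 ≤ kin a (ptK a) m := by
  have key : (2 : ℤ) ≤ (m 0 + m 1) * (m 0 + m 1 - 1) + (m 1 + m 2) * (m 1 + m 2 - 1) +
      (m 0 + m 2) * (m 0 + m 2 - 1) := by
    by_contra! hlt
    have h2 : ∀ x : ℤ, x * (x - 1) < 2 → x = 0 ∨ x = 1 := fun x hx => by
      have h1 : x < 2 := by nlinarith
      have h3 : -1 < x := by nlinarith
      omega
    have h0 : ∀ x : ℤ, 0 ≤ x * (x - 1) := fun x => by
      rcases le_or_gt x 0 with h | h
      · nlinarith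
      · exact mul_nonneg h.le (by omega)
    have ha := h2 (m 0 + m 1) (by linarith [h0 (m 1 + m 2), h0 (m 0 + m 2)])
    have hb := h2 (m 1 + m 2) (by linarith [h0 (m 0 + m 1), h0 (m 0 + m 2)])
    have hc := h2 (m 0 + m 2) (by linarith [h0 (m 0 + m 1), h0 (m 1 + m 2)])
    have hne : ∀ i, ¬ (m 0 = low i 0 ∧ m 1 = low i 1 ∧ m 2 = low i 2) := fun i h =>
      hm i (by ext j; fin_cases j <;> simp [h])
    have n0 := hne 0
    have n1 := hne 1
    have n2 := hne 2
    have n3 := hne 3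
    simp [low] at n0 n1 n2 n3
    omega
  have key' : (2 : ℝ) ≤ (((m 0 + m 1) * (m 0 + m 1 - 1) + (m 1 + m 2) * (m 1 + m 2 - 1) +
      (m 0 + m 2) * (m 0 + m 2 - 1) : ℤ) : ℝ) := by exact_mod_cast key
  rw [kin_ptK]
  nlinarith [sq_nonneg (qScale a)]

/-- The restriction of a sequence to the four lowest modes. -/
def lowMap : Ell2 Idx →ₗ[ℂ] (Fin 4 → ℂ) where
  toFun u i := u (low i)
  map_add' _ _ := rfl
  map_smul' _ _ := rfl

theorem lowMap_apply (u : Ell2 Idx) (i : Fin 4) : lowMap u i = u (low i) := rfl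

theorem lowMap_permR (u : Ell2 Idx) (i : Fin 4) :
    lowMap (permOp permR u) i = lowMap u (![3, 0, 1, 2] i) := by
  rw [lowMap_apply, lowMap_apply, permOp_apply]
  exact congrArg u (by revert i; decide)

theorem lowMap_permT (u : Ell2 Idx) (i : Fin 4) :
    lowMap (permOp permT u) i = lowMap u (![2, 0, 3, 1] i) := by
  rw [lowMap_apply, lowMap_apply, permOp_apply]
  exact congrArg u (by revert i; decide)

theorem lowMap_star (u : Ell2 Idx) (i : Fin 4) :
    lowMap (star u) i = (starRingEnd ℂ) (lowMap u i) := rfl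

/-- The leading parts of the three eigenvectors. -/
def lead : Fin 3 → Fin 4 → ℝ :=
  ![![-(1 / 2), 1 / 2, 1 / 2, -(1 / 2)], ![-(1 / 2), -(1 / 2), 1 / 2, 1 / 2],
    ![1 / 2, -(1 / 2), 1 / 2, -(1 / 2)]]

variable {a : ℝ} (ha : 0 < a) {V : E3 → ℝ} (hV : IsAdmissible a V) {ε : ℝ}

/-- The span of the eigenvectors with eigenvalue below the gap. -/
abbrev lowSpan (ε : ℝ) : Submodule ℂ (Ell2 Idx) :=
  seqSpan (kin a (ptK a)) ((ε : ℂ) • potOp ha hV) (Set.Iic (7 / 4 * qScale a ^ 2))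

theorem isSymmetric_smul_potOp (ε : ℝ) : ((ε : ℂ) • potOp ha hV).IsSymmetric := fun u v => by
  change inner ℂ ((ε : ℂ) • potOp ha hV u) v = inner ℂ u ((ε : ℂ) • potOp ha hV v)
  rw [inner_smul_left, inner_smul_right, Complex.conj_ofReal]
  exact congrArg _ (isSymmetric_potOp ha hV u v)

theorem qScale_pos (ha : 0 < a) : 0 < qScale a := by
  unfold qScale; positivity

/-- Without low modes the kinetic form is at least 11q²/4, and the potential costs at most q²/20.
The threshold 7q²/4 is midway between the two lowest kinetic levels. -/
theorem lt_re_inner_of_lowMap_eq_zero (hε : ‖(ε : ℂ) • potOp ha hV‖ ≤ qScale a ^ 2 / 20)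
    {u v : Ell2 Idx} (huv : HRel (kin a (ptK a)) ((ε : ℂ) • potOp ha hV) u v)
    (hu : lowMap u = 0) (hne : u ≠ 0) :
    7 / 4 * qScale a ^ 2 * ‖u‖ ^ 2 < (inner ℂ u v).re := by
  have h := huv.le_re_inner (c := 11 / 4 * qScale a ^ 2) fun m hm =>
    le_kin_of_ne_low a fun i hi => hm (by rw [hi]; exact congrFun hu i)
  have h1 : 0 < ‖u‖ ^ 2 := by positivity
  have h2 : 0 < qScale a ^ 2 := by have := qScale_pos ha; positivity
  refine lt_of_lt_of_le ?_ h
  exact mul_lt_mul_of_pos_right (by linarith) h1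

/-- The four low entries serve as functionals for the upper count. The four low plane waves serve as
trial vectors for the lower count, with form at most (3/4 + 1/20)q². -/
theorem rank_lowSpan (hε : ‖(ε : ℂ) • potOp ha hV‖ ≤ qScale a ^ 2 / 20) :
    Module.rank ℂ (lowSpan ha hV ε) = 4 := by
  classical
  refine le_antisymm (rank_seqSpan_le (n := 4) (isSymmetric_smul_potOp ha hV ε) lowMap
    fun u v h1 h2 h3 => lt_re_inner_of_lowMap_eq_zero ha hV hε h1 h2 h3) ?_
  set w : Fin 4 → Ell2 Idx := fun i => lp.single 2 (low i) 1 with hw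
  have hwm : ∀ i j, lowMap (w i) j = if i = j then 1 else 0 := fun i j => by
    rw [lowMap_apply, hw]
    rw [lp.single_apply]
    by_cases h : i = j
    · subst h; simp
    · rw [Pi.single_eq_of_ne (fun h' => h (low_injective h').symm), if_neg h]
  have hli : LinearIndependent ℂ w := by
    refine LinearIndependent.of_comp lowMap ?_
    convert! (Pi.basisFun ℂ (Fin 4)).linearIndependent using 1
    ext i j
    rw [Function.comp_apply, hwm, Pi.basisFun_apply, Pi.single_apply]
    simp [eq_comm]
  have hoff : ∀ u ∈ Submodule.span ℂ (Set.range w), ∀ m, (∀ i, m ≠ low i) → u m = 0 := by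
    intro u hu m hm
    induction hu using Submodule.span_induction with
    | mem x hx =>
      obtain ⟨i, rfl⟩ := hx
      rw [hw, lp.single_apply, Pi.single_eq_of_ne (hm i)]
    | zero => rfl
    | add x y _ _ h1 h2 => rw [lp.coeFn_add, Pi.add_apply, h1, h2, add_zero]
    | smul c x _ h1 => rw [lp.coeFn_smul, Pi.smul_apply, h1, smul_zero]
  have hfr : Module.finrank ℂ (Submodule.span ℂ (Set.range w)) = 4 := by
    rw [finrank_span_eq_card hli]; rfl
  have hfd : FiniteDimensional ℂ (Submodule.span ℂ (Set.range w)) :=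
    FiniteDimensional.span_of_finite ℂ (Set.finite_range w)
  have := le_rank_seqSpan (isSymmetric_smul_potOp ha hV ε) (tendsto_mom ha (ptK a))
    (fun m => sq_nonneg _) (μ := 7 / 4 * qScale a ^ 2) (Submodule.span ℂ (Set.range w))
    (fun u hu => ⟨((3 / 4 * qScale a ^ 2 : ℝ) : ℂ) • u + ((ε : ℂ) • potOp ha hV) u, fun m => ?_, ?_⟩)
  · rw [hfr] at this; exact_mod_cast this
  · rw [lp.coeFn_add, Pi.add_apply, lp.coeFn_smul, Pi.smul_apply, smul_eq_mul]
    by_cases hm : ∃ i, m = low i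
    · obtain ⟨i, rfl⟩ := hm
      exact congrArg (fun t : ℝ => (t : ℂ) * u (low i) + ((ε : ℂ) • potOp ha hV) u (low i))
        (kin_low a i)
    · push Not at hm
      rw [hoff u hu m hm, mul_zero, mul_zero]
  · rw [inner_add_right, inner_smul_right, inner_self_eq_norm_sq_to_K, Complex.add_re]
    have h1 : (inner ℂ u (((ε : ℂ) • potOp ha hV) u)).re ≤ qScale a ^ 2 / 20 * ‖u‖ ^ 2 := by
      refine (Complex.re_le_norm _).trans ((norm_inner_le_norm _ _).trans ?_)
      have h2 := (((ε : ℂ) • potOp ha hV).le_opNorm u).trans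
        (mul_le_mul_of_nonneg_right hε (norm_nonneg u))
      nlinarith [norm_nonneg u]
    have h2 : (((3 / 4 * qScale a ^ 2 : ℝ) : ℂ) * ((‖u‖ : ℂ)) ^ 2).re =
        3 / 4 * qScale a ^ 2 * ‖u‖ ^ 2 := by
      rw [← Complex.ofReal_pow, ← Complex.ofReal_mul, Complex.ofReal_re]
    have h3 : 0 ≤ qScale a ^ 2 * ‖u‖ ^ 2 := by positivity
    rw [show ((RCLike.ofReal ‖u‖ : ℂ)) = ((‖u‖ : ℝ) : ℂ) from rfl, h2]
    nlinarith

/-- A nonzero difference would have form at most 7q²/4 as a spectral vector and larger form as a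
vector without low entries. This reduces identities in the low spectral space to identities in ℂ⁴.
-/
theorem eq_of_lowMap_eq (hε : ‖(ε : ℂ) • potOp ha hV‖ ≤ qScale a ^ 2 / 20) {u v : Ell2 Idx}
    (hu : u ∈ lowSpan ha hV ε) (hv : v ∈ lowSpan ha hV ε) (h : lowMap u = lowMap v) : u = v := by
  by_contra hne
  obtain ⟨w, -, hw, hle⟩ := exists_hRel_of_mem_seqSpan_Iic (isSymmetric_smul_potOp ha hV ε)
    (Submodule.sub_mem _ hu hv)
  exact absurd (lt_re_inner_of_lowMap_eq_zero ha hV hε hw (by rw [map_sub, h, sub_self])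
    (sub_ne_zero.2 hne)) (not_lt.2 hle)

theorem exists_lowMap_eq (hε : ‖(ε : ℂ) • potOp ha hV‖ ≤ qScale a ^ 2 / 20) (c : Fin 4 → ℂ) :
    ∃ u ∈ lowSpan ha hV ε, lowMap u = c := by
  have hr := rank_lowSpan ha hV hε
  have hfd : FiniteDimensional ℂ (lowSpan ha hV ε) := by
    refine Module.rank_lt_aleph0_iff.1 ?_
    rw [hr]; exact_mod_cast Cardinal.natCast_lt_aleph0
  have hfr : Module.finrank ℂ (lowSpan ha hV ε) = Module.finrank ℂ (Fin 4 → ℂ) := by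
    rw [Module.finrank_fin_fun]; exact Module.finrank_eq_of_rank_eq (by rw [hr]; rfl)
  have hinj : Function.Injective (lowMap.comp (lowSpan ha hV ε).subtype) := fun u v h =>
    Subtype.ext (eq_of_lowMap_eq ha hV hε u.2 v.2 h)
  obtain ⟨u, hu⟩ := (LinearMap.injective_iff_surjective_of_finrank_eq_finrank hfr).1 hinj c
  exact ⟨u, u.2, hu⟩

end LowModes

end

section

/-! ### Splitting of the low spectral space under the symmetries -/

section LowEigenvectors

variable {a : ℝ} (ha : 0 < a) {V : E3 → ℝ} (hV : IsAdmissible a V) {ε : ℝ}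

/-- The operator preserves the low spectral space, where vectors are determined by their low
entries. Proportional low entries thus force Hu = tu, and t is real by symmetry. -/
theorem exists_mem_seqEigenspace_of_lowMap (hε : ‖(ε : ℂ) • potOp ha hV‖ ≤ qScale a ^ 2 / 20)
    {u : Ell2 Idx} (hu : u ∈ lowSpan ha hV ε) (hne : u ≠ 0)
    (h : ∀ v, HRel (kin a (ptK a)) ((ε : ℂ) • potOp ha hV) u v → ∃ t : ℂ, lowMap v = t • lowMap u) :
    ∃ μ : ℝ, μ ≤ 7 / 4 * qScale a ^ 2 ∧
      u ∈ seqEigenspace (kin a (ptK a)) ((ε : ℂ) • potOp ha hV) μ := by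
  obtain ⟨v, hvW, hv, hle⟩ := exists_hRel_of_mem_seqSpan_Iic (isSymmetric_smul_potOp ha hV ε) hu
  obtain ⟨t, ht⟩ := h v hv
  have e : v = t • u := eq_of_lowMap_eq ha hV hε hvW (Submodule.smul_mem _ t hu) (by
    rw [ht, map_smul])
  have hs := HRel.inner_eq (isSymmetric_smul_potOp ha hV ε) hv hv
  have hn : (inner ℂ u u : ℂ) ≠ 0 := by simpa using hne
  rw [e, inner_smul_left, inner_smul_right] at hs
  have hre : ((t.re : ℝ) : ℂ) = t := Complex.conj_eq_iff_re.1 (mul_right_cancel₀ hn hs).symm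
  refine ⟨t.re, ?_, ?_⟩
  · rw [e, inner_smul_right, ← hre, inner_self_eq_norm_sq_to_K,
      show ((RCLike.ofReal ‖u‖ : ℂ)) = ((‖u‖ : ℝ) : ℂ) from rfl, ← Complex.ofReal_pow,
      ← Complex.ofReal_mul, Complex.ofReal_re] at hle
    exact le_of_mul_le_mul_right hle (by positivity)
  · rw [mem_seqEigenspace, hre, ← e]; exact hv

theorem hRel_symm_of_eq_smul {M : Matrix (Fin 3) (Fin 3) ℝ} {σ g : Equiv.Perm Idx}
    (h : IsSymPerm a M σ g) (hM : pull M V = V) {u v : Ell2 Idx} {s : ℂ}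
    (huv : HRel (kin a (ptK a)) ((ε : ℂ) • potOp ha hV) u v) (hu : permOp σ u = s • u) :
    permOp σ v = s • v := by
  have h1 := h.hRel_permOp ha hV hM huv
  rw [hu] at h1
  exact h1.unique (huv.smul s)

/-- Eigenvectors close to the four lowest modes, with the action of the symmetries. -/
structure IsLowTriple (ε : ℝ) (f : Fin 3 → Ell2 Idx) (f₀ : Ell2 Idx) (μ μ₀ : ℝ) : Prop where
  mem : ∀ j, f j ∈ seqEigenspace (kin a (ptK a)) ((ε : ℂ) • potOp ha hV) μ
  mem₀ : f₀ ∈ seqEigenspace (kin a (ptK a)) ((ε : ℂ) • potOp ha hV) μ₀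
  le : μ ≤ 7 / 4 * qScale a ^ 2
  le₀ : μ₀ ≤ 7 / 4 * qScale a ^ 2
  lowMap_eq : ∀ j i, lowMap (f j) i = lead j i
  lowMap_eq₀ : ∀ i, lowMap f₀ i = 1 / 2
  star_eq : ∀ j, star (f j) = f j
  permR_eq : ∀ j, permOp permR (f j) = (![1, -1, -1] j : ℂ) • f (![1, 0, 2] j)
  permT_eq : ∀ j, permOp permT (f j) = (![-1, 1, -1] j : ℂ) • f (![0, 2, 1] j)

/-- A hands-on Schur lemma. Lifting the sign vectors and the constant vector from ℂ⁴, every symmetry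
relation need only be checked on four entries; R isolates two lines, and T and R carry one of them
through the triple. -/
theorem exists_isLowTriple (hε : ‖(ε : ℂ) • potOp ha hV‖ ≤ qScale a ^ 2 / 20) :
    ∃ f f₀ μ μ₀, IsLowTriple ha hV ε f f₀ μ μ₀ := by
  have hWR : ∀ {u}, u ∈ lowSpan ha hV ε → permOp permR u ∈ lowSpan ha hV ε := fun hu =>
    (isSymPerm_R a).permOp_mem_seqSpan ha hV hV.invR hu
  have hWT : ∀ {u}, u ∈ lowSpan ha hV ε → permOp permT u ∈ lowSpan ha hV ε := fun hu =>
    (isSymPerm_T a).permOp_mem_seqSpan ha hV hV.invT hu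
  choose f hfW hf using fun j => exists_lowMap_eq ha hV hε fun i => (lead j i : ℂ)
  obtain ⟨f₀, hf₀W, hf₀⟩ := exists_lowMap_eq ha hV hε fun _ => (1 / 2 : ℂ)
  have hl : ∀ j i, lowMap (f j) i = lead j i := fun j i => congrFun (hf j) i
  have hl₀ : ∀ i, lowMap f₀ i = 1 / 2 := fun i => congrFun hf₀ i
  have hR : ∀ j, permOp permR (f j) = (![1, -1, -1] j : ℂ) • f (![1, 0, 2] j) := fun j =>
    eq_of_lowMap_eq ha hV hε (hWR (hfW j)) (Submodule.smul_mem _ _ (hfW _)) (by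
      ext i
      rw [lowMap_permR, map_smul, Pi.smul_apply, hl, hl]
      fin_cases j <;> fin_cases i <;> simp [lead])
  have hT : ∀ j, permOp permT (f j) = (![-1, 1, -1] j : ℂ) • f (![0, 2, 1] j) := fun j =>
    eq_of_lowMap_eq ha hV hε (hWT (hfW j)) (Submodule.smul_mem _ _ (hfW _)) (by
      ext i
      rw [lowMap_permT, map_smul, Pi.smul_apply, hl, hl]
      fin_cases j <;> fin_cases i <;> simp [lead])
  have hne : f 2 ≠ 0 := fun h => by
    have := hl 2 0
    rw [h] at this
    simp [lead] at this
  have hne₀ : f₀ ≠ 0 := fun h => by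
    have := hl₀ 0
    rw [h] at this
    simp at this
  -- On the low entries R is a 4-cycle, so its eigenvalue -1 is simple, with the alternating vector
  -- as eigenvector. H commutes with R and so preserves this line; the factor 2 undoes the entry
  -- 1/2.
  obtain ⟨μ, hμ, hm⟩ := exists_mem_seqEigenspace_of_lowMap ha hV hε (hfW 2) hne fun v hv => by
    have e : permOp permR v = (-1 : ℂ) • v :=
      hRel_symm_of_eq_smul ha hV (isSymPerm_R a) hV.invR hv (by simpa using hR 2)
    have e' : ∀ i, lowMap v (![3, 0, 1, 2] i) = - lowMap v i := fun i => by
      rw [← lowMap_permR, e, map_smul]; simp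
    refine ⟨2 * lowMap v 0, ?_⟩
    have e0 := e' 0
    have e1 := e' 1
    have e2 := e' 2
    simp only [Matrix.cons_val] at e0 e1 e2
    ext i
    rw [Pi.smul_apply, hl, smul_eq_mul]
    fin_cases i <;> simp [lead]
    · ring
    · linear_combination e1
    · linear_combination e2 - e1
    · linear_combination e0
  -- The same argument for the fixed line of the 4-cycle, the constants.
  obtain ⟨μ₀, hμ₀, hm₀⟩ := exists_mem_seqEigenspace_of_lowMap ha hV hε hf₀W hne₀ fun v hv => by
    have h1 : permOp permR f₀ = (1 : ℂ) • f₀ :=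
      eq_of_lowMap_eq ha hV hε (hWR hf₀W) (Submodule.smul_mem _ _ hf₀W) (by
        ext i
        rw [lowMap_permR, map_smul, Pi.smul_apply, hl₀, hl₀, one_smul])
    have e : permOp permR v = (1 : ℂ) • v :=
      hRel_symm_of_eq_smul ha hV (isSymPerm_R a) hV.invR hv h1
    have e' : ∀ i, lowMap v (![3, 0, 1, 2] i) = lowMap v i := fun i => by
      rw [← lowMap_permR, e, one_smul]
    refine ⟨2 * lowMap v 0, ?_⟩
    have e0 := e' 0
    have e1 := e' 1
    have e2 := e' 2
    simp only [Matrix.cons_val] at e0 e1 e2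
    ext i
    rw [Pi.smul_apply, hl₀, smul_eq_mul]
    fin_cases i <;> simp
    · ring
    · linear_combination -e1
    · linear_combination -e2 - e1
    · linear_combination e0
  have hm1 : f 1 ∈ seqEigenspace (kin a (ptK a)) ((ε : ℂ) • potOp ha hV) μ := by
    have h1 := (isSymPerm_T a).permOp_mem_seqEigenspace ha hV hV.invT hm
    rw [hT] at h1
    simpa using h1
  have hm0 : f 0 ∈ seqEigenspace (kin a (ptK a)) ((ε : ℂ) • potOp ha hV) μ := by
    have h1 := (isSymPerm_R a).permOp_mem_seqEigenspace ha hV hV.invR hm1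
    rw [hR] at h1
    simpa using h1
  refine ⟨f, f₀, μ, μ₀, ?_, hm₀, hμ, hμ₀, hl, hl₀, fun j => ?_, hR, hT⟩
  · intro j
    fin_cases j
    exacts [hm0, hm1, hm]
  · refine eq_of_lowMap_eq ha hV hε (star_mem_seqSpan ha hV (hfW j)) (hfW j) ?_
    ext i
    rw [lowMap_star, hl, Complex.conj_ofReal]

variable {ha hV} {f : Fin 3 → Ell2 Idx} {f₀ : Ell2 Idx} {μ μ₀ : ℝ}

/-- R and T are unitary and act by signed permutations. T equates ⟨f₀, f₁⟩ with both ⟨f₀, f₂⟩ and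
its negative, and R transfers the vanishing to ⟨f₁, f₂⟩. -/
theorem IsLowTriple.inner_eq_zero (h : IsLowTriple ha hV ε f f₀ μ μ₀) {i j : Fin 3} (hij : i ≠ j) :
    inner ℂ (f i) (f j) = 0 := by
  have hR : ∀ i j, inner ℂ (f i) (f j) = (![1, -1, -1] i * ![1, -1, -1] j : ℂ) *
      inner ℂ (f (![1, 0, 2] i)) (f (![1, 0, 2] j)) := fun i j => by
    rw [← (permOp permR).inner_map_map, h.permR_eq, h.permR_eq, inner_smul_left, inner_smul_right,
      ← mul_assoc]
    congr 2
    fin_cases i <;> simp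
  have hT : ∀ i j, inner ℂ (f i) (f j) = (![-1, 1, -1] i * ![-1, 1, -1] j : ℂ) *
      inner ℂ (f (![0, 2, 1] i)) (f (![0, 2, 1] j)) := fun i j => by
    rw [← (permOp permT).inner_map_map, h.permT_eq, h.permT_eq, inner_smul_left, inner_smul_right,
      ← mul_assoc]
    congr 2
    fin_cases i <;> simp
  have h01 := hT 0 1
  have h02 := hT 0 2
  have h12 := hR 1 2
  have h20 := hT 2 0
  have h10 := hT 1 0
  have h21 := hR 2 1
  simp at h01 h02 h12 h20 h10 h21
  fin_cases i <;> fin_cases j <;> simp at hij ⊢ <;> grind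

theorem IsLowTriple.norm_eq (h : IsLowTriple ha hV ε f f₀ μ μ₀) (i : Fin 3) : ‖f i‖ = ‖f 2‖ := by
  have e1 : ‖f 1‖ = ‖f 2‖ := by
    rw [← (permOp permT).norm_map (f 1), h.permT_eq]
    simp
  have e0 : ‖f 0‖ = ‖f 1‖ := by
    rw [← (permOp permR).norm_map (f 0), h.permR_eq]
    simp
  fin_cases i
  exacts [e0.trans e1, e1, rfl]

end LowEigenvectors

end

section

/-! ### Smallness of the components outside the four low modes -/

section Tail

theorem tsum_eq_low_add {g h : Idx → ℝ} (hg : Summable g) (h0 : ∀ i, h (low i) = 0)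
    (h1 : ∀ m, (∀ i, m ≠ low i) → h m = g m) : ∑' m, g m = ∑ i, g (low i) + ∑' m, h m := by
  classical
  set s : Finset Idx := Finset.univ.image low with hs
  have hsum : ∑ m ∈ s, g m = ∑ i, g (low i) := Finset.sum_image fun i _ j _ hij => low_injective hij
  have hk : HasSum (fun m => g m - h m) (∑ m ∈ s, g m) := by
    have : ∑ m ∈ s, g m = ∑ m ∈ s, (g m - h m) := by
      refine Finset.sum_congr rfl fun m hm => ?_
      obtain ⟨i, -, rfl⟩ := Finset.mem_image.1 hm
      rw [h0, sub_zero]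
    rw [this]
    refine hasSum_sum_of_ne_finset_zero fun m hm => ?_
    rw [h1 m fun i hi => hm (Finset.mem_image.2 ⟨i, Finset.mem_univ _, hi.symm⟩), sub_self]
  have hh : Summable h := by
    have := hg.sub hk.summable
    simpa using this
  have := hk.tsum_eq
  rw [hg.tsum_sub hh, hsum] at this
  linarith

variable {a : ℝ} {ha : 0 < a} {V : E3 → ℝ} {hV : IsAdmissible a V} {ε μ : ℝ}

/-- An eigenvector with eigenvalue below the gap is concentrated on the lowest modes. -/
theorem exists_tail {u : Ell2 Idx} (hμ : μ ≤ 7 / 4 * qScale a ^ 2)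
    (hu : u ∈ seqEigenspace (kin a (ptK a)) ((ε : ℂ) • potOp ha hV) μ) :
    ∃ (w : Ell2 Idx) (z : Fin 3 → Ell2 Idx), (∀ i, w (low i) = 0) ∧
      (∀ m, (∀ i, m ≠ low i) → w m = u m) ∧ (∀ j m, z j m = (mom a (ptK a) m j : ℂ) * w m) ∧
      qScale a ^ 2 * ‖w‖ ≤ ‖(ε : ℂ) • potOp ha hV‖ * ‖u‖ ∧
      ∀ j, qScale a * ‖z j‖ ≤ 2 * (‖(ε : ℂ) • potOp ha hV‖ * ‖u‖) := by
  classical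
  have hq := qScale_pos ha
  set d := kin a (ptK a) with hd
  set B := (ε : ℂ) • potOp ha hV with hB
  -- Reduced resolvent: off the low modes the eigenvalue equation reads u = -(d - μ)⁻¹Bu, and d - μ
  -- ≥ 11q²/4 - 7q²/4 = q².
  set r : Idx → ℝ := fun m => if ∃ i, m = low i then 0 else -(d m - μ)⁻¹ with hr
  have hgap : ∀ m, (¬ ∃ i, m = low i) → qScale a ^ 2 ≤ d m - μ := fun m hm => by
    push Not at hm
    have := le_kin_of_ne_low a hm
    linarith
  have hrb : ∀ m, |r m| ≤ (qScale a ^ 2)⁻¹ := fun m => by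
    rw [hr]
    by_cases hm : ∃ i, m = low i
    · simp only [hm, if_true, abs_zero]; positivity
    · simp only [hm, if_false, abs_neg]
      have h1 := hgap m hm
      have h2 : 0 < qScale a ^ 2 := by positivity
      rw [abs_of_pos (inv_pos.2 (h2.trans_le h1))]
      exact inv_anti₀ h2 h1
  -- From q|p| ≤ (|p|² + q²)/2 and |p|² ≥ 11q²/4 one gets q|p| ≤ 2(|p|² - μ), so the momentum of the
  -- tail is controlled too.
  have hsb : ∀ j m, |mom a (ptK a) m j * r m| ≤ 2 * (qScale a)⁻¹ := fun j m => by
    rw [hr]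
    by_cases hm : ∃ i, m = low i
    · simp only [hm, if_true, mul_zero, abs_zero]; positivity
    · simp only [hm, if_false]
      have h1 := hgap m hm
      have h2 : 0 < qScale a ^ 2 := by positivity
      have h3 : |mom a (ptK a) m j| ≤ ‖mom a (ptK a) m‖ := by
        simpa using PiLp.norm_apply_le (mom a (ptK a) m) j
      have h4 : 0 < d m - μ := h2.trans_le h1
      rw [abs_mul, abs_neg, abs_of_pos (inv_pos.2 h4), ← div_eq_mul_inv, ← div_eq_mul_inv,
        div_le_div_iff₀ h4 hq]
      push Not at hm
      have h5 := le_kin_of_ne_low a hm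
      have h6 : d m = ‖mom a (ptK a) m‖ ^ 2 := rfl
      have h7 : 11 / 4 * qScale a ^ 2 ≤ d m := h5
      nlinarith [sq_nonneg (‖mom a (ptK a) m‖ - qScale a), norm_nonneg (mom a (ptK a) m)]
  have hw : ∀ m, (∀ i, m ≠ low i) → (r m : ℂ) * B u m = u m := fun m hm => by
    have h1 := hu m
    have h2 : ¬ ∃ i, m = low i := by push Not; exact hm
    have h3 : ((d m : ℂ) - μ) ≠ 0 := by
      have h4 := hgap m h2
      have h5 : 0 < qScale a ^ 2 := by positivity
      exact_mod_cast (h5.trans_le h4).ne'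
    rw [lp.coeFn_smul, Pi.smul_apply, smul_eq_mul] at h1
    have h4 : B u m = -(((d m : ℂ) - μ) * u m) := by linear_combination h1
    have h5 : (r m : ℂ) = -((d m : ℂ) - μ)⁻¹ := by
      simp only [hr, h2, if_false]; push_cast; rfl
    rw [h4, h5]
    field_simp
  have hqi : (0 : ℝ) ≤ (qScale a ^ 2)⁻¹ := by positivity
  refine ⟨diagOp r _ hrb (B u), fun j => diagOp _ _ (hsb j) (B u), fun i => ?_, fun m hm => ?_,
    fun j m => ?_, ?_, fun j => ?_⟩
  · rw [diagOp_apply, hr]; simp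
  · rw [diagOp_apply, hw m hm]
  · rw [diagOp_apply, diagOp_apply]; push_cast; ring
  · have h1 := (diagOp r _ hrb).le_opNorm (B u)
    have h2 := mul_le_mul_of_nonneg_right (norm_diagOp_le r _ hqi hrb) (norm_nonneg (B u))
    have h3 := B.le_opNorm u
    calc qScale a ^ 2 * ‖diagOp r _ hrb (B u)‖
        ≤ qScale a ^ 2 * ((qScale a ^ 2)⁻¹ * ‖B u‖) := by gcongr; exact h1.trans h2
      _ = ‖B u‖ := by field_simp
      _ ≤ _ := h3
  · have h1 := (diagOp _ _ (hsb j)).le_opNorm (B u)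
    have h2 := mul_le_mul_of_nonneg_right (norm_diagOp_le _ _ (by positivity) (hsb j))
      (norm_nonneg (B u))
    have h3 := B.le_opNorm u
    calc qScale a * ‖diagOp _ _ (hsb j) (B u)‖
        ≤ qScale a * (2 * (qScale a)⁻¹ * ‖B u‖) := by gcongr; exact h1.trans h2
      _ = 2 * ‖B u‖ := by field_simp
      _ ≤ _ := by gcongr

theorem norm_sq_eq_low_add {u w : Ell2 Idx} (h0 : ∀ i, w (low i) = 0)
    (h1 : ∀ m, (∀ i, m ≠ low i) → w m = u m) : ‖u‖ ^ 2 = ∑ i, ‖u (low i)‖ ^ 2 + ‖w‖ ^ 2 := by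
  rw [norm_sq_eq_tsum, norm_sq_eq_tsum]
  refine tsum_eq_low_add (summable_norm_sq u) (fun i => ?_) fun m hm => ?_
  · rw [h0]; simp
  · rw [h1 m hm]

/-- Evenness together with R and T relates the coefficients of V at the three unit indices. -/
theorem vhat_low_sub (ha : 0 < a) (hV : IsAdmissible a V) (i : Fin 4) (hi : i ≠ 0) :
    vhat ha hV (low 0 - low i) = vhat ha hV ![1, 0, 0] := by
  rw [← vhat_neg']
  have h2 : vhat ha hV ![0, 1, 0] = vhat ha hV ![1, 0, 0] := by
    rw [← (isSymPerm_T a).vhat_eq ha hV hV.invT, ← vhat_neg']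
    exact congrArg _ (by decide)
  have h3 : vhat ha hV ![0, 0, 1] = vhat ha hV ![1, 0, 0] := by
    rw [← (isSymPerm_R a).vhat_eq ha hV hV.invR, ← vhat_neg']
    exact congrArg _ (by decide)
  fin_cases i
  · exact absurd rfl hi
  · exact congrArg _ (by decide)
  · exact (congrArg _ (by decide)).trans h2
  · exact (congrArg _ (by decide)).trans h3

/-- The eigenvalue equation at the lowest mode. -/
theorem eigenvalue_eq {u w : Ell2 Idx}
    (hu : u ∈ seqEigenspace (kin a (ptK a)) ((ε : ℂ) • potOp ha hV) μ)
    (h0 : ∀ i, w (low i) = 0) (h1 : ∀ m, (∀ i, m ≠ low i) → w m = u m) :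
    ((μ - 3 / 4 * qScale a ^ 2 : ℝ) : ℂ) * u (low 0) =
      ε * (vhat ha hV ![0, 0, 0] * u (low 0) + vhat ha hV ![1, 0, 0] *
        (u (low 1) + u (low 2) + u (low 3))) + ((ε : ℂ) • potOp ha hV) w (low 0) := by
  classical
  have e := hu (low 0)
  rw [kin_low, lp.coeFn_smul, Pi.smul_apply, smul_eq_mul] at e
  have e2 : ((ε : ℂ) • potOp ha hV) u (low 0) =
      ε * potOp ha hV (u - w) (low 0) + ((ε : ℂ) • potOp ha hV) w (low 0) := by
    conv_lhs => rw [← sub_add_cancel u w]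
    rw [map_add, lp.coeFn_add, Pi.add_apply]
    rfl
  have e3 : potOp ha hV (u - w) (low 0) = ∑ i, vhat ha hV (low 0 - low i) * u (low i) := by
    have hs := hasSum_convOp_apply (summable_vhat ha hV) (u - w) (low 0)
    rw [← (Equiv.subLeft (low 0)).hasSum_iff] at hs
    refine hs.unique ?_
    have : ∑ i, vhat ha hV (low 0 - low i) * u (low i) =
        ∑ m ∈ Finset.univ.image low, vhat ha hV (low 0 - m) * (u - w) m := by
      rw [Finset.sum_image fun i _ j _ hij => low_injective hij]
      refine Finset.sum_congr rfl fun i _ => ?_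
      rw [lp.coeFn_sub, Pi.sub_apply, h0, sub_zero]
    rw [this]
    convert! hasSum_sum_of_ne_finset_zero (s := Finset.univ.image low) (f := fun m =>
      vhat ha hV (low 0 - m) * (u - w) m) fun m hm => ?_ using 1
    · ext m
      rw [Function.comp_apply, Equiv.subLeft_apply, sub_sub_cancel]
    · rw [lp.coeFn_sub, Pi.sub_apply,
        h1 m fun i hi => hm (Finset.mem_image.2 ⟨i, Finset.mem_univ _, hi.symm⟩), sub_self, mul_zero]
    · infer_instance
  rw [Fin.sum_univ_four, vhat_low_sub ha hV 1 (by decide), vhat_low_sub ha hV 2 (by decide),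
    vhat_low_sub ha hV 3 (by decide), show low 0 - low 0 = ![0, 0, 0] by decide] at e3
  rw [e2, e3] at e
  push_cast at e ⊢
  linear_combination -e

end Tail

end

section

/-! ### Momentum matrix elements in the triple -/

section Momentum

variable {a : ℝ}

/-- The matrix element of a component of the momentum between real sequences. -/
def momEl (a : ℝ) (f g : Ell2 Idx) (j : Fin 3) : ℝ :=
  ∑' m, mom a (ptK a) m j * ((f m).re * (g m).re)

theorem momEl_comm (f g : Ell2 Idx) (j : Fin 3) : momEl a f g j = momEl a g f j := by
  simp only [momEl, mul_comm ((f _).re)]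

theorem momEl_smul (s t : ℝ) (f g : Ell2 Idx) (j : Fin 3) :
    momEl a ((s : ℂ) • f) ((t : ℂ) • g) j = s * t * momEl a f g j := by
  rw [momEl, momEl, ← tsum_mul_left]
  congr 1; ext m
  rw [lp.coeFn_smul, lp.coeFn_smul, Pi.smul_apply, Pi.smul_apply, smul_eq_mul, smul_eq_mul,
    Complex.re_ofReal_mul, Complex.re_ofReal_mul]
  ring

theorem momEl_permOp (σ : Equiv.Perm Idx) (f g : Ell2 Idx) (j : Fin 3) :
    momEl a (permOp σ f) (permOp σ g) j =
      ∑' m, mom a (ptK a) (σ m) j * ((f m).re * (g m).re) := by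
  rw [momEl, ← σ.tsum_eq]
  congr 1; ext m
  rw [permOp_apply, permOp_apply, Equiv.symm_apply_apply]

theorem momEl_permR (f g : Ell2 Idx) (j : Fin 3) : momEl a (permOp permR f) (permOp permR g) j =
    ![-1, 1, -1] j * momEl a f g (![1, 0, 2] j) := by
  rw [momEl_permOp, momEl, ← tsum_mul_left]
  congr 1; ext m
  rw [(isSymPerm_R a).mom_eq, toEuclideanLin_matR]
  fin_cases j <;> simp

theorem momEl_permT (f g : Ell2 Idx) (j : Fin 3) : momEl a (permOp permT f) (permOp permT g) j =
    ![-1, -1, 1] j * momEl a f g (![0, 2, 1] j) := by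
  rw [momEl_permOp, momEl, ← tsum_mul_left]
  congr 1; ext m
  rw [(isSymPerm_T a).mom_eq, toEuclideanLin_matT]
  fin_cases j <;> simp

variable {ha : 0 < a} {V : E3 → ℝ} {hV : IsAdmissible a V} {ε μ μ₀ : ℝ}
  {f : Fin 3 → Ell2 Idx} {f₀ : Ell2 Idx}

/-- The symmetries determine the momentum matrix elements up to one real number. -/
theorem IsLowTriple.momEl_eq (h : IsLowTriple ha hV ε f f₀ μ μ₀) (i k j : Fin 3) :
    momEl a (f i) (f k) j =
      if i ≠ k ∧ k ≠ j ∧ j ≠ i then momEl a (f 1) (f 2) 0 else 0 := by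
  have hR : ∀ i k j, ![1, -1, -1] i * ![1, -1, -1] k * momEl a (f (![1, 0, 2] i)) (f (![1, 0, 2] k)) j
      = ![-1, 1, -1] j * momEl a (f i) (f k) (![1, 0, 2] j) := fun i k j => by
    have e : ∀ i : Fin 3, (![1, -1, -1] i : ℂ) = ((![1, -1, -1] i : ℝ) : ℂ) := fun i => by
      fin_cases i <;> simp
    rw [← momEl_permR, h.permR_eq, h.permR_eq, e, e, momEl_smul]
  have hT : ∀ i k j, ![-1, 1, -1] i * ![-1, 1, -1] k * momEl a (f (![0, 2, 1] i)) (f (![0, 2, 1] k)) j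
      = ![-1, -1, 1] j * momEl a (f i) (f k) (![0, 2, 1] j) := fun i k j => by
    have e : ∀ i : Fin 3, (![-1, 1, -1] i : ℂ) = ((![-1, 1, -1] i : ℝ) : ℂ) := fun i => by
      fin_cases i <;> simp
    rw [← momEl_permT, h.permT_eq, h.permT_eq, e, e, momEl_smul]
  have hC : ∀ i k j, momEl a (f i) (f k) j = momEl a (f k) (f i) j := fun i k j => momEl_comm _ _ _
  generalize hX : (fun i k j => momEl a (f i) (f k) j) = X
  have hX' : ∀ i k j, momEl a (f i) (f k) j = X i k j := fun i k j => by rw [← hX]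
  simp only [hX'] at hR hT hC ⊢
  -- The 27 numbers now satisfy explicit sign relations from R, T and the exchange of the two
  -- vectors; linear algebra finishes.
  simp only [Fin.forall_fin_succ, Fin.isValue, Matrix.cons_val, Fin.succ_zero_eq_one,
    Fin.succ_one_eq_two, IsEmpty.forall_iff, and_true, one_mul, mul_one, neg_mul, mul_neg,
    neg_neg] at hR hT hC
  fin_cases i <;> fin_cases k <;> fin_cases j <;> simp <;> grind

end Momentum

/-! ### First order asymptotics of the eigenvalues and the velocity -/

section Asymptotics

variable {a : ℝ} {ha : 0 < a} {V : E3 → ℝ} {hV : IsAdmissible a V} {ε μ μ₀ : ℝ}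
  {f : Fin 3 → Ell2 Idx} {f₀ : Ell2 Idx}

/-- The low part has norm one, so ‖u‖² - 1 is the squared norm of the tail. In the equation at the
mode K the tail enters only after another factor εV, hence at second order. The parameter s is -1
for the triple and 3 for the constant vector. -/
theorem eigenvalue_estimate {ν : ℝ} {u : Ell2 Idx} (hν : ν ≤ 7 / 4 * qScale a ^ 2)
    (hε : ‖(ε : ℂ) • potOp ha hV‖ ≤ qScale a ^ 2 / 20)
    (hu : u ∈ seqEigenspace (kin a (ptK a)) ((ε : ℂ) • potOp ha hV) ν) {s : ℝ}
    (hn : ∀ i, ‖u (low i)‖ = 1 / 2) (h0 : u (low 0) = 1 / 2)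
    (hs : u (low 1) + u (low 2) + u (low 3) = s / 2) :
    1 ≤ ‖u‖ ^ 2 ∧ qScale a ^ 4 * (‖u‖ ^ 2 - 1) ≤ 4 * ‖(ε : ℂ) • potOp ha hV‖ ^ 2 ∧
    qScale a ^ 2 * |ν - (3 / 4 * qScale a ^ 2 + ε * ((vhat ha hV ![0, 0, 0]).re +
      s * (vhat ha hV ![1, 0, 0]).re))| ≤ 4 * ‖(ε : ℂ) • potOp ha hV‖ ^ 2 := by
  have hq := qScale_pos ha
  obtain ⟨w, z, hw0, hw1, hz, hw, -⟩ := exists_tail hν hu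
  set b := ‖(ε : ℂ) • potOp ha hV‖ with hb
  have hb0 : 0 ≤ b := norm_nonneg _
  have e1 := norm_sq_eq_low_add hw0 hw1
  simp only [hn, Fin.sum_univ_four] at e1
  have hq2 : 0 < qScale a ^ 2 := by positivity
  have hu2 : ‖u‖ ≤ 2 := by
    have h1 : qScale a ^ 2 * ‖w‖ ≤ qScale a ^ 2 * (‖u‖ / 20) := by
      nlinarith [norm_nonneg u]
    have h2 := le_of_mul_le_mul_left h1 hq2
    nlinarith [norm_nonneg u, norm_nonneg w]
  have hw2 : qScale a ^ 2 * ‖w‖ ≤ 2 * b := by nlinarith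
  refine ⟨by nlinarith [sq_nonneg ‖w‖], ?_, ?_⟩
  · have : qScale a ^ 4 * (‖u‖ ^ 2 - 1) = (qScale a ^ 2 * ‖w‖) ^ 2 := by rw [e1]; ring
    rw [this]
    nlinarith [norm_nonneg w, mul_nonneg hq2.le (norm_nonneg w)]
  · have e := eigenvalue_eq hu hw0 hw1
    rw [h0, hs] at e
    have e2 := congrArg Complex.re e
    have hr : ∀ m, ((vhat ha hV m).re : ℂ) = vhat ha hV m := fun m =>
      Complex.conj_eq_iff_re.1 (conj_vhat ha hV m)
    rw [← hr ![0, 0, 0], ← hr ![1, 0, 0]] at e2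
    have e3 : ((((ε : ℂ) • potOp ha hV) w) (low 0)).re = (ν - (3 / 4 * qScale a ^ 2 +
        ε * ((vhat ha hV ![0, 0, 0]).re + s * (vhat ha hV ![1, 0, 0]).re))) / 2 := by
      have e4 : ((ν - 3 / 4 * qScale a ^ 2 : ℝ) : ℂ) * (1 / 2) =
        (((ν - 3 / 4 * qScale a ^ 2) / 2 : ℝ) : ℂ) := by push_cast; ring
      have e5 : (ε : ℂ) * (((vhat ha hV ![0, 0, 0]).re : ℂ) * (1 / 2) +
          ((vhat ha hV ![1, 0, 0]).re : ℂ) * ((s : ℂ) / 2)) =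
          ((ε * ((vhat ha hV ![0, 0, 0]).re + s * (vhat ha hV ![1, 0, 0]).re) / 2 : ℝ) : ℂ) := by
        push_cast; ring
      rw [e4, e5, Complex.add_re, Complex.ofReal_re, Complex.ofReal_re] at e2
      linarith
    have e6 : |((((ε : ℂ) • potOp ha hV) w) (low 0)).re| ≤ b * ‖w‖ :=
      (Complex.abs_re_le_norm _).trans ((lp.norm_apply_le_norm (by norm_num) _ _).trans
        (ContinuousLinearMap.le_opNorm _ _))
    rw [e3, abs_div, abs_two] at e6
    have e7 := mul_le_mul_of_nonneg_left e6 hq2.le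
    nlinarith [mul_le_mul_of_nonneg_left hw2 hb0]

theorem IsLowTriple.star_apply (h : IsLowTriple ha hV ε f f₀ μ μ₀) (i : Fin 3) (m : Idx) :
    (((f i m).re : ℝ) : ℂ) = f i m := by
  refine Complex.conj_eq_iff_re.1 ?_
  conv_rhs => rw [← h.star_eq i]
  rfl

theorem IsLowTriple.estimate (h : IsLowTriple ha hV ε f f₀ μ μ₀)
    (hε : ‖(ε : ℂ) • potOp ha hV‖ ≤ qScale a ^ 2 / 20) (i : Fin 3) :
    1 ≤ ‖f i‖ ^ 2 ∧ qScale a ^ 4 * (‖f i‖ ^ 2 - 1) ≤ 4 * ‖(ε : ℂ) • potOp ha hV‖ ^ 2 ∧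
    qScale a ^ 2 * |μ - (3 / 4 * qScale a ^ 2 + ε * ((vhat ha hV ![0, 0, 0]).re -
      (vhat ha hV ![1, 0, 0]).re))| ≤ 4 * ‖(ε : ℂ) • potOp ha hV‖ ^ 2 := by
  rw [h.norm_eq i]
  have e : ∀ i, f 2 (low i) = lead 2 i := fun i => h.lowMap_eq 2 i
  have := eigenvalue_estimate h.le hε (h.mem 2) (s := -1) (fun i => ?_) ?_ ?_
  · simpa [sub_eq_add_neg] using this
  · rw [e]; fin_cases i <;> simp [lead]
  · rw [e]; simp [lead]
  · rw [e, e, e]; simp [lead]; ring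

theorem IsLowTriple.estimate₀ (h : IsLowTriple ha hV ε f f₀ μ μ₀)
    (hε : ‖(ε : ℂ) • potOp ha hV‖ ≤ qScale a ^ 2 / 20) :
    qScale a ^ 2 * |μ₀ - (3 / 4 * qScale a ^ 2 + ε * ((vhat ha hV ![0, 0, 0]).re +
      3 * (vhat ha hV ![1, 0, 0]).re))| ≤ 4 * ‖(ε : ℂ) • potOp ha hV‖ ^ 2 := by
  have e : ∀ i, f₀ (low i) = 1 / 2 := h.lowMap_eq₀
  refine (eigenvalue_estimate h.le₀ hε h.mem₀ (fun i => ?_) ?_ ?_).2.2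
  · rw [e]; simp
  · rw [e]
  · rw [e, e, e]; push_cast; ring

theorem summable_momEl (hV : IsAdmissible a V) {u v : Ell2 Idx} {ν : ℝ}
    (hu : u ∈ seqEigenspace (kin a (ptK a)) ((ε : ℂ) • potOp ha hV) ν) (j : Fin 3) :
    Summable fun m => mom a (ptK a) m j * ((u m).re * (v m).re) := by
  have h1 := (summable_of_mem_seqEigenspace ha hV hu).mul_right ‖v‖
  refine Summable.of_norm_bounded h1 fun m => ?_
  have h3 : |mom a (ptK a) m j| ≤ ‖mom a (ptK a) m‖ := by
    simpa using PiLp.norm_apply_le (mom a (ptK a) m) j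
  have h4 : |(u m).re| ≤ ‖u m‖ := Complex.abs_re_le_norm _
  have h5 : |(v m).re| ≤ ‖v‖ :=
    (Complex.abs_re_le_norm _).trans (lp.norm_apply_le_norm (by norm_num) v m)
  have h6 : ‖mom a (ptK a) m‖ ≤ (1 + ‖mom a (ptK a) m‖) ^ 2 := by
    nlinarith [norm_nonneg (mom a (ptK a) m)]
  rw [Real.norm_eq_abs, abs_mul, abs_mul]
  calc |mom a (ptK a) m j| * (|(u m).re| * |(v m).re|)
      ≤ (1 + ‖mom a (ptK a) m‖) ^ 2 * (‖u m‖ * ‖v‖) := by gcongr; exact h3.trans h6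
    _ = _ := by ring

/-- The momentum is diagonal, so no terms mix low modes and tail. The four low modes contribute q/8
each; the rest pairs two tails of first order and is of second order. -/
theorem IsLowTriple.velocity_estimate (h : IsLowTriple ha hV ε f f₀ μ μ₀)
    (hε : ‖(ε : ℂ) • potOp ha hV‖ ≤ qScale a ^ 2 / 20) :
    qScale a ^ 3 * |momEl a (f 1) (f 2) 0 - qScale a / 2| ≤ 8 * ‖(ε : ℂ) • potOp ha hV‖ ^ 2 := by
  have hq := qScale_pos ha
  obtain ⟨w, z, hw0, hw1, hz, hw, hzn⟩ := exists_tail h.le (h.mem 1)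
  obtain ⟨w', z', hw0', hw1', hz', hw', hzn'⟩ := exists_tail h.le (h.mem 2)
  set b := ‖(ε : ℂ) • potOp ha hV‖ with hb
  have hb0 : 0 ≤ b := norm_nonneg _
  have hn : ∀ i, ‖f i‖ ≤ 2 := fun i => by
    obtain ⟨h1, h2, -⟩ := h.estimate hε i
    have h3 : qScale a ^ 4 * (‖f i‖ ^ 2 - 1) ≤ qScale a ^ 4 * 1 := by
      refine h2.trans ?_
      nlinarith
    have h4 := le_of_mul_le_mul_left h3 (by positivity)
    nlinarith [norm_nonneg (f i)]
  have hre : ∀ {i} {y : Ell2 Idx}, (∀ i, y (low i) = 0) → (∀ m, (∀ i, m ≠ low i) → y m = f i m) →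
      ∀ m, (((y m).re : ℝ) : ℂ) = y m := fun {i y} h0 h1 m => by
    by_cases hm : ∃ i, m = low i
    · obtain ⟨i, rfl⟩ := hm
      rw [h0]; simp
    · push Not at hm
      rw [h1 m hm, h.star_apply]
  have e : momEl a (f 1) (f 2) 0 = qScale a / 2 + (inner ℂ w (z' 0)).re := by
    rw [momEl, tsum_eq_low_add (summable_momEl hV (h.mem 1) 0)
      (h := fun m => mom a (ptK a) m 0 * ((w m).re * (w' m).re))
      (fun i => by rw [hw0]; simp) (fun m hm => by rw [hw1 m hm, hw1' m hm])]
    congr 1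
    · have e1 : ∀ i, f 1 (low i) = lead 1 i := fun i => h.lowMap_eq 1 i
      have e2 : ∀ i, f 2 (low i) = lead 2 i := fun i => h.lowMap_eq 2 i
      simp only [e1, e2, Fin.sum_univ_four, mom_ptK, Complex.ofReal_re]
      simp [lead, low]
      ring
    · have h1 := lp.hasSum_inner (𝕜 := ℂ) w (z' 0)
      rw [← h1.tsum_eq, Complex.re_tsum h1.summable]
      congr 1; ext m
      rw [hz', ← hre hw0 hw1 m, ← hre hw0' hw1' m, RCLike.inner_apply, Complex.conj_ofReal,
        ← Complex.ofReal_mul, ← Complex.ofReal_mul, Complex.ofReal_re, Complex.ofReal_re,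
        Complex.ofReal_re]
      ring
  have h1 : |(inner ℂ w (z' 0)).re| ≤ ‖w‖ * ‖z' 0‖ :=
    (Complex.abs_re_le_norm _).trans (norm_inner_le_norm _ _)
  have h2 : qScale a ^ 2 * ‖w‖ ≤ 2 * b := hw.trans (by nlinarith [hn 1])
  have h3 : qScale a * ‖z' 0‖ ≤ 4 * b := (hzn' 0).trans (by nlinarith [hn 2])
  rw [e, add_sub_cancel_left]
  calc qScale a ^ 3 * |(inner ℂ w (z' 0)).re| ≤ qScale a ^ 3 * (‖w‖ * ‖z' 0‖) := by gcongr
    _ = (qScale a ^ 2 * ‖w‖) * (qScale a * ‖z' 0‖) := by ring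
    _ ≤ (2 * b) * (4 * b) := by gcongr
    _ = _ := by ring

end Asymptotics

end

/-! ### The isolated triple ground state at K -/

section

theorem mem_seqSpan_of_mem {ι : Type*} {d : ι → ℝ} {B : Ell2 ι →L[ℂ] Ell2 ι} {I : Set ℝ} {ν : ℝ}
    {u : Ell2 ι} (hu : u ∈ seqEigenspace d B ν) (hν : ν ∈ I) : u ∈ seqSpan d B I := by
  have h := seqEigenspace_le_seqSpan (d := d) (B := B) hν
  exact h hu

section WeylData

variable {a : ℝ} (ha : 0 < a) {V : E3 → ℝ} (hV : IsAdmissible a V) {ε : ℝ}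

/-- The three-fold ground state eigenvalue at `K` with an adapted real orthonormal eigenbasis. -/
structure IsWeylData (ε : ℝ) (f : Fin 3 → Ell2 Idx) (μ v : ℝ) : Prop where
  pos : 0 < v
  mem : ∀ j, f j ∈ seqEigenspace (kin a (ptK a)) ((ε : ℂ) • potOp ha hV) μ
  orthonormal : Orthonormal ℂ f
  real : ∀ i m, (((f i m).re : ℝ) : ℂ) = f i m
  permR_eq : ∀ j, permOp permR (f j) = (![1, -1, -1] j : ℂ) • f (![1, 0, 2] j)
  momEl_eq : ∀ i k j, momEl a (f i) (f k) j = if i ≠ k ∧ k ≠ j ∧ j ≠ i then v / 2 else 0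
  gap : ∃ μ₁ > μ, seqSpan (kin a (ptK a)) ((ε : ℂ) • potOp ha hV) (Set.Iic μ₁) ≤
    Submodule.span ℂ (Set.range f)

variable {ha hV} {f : Fin 3 → Ell2 Idx} {f₀ : Ell2 Idx} {μ μ₀ : ℝ}

/-- The three sign vectors and the constant vector with entries 1/2 form an orthonormal basis of ℂ⁴.
-/
theorem lead_decomposition (y : Fin 4 → ℂ) (i : Fin 4) :
    y i = ∑ j, (∑ l, (lead j l : ℂ) * y l) * lead j i + ((1 / 2) * ∑ l, y l) * (1 / 2) := by
  simp only [Fin.sum_univ_three, Fin.sum_univ_four]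
  fin_cases i <;> simp [lead] <;> ring

/-- Such an eigenvector is a combination of the triple and `f₀` by its low entries, and its
coefficient along `f₀` vanishes by orthogonality of eigenspaces. -/
theorem IsLowTriple.seqEigenspace_le (h : IsLowTriple ha hV ε f f₀ μ μ₀)
    (hε : ‖(ε : ℂ) • potOp ha hV‖ ≤ qScale a ^ 2 / 20) (hμ : μ < μ₀) {ν : ℝ} (hν : ν < μ₀) :
    seqEigenspace (kin a (ptK a)) ((ε : ℂ) • potOp ha hV) ν ≤ Submodule.span ℂ (Set.range f) := by
  intro u hu
  have hs := isSymmetric_smul_potOp ha hV ε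
  set c : Fin 3 → ℂ := fun j => ∑ i, (lead j i : ℂ) * lowMap u i with hc
  set c₀ : ℂ := (1 / 2) * ∑ i, lowMap u i with hc₀
  have hm : ∑ j, c j • f j + c₀ • f₀ ∈ lowSpan ha hV ε := by
    refine Submodule.add_mem _ (Submodule.sum_mem _ fun j _ => Submodule.smul_mem _ _ ?_)
      (Submodule.smul_mem _ _ ?_)
    · exact mem_seqSpan_of_mem (h.mem j) h.le
    · exact mem_seqSpan_of_mem h.mem₀ h.le₀
  have e : u = ∑ j, c j • f j + c₀ • f₀ := by
    refine eq_of_lowMap_eq ha hV hε (mem_seqSpan_of_mem hu (hν.le.trans h.le₀)) hm ?_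
    ext i
    rw [map_add, map_sum, map_smul, Pi.add_apply, Finset.sum_apply, Pi.smul_apply, h.lowMap_eq₀,
      lead_decomposition (lowMap u) i]
    simp only [map_smul, Pi.smul_apply, h.lowMap_eq, smul_eq_mul, hc, hc₀]
  have h0 : inner ℂ f₀ u = 0 := inner_eq_zero_of_seqEigenspace hs hν.ne' h.mem₀ hu
  have hne : f₀ ≠ 0 := fun h' => by
    have := h.lowMap_eq₀ 0
    rw [h'] at this
    simp at this
  have h1 : c₀ = 0 := by
    rw [e, inner_add_right, inner_sum] at h0
    simp only [inner_smul_right, inner_eq_zero_of_seqEigenspace hs hμ.ne' h.mem₀ (h.mem _),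
      mul_zero, Finset.sum_const_zero, zero_add] at h0
    rcases mul_eq_zero.1 h0 with h2 | h2
    · exact h2
    · exact absurd (inner_self_eq_zero.1 h2) hne
  rw [e, h1, zero_smul, add_zero]
  exact Submodule.sum_mem _ fun j _ => Submodule.smul_mem _ _ (Submodule.subset_span ⟨j, rfl⟩)

theorem IsLowTriple.isWeylData (h : IsLowTriple ha hV ε f f₀ μ μ₀)
    (hε : ‖(ε : ℂ) • potOp ha hV‖ ≤ qScale a ^ 2 / 20) (hμ : μ < μ₀)
    (hα : 0 < momEl a (f 1) (f 2) 0) :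
    IsWeylData ha hV ε (fun j => ((‖f 2‖⁻¹ : ℝ) : ℂ) • f j) μ
      (2 * momEl a (f 1) (f 2) 0 / ‖f 2‖ ^ 2) where
  pos := by
    have := (h.estimate hε 2).1
    positivity
  mem j := Submodule.smul_mem _ _ (h.mem j)
  orthonormal := by
    have hN : 0 < ‖f 2‖ := by
      have := (h.estimate hε 2).1
      exact norm_pos_iff.2 fun h0 => by rw [h0] at this; norm_num at this
    refine ⟨fun i => ?_, fun i j hij => ?_⟩
    · rw [norm_smul, h.norm_eq i, Complex.norm_real, Real.norm_eq_abs, abs_of_pos (inv_pos.2 hN),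
        inv_mul_cancel₀ hN.ne']
    · change inner ℂ (_ • f i) (_ • f j) = 0
      rw [inner_smul_left, inner_smul_right, h.inner_eq_zero hij, mul_zero, mul_zero]
  real i m := by
    rw [lp.coeFn_smul, Pi.smul_apply, smul_eq_mul, Complex.re_ofReal_mul, Complex.ofReal_mul,
      h.star_apply]
  permR_eq j := by rw [map_smul, h.permR_eq, smul_comm]
  momEl_eq i k j := by
    rw [momEl_smul, h.momEl_eq]
    split_ifs
    · field_simp
    · rw [mul_zero]
  gap := by
    have hN : ((‖f 2‖ : ℝ) : ℂ) ≠ 0 := by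
      have := (h.estimate hε 2).1
      rw [Complex.ofReal_ne_zero]
      intro h0
      rw [h0] at this
      norm_num at this
    refine ⟨(μ + μ₀) / 2, by linarith, iSup₂_le fun ν hν =>
      (h.seqEigenspace_le hε hμ (?_ : ν < μ₀)).trans (Submodule.span_le.2 ?_)⟩
    · have : ν ≤ (μ + μ₀) / 2 := hν
      linarith
    · rintro _ ⟨j, rfl⟩
      have e : f j = ((‖f 2‖ : ℝ) : ℂ) • (((‖f 2‖⁻¹ : ℝ) : ℂ) • f j) := by
        rw [smul_smul, Complex.ofReal_inv, mul_inv_cancel₀ hN, one_smul]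
      rw [e]
      exact Submodule.smul_mem _ _ (Submodule.subset_span ⟨j, rfl⟩)

theorem exists_isWeylData (ha : 0 < a) (hV : IsAdmissible a V)
    (hV1 : 0 < (vhat ha hV ![1, 0, 0]).re) :
    ∃ ε₀ > 0, ∃ C : ℝ, ∀ ε : ℝ, 0 < ε → ε < ε₀ → ∃ f μ v, IsWeylData ha hV ε f μ v ∧
      |μ - (3 / 4 * qScale a ^ 2 + ε * ((vhat ha hV ![0, 0, 0]).re -
        (vhat ha hV ![1, 0, 0]).re))| ≤ C * ε ^ 2 ∧ |v - qScale a| ≤ C * ε := by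
  have hq := qScale_pos ha
  set q := qScale a
  set P := ‖potOp ha hV‖ with hP
  set V1 := (vhat ha hV ![1, 0, 0]).re
  have hP0 : 0 ≤ P := norm_nonneg _
  -- The first bound keeps ‖εV‖ below q²/20. The second makes the first order splitting 4εV₁₀₀
  -- exceed the error 8(εP)²/q². The summands of C serve the eigenvalue and the velocity.
  refine ⟨min (q ^ 2 / (20 * (P + 1))) (V1 * q ^ 2 / (4 * (P ^ 2 + 1))), by positivity,
    4 * P ^ 2 / q ^ 2 + P / q, fun ε h0 h1 => ?_⟩
  rw [lt_min_iff, lt_div_iff₀ (by positivity), lt_div_iff₀ (by positivity)] at h1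
  obtain ⟨h1, h2⟩ := h1
  have hb : ‖(ε : ℂ) • potOp ha hV‖ = ε * P := by
    rw [norm_smul, Complex.norm_real, Real.norm_eq_abs, abs_of_pos h0]
  have hε : ‖(ε : ℂ) • potOp ha hV‖ ≤ q ^ 2 / 20 := by rw [hb]; nlinarith
  obtain ⟨f, f₀, μ, μ₀, h⟩ := exists_isLowTriple ha hV hε
  obtain ⟨hN1, hN2, hE⟩ := h.estimate hε 2
  have hE0 := h.estimate₀ hε
  have hv := h.velocity_estimate hε
  rw [hb] at hN2 hE hE0 hv
  have hε' := hε
  rw [hb] at hε'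
  set N2 := ‖f 2‖ ^ 2
  set α := momEl a (f 1) (f 2) 0
  have hb0 : 0 ≤ ε * P := by positivity
  have hq2 : 0 < q ^ 2 := by positivity
  have hb2 : 20 * (ε * P) ^ 2 ≤ q ^ 2 * (ε * P) := by nlinarith
  have hμ : μ < μ₀ := by
    have e1 := le_abs_self (μ - (3 / 4 * q ^ 2 + ε * ((vhat ha hV ![0, 0, 0]).re - V1)))
    have e2 := neg_abs_le (μ₀ - (3 / 4 * q ^ 2 + ε * ((vhat ha hV ![0, 0, 0]).re + 3 * V1)))
    have e3 : q ^ 2 * (μ₀ - μ) ≥ q ^ 2 * (4 * ε * V1) - 8 * (ε * P) ^ 2 := by nlinarith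
    have e4 : 8 * (ε * P) ^ 2 < q ^ 2 * (4 * ε * V1) := by
      have : ε * (ε * (4 * (P ^ 2 + 1))) < ε * (V1 * q ^ 2) := mul_lt_mul_of_pos_left h2 h0
      have e5 : 0 < ε * V1 * q ^ 2 := by positivity
      nlinarith [sq_nonneg ε]
    have e5 : 0 < q ^ 2 * (μ₀ - μ) := by linarith
    have := (mul_pos_iff_of_pos_left hq2).1 e5
    linarith
  -- The errors of the matrix element and of the normalization are both quadratic in εP; 20(εP)² ≤
  -- q²εP turns them into a linear bound.
  have hv' : |2 * α - q * N2| ≤ ε * P / q := by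
    have e1 : q ^ 3 * |2 * α - q * N2| ≤ 20 * (ε * P) ^ 2 := by
      have e2 : |2 * α - q * N2| ≤ 2 * |α - q / 2| + q * (N2 - 1) := by
        have e3 : 2 * α - q * N2 = 2 * (α - q / 2) - q * (N2 - 1) := by ring
        rw [e3]
        refine (abs_sub _ _).trans (le_of_eq ?_)
        rw [abs_mul, abs_two, abs_of_nonneg (mul_nonneg hq.le (by linarith : 0 ≤ N2 - 1))]
      calc q ^ 3 * |2 * α - q * N2| ≤ q ^ 3 * (2 * |α - q / 2| + q * (N2 - 1)) := by gcongr
        _ = 2 * (q ^ 3 * |α - q / 2|) + q ^ 4 * (N2 - 1) := by ring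
        _ ≤ 2 * (8 * (ε * P) ^ 2) + 4 * (ε * P) ^ 2 := by gcongr
        _ = _ := by ring
    rw [le_div_iff₀ hq]
    have e2 := e1.trans hb2
    have e3 : q ^ 2 * (|2 * α - q * N2| * q) ≤ q ^ 2 * (ε * P) := by linarith
    exact le_of_mul_le_mul_left e3 hq2
  have hα : 0 < α := by
    have e1 := neg_abs_le (2 * α - q * N2)
    have e2 : ε * P / q ≤ q / 20 := by rw [div_le_iff₀ hq]; nlinarith
    nlinarith
  refine ⟨_, μ, _, h.isWeylData hε hμ hα, ?_, ?_⟩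
  · have e1 : |μ - (3 / 4 * q ^ 2 + ε * ((vhat ha hV ![0, 0, 0]).re - V1))| ≤
        4 * P ^ 2 / q ^ 2 * ε ^ 2 := by
      rw [show 4 * P ^ 2 / q ^ 2 * ε ^ 2 = 4 * (ε * P) ^ 2 / q ^ 2 by ring, le_div_iff₀ hq2]
      linarith
    refine e1.trans ?_
    gcongr
    have : 0 ≤ P / q := by positivity
    linarith
  · have e1 : 2 * α / N2 - q = (2 * α - q * N2) / N2 := by
      field_simp
    rw [e1, abs_div, abs_of_pos (by linarith : 0 < N2)]
    refine (div_le_self (abs_nonneg _) hN1).trans (hv'.trans ?_)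
    have : 0 ≤ 4 * P ^ 2 / q ^ 2 * ε := by positivity
    have e2 : ε * P / q = P / q * ε := by ring
    rw [e2, add_mul]
    linarith

variable {v : ℝ}

theorem IsWeylData.seqEigenspace_eq (h : IsWeylData ha hV ε f μ v) :
    seqEigenspace (kin a (ptK a)) ((ε : ℂ) • potOp ha hV) μ = Submodule.span ℂ (Set.range f) := by
  obtain ⟨μ₁, h1, h2⟩ := h.gap
  refine le_antisymm (fun u hu => h2 (mem_seqSpan_of_mem hu h1.le)) (Submodule.span_le.2 ?_)
  rintro _ ⟨j, rfl⟩
  exact h.mem j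

/-- By the gap property a lower eigenvector would lie in the μ-eigenspace, to which it is
orthogonal. -/
theorem IsWeylData.seqSpan_Iio (h : IsWeylData ha hV ε f μ v) :
    seqSpan (kin a (ptK a)) ((ε : ℂ) • potOp ha hV) (Set.Iio μ) = ⊥ := by
  obtain ⟨μ₁, h1, h2⟩ := h.gap
  refine (Submodule.eq_bot_iff _).2 fun u hu => ?_
  have hu' : ∀ ν < μ, ∀ u ∈ seqEigenspace (kin a (ptK a)) ((ε : ℂ) • potOp ha hV) ν, u = 0 :=
    fun ν hν u hu => by
      have h3 := h2 (mem_seqSpan_of_mem hu (hν.le.trans h1.le))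
      rw [← h.seqEigenspace_eq] at h3
      exact inner_self_eq_zero.1
        (inner_eq_zero_of_seqEigenspace (isSymmetric_smul_potOp ha hV ε) hν.ne hu h3)
  obtain ⟨g, hg, hI, rfl⟩ := mem_seqSpan hu
  exact Finset.sum_eq_zero fun ν hν => hu' ν (hI ν hν) _ (hg ν)

theorem IsWeylData.isBandValue (h : IsWeylData ha hV ε f μ v) (j : Fin 3) :
    IsBandValue a (fun x => ε * V x) (ptK a) (1 + j) μ := by
  rw [isBandValue_iff ha hV, h.seqSpan_Iio]
  constructor
  · rw [rank_bot]
    exact_mod_cast Nat.add_pos_left one_pos _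
  · have h1 : Module.rank ℂ (Submodule.span ℂ (Set.range f)) = 3 := by
      rw [rank_span h.orthonormal.linearIndependent,
        Cardinal.mk_range_eq _ h.orthonormal.linearIndependent.injective]
      simp
    have h2 := Submodule.rank_mono (seqEigenspace_le_seqSpan (d := kin a (ptK a))
      (B := (ε : ℂ) • potOp ha hV) (Set.self_mem_Iic (a := μ)))
    rw [h.seqEigenspace_eq, h1] at h2
    refine le_trans ?_ h2
    have : 1 + (j : ℕ) ≤ 3 := by omega
    exact_mod_cast this

end WeylData

end

section

/-! ### The cubic equation of the cone -/

section Cone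

/-- The effective Hamiltonian of the three-fold point in the direction of `κ`. -/
def coneMatrix (κ : E3) : Matrix (Fin 3) (Fin 3) ℝ :=
  ‖κ‖⁻¹ • !![0, κ 2, κ 1; κ 2, 0, κ 0; κ 1, κ 0, 0]

theorem isHermitian_coneMatrix (κ : E3) : (coneMatrix κ).IsHermitian := by
  ext i j
  fin_cases i <;> fin_cases j <;> simp [coneMatrix]

/-- The cubic is the characteristic polynomial of a real symmetric matrix: the squared off-diagonal
entries add up to 1 and the determinant is 2κ_xκ_yκ_z/|κ|³. So the roots are real and come with an
orthonormal eigenbasis. -/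
theorem exists_isConeRoots {κ : E3} (hκ : κ ≠ 0) :
    ∃ (ξ : Fin 3 → ℝ) (g : OrthonormalBasis (Fin 3) ℝ E3), IsConeRoots (-1) κ ξ ∧
      ∀ i b, ∑ c, coneMatrix κ b c * g i c = ξ i * g i b := by
  have hT := Matrix.isSymmetric_toEuclideanLin_iff.2 (isHermitian_coneMatrix κ)
  have hn : Module.finrank ℝ E3 = 3 := finrank_euclideanSpace_fin
  -- The spectral theorem lists eigenvalues in decreasing order, hence the reversal.
  refine ⟨fun i => hT.eigenvalues hn i.rev, (hT.eigenvectorBasis hn).reindex Fin.revPerm,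
    ⟨fun i j hij => hT.eigenvalues_antitone hn (Fin.rev_le_rev.2 hij), fun t => ?_⟩, fun i b => ?_⟩
  · have h1 := hT.charpoly_eq hn
    have h2 : (Matrix.toEuclideanLin (coneMatrix κ)).charpoly = (coneMatrix κ).charpoly :=
      Matrix.charpoly_toLin (coneMatrix κ) (PiLp.basisFun 2 ℝ (Fin 3))
    rw [h2] at h1
    have h3 := congrArg (Polynomial.eval t) h1
    rw [Matrix.eval_charpoly, Matrix.det_fin_three, Fin.prod_univ_three] at h3
    have hκ' : ‖κ‖ ≠ 0 := norm_ne_zero_iff.2 hκ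
    have h4 : κ 0 ^ 2 + κ 1 ^ 2 + κ 2 ^ 2 = ‖κ‖ ^ 2 := by
      rw [EuclideanSpace.norm_sq_eq, Fin.sum_univ_three]; simp
    generalize hT.eigenvalues hn = z at h3 ⊢
    simp [coneMatrix] at h3 ⊢
    have h5 : (‖κ‖⁻¹) ^ 2 * ‖κ‖ ^ 2 = 1 := by field_simp
    rw [div_eq_mul_inv, ← inv_pow]
    linear_combination -h3 - t * (‖κ‖⁻¹) ^ 2 * h4 - t * h5
  · have h1 := hT.apply_eigenvectorBasis hn i.rev
    have h2 := congrArg (fun x : E3 => x b) h1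
    rw [Matrix.toLpLin_apply] at h2
    rw [OrthonormalBasis.reindex_apply]
    exact h2

/-- Beyond modulus 2 the term |ξ³ - ξ| exceeds 6, while the constant term is at most 2. A crude
bound uniform in the direction suffices. -/
theorem IsConeRoots.abs_le {κ : E3} (hκ : κ ≠ 0) {ξ : Fin 3 → ℝ} (h : IsConeRoots (-1) κ ξ)
    (i : Fin 3) : |ξ i| ≤ 2 := by
  have h1 := h.2 (ξ i)
  have h2 : (ξ i - ξ 0) * (ξ i - ξ 1) * (ξ i - ξ 2) = 0 := by fin_cases i <;> simp
  have h3 : |κ 0 * κ 1 * κ 2 / ‖κ‖ ^ 3| ≤ 1 := by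
    have hb : ∀ i, |κ i| ≤ ‖κ‖ := fun i => by simpa using PiLp.norm_apply_le κ i
    have hp : 0 < ‖κ‖ := norm_pos_iff.2 hκ
    rw [abs_div, abs_of_pos (pow_pos hp 3), div_le_one (pow_pos hp 3), abs_mul, abs_mul]
    calc |κ 0| * |κ 1| * |κ 2| ≤ ‖κ‖ * ‖κ‖ * ‖κ‖ := by gcongr <;> exact hb _
      _ = _ := by ring
  rw [h2] at h1
  have h4 := _root_.abs_le.1 h3
  rw [_root_.abs_le]
  constructor
  · by_contra! hlt
    nlinarith [sq_nonneg (ξ i), mul_pos (by linarith : 0 < -ξ i - 2) (by nlinarith : 0 < ξ i ^ 2 - 1)]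
  · by_contra! hlt
    nlinarith [sq_nonneg (ξ i), mul_pos (by linarith : 0 < ξ i - 2) (by nlinarith : 0 < ξ i ^ 2 - 1)]

end Cone

/-! ### Relatively bounded multiplication operators and the form above the gap -/

section Multiplication

variable {ι : Type*} {d : ι → ℝ} {B : Ell2 ι →L[ℂ] Ell2 ι} {c : ι → ℝ}

/-- The graph of the multiplication operator by `c`. -/
def MRel (c : ι → ℝ) (u y : Ell2 ι) : Prop := ∀ m, y m = (c m : ℂ) * u m

theorem MRel.add {u y u' y' : Ell2 ι} (h : MRel c u y) (h' : MRel c u' y') :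
    MRel c (u + u') (y + y') := fun m => by
  rw [lp.coeFn_add, lp.coeFn_add, Pi.add_apply, Pi.add_apply, h, h', mul_add]

theorem MRel.smul {u y : Ell2 ι} (s : ℂ) (h : MRel c u y) : MRel c (s • u) (s • y) := fun m => by
  rw [lp.coeFn_smul, lp.coeFn_smul, Pi.smul_apply, Pi.smul_apply, h, smul_eq_mul, smul_eq_mul,
    mul_left_comm]

theorem MRel.sum {α : Type*} (s : Finset α) {u y : α → Ell2 ι} (h : ∀ i ∈ s, MRel c (u i) (y i)) :
    MRel c (∑ i ∈ s, u i) (∑ i ∈ s, y i) := fun m => by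
  rw [lp.coeFn_sum, lp.coeFn_sum, Finset.sum_apply, Finset.sum_apply, Finset.mul_sum]
  exact Finset.sum_congr rfl fun i hi => h i hi m

theorem MRel.inner_eq {u y u' y' : Ell2 ι} (h : MRel c u y) (h' : MRel c u' y') :
    inner ℂ u y' = inner ℂ y u' := by
  rw [lp.inner_eq_tsum, lp.inner_eq_tsum]
  congr 1; ext m
  rw [h, h', RCLike.inner_apply, RCLike.inner_apply, map_mul, Complex.conj_ofReal]
  ring

/-- Being in the domain means that (1 + d)u = u + g - Bu is in ℓ²; dividing out the weight leaves a
bounded multiplier. -/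
theorem HRel.exists_mRel {u g : Ell2 ι} (h : HRel d B u g) {C : ℝ} (hd : ∀ m, 0 ≤ d m)
    (hc : ∀ m, |c m| ≤ C * (1 + d m)) : ∃ y, MRel c u y := by
  have hb : ∀ m, |c m / (1 + d m)| ≤ C := fun m => by
    have : 0 < 1 + d m := by linarith [hd m]
    rw [abs_div, abs_of_pos this, div_le_iff₀ this]; exact hc m
  refine ⟨diagOp _ C hb (u + g - B u), fun m => ?_⟩
  have h1 : (1 + d m : ℂ) ≠ 0 := by
    have : 0 < 1 + d m := by linarith [hd m]
    exact_mod_cast this.ne'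
  rw [diagOp_apply, lp.coeFn_sub, Pi.sub_apply, lp.coeFn_add, Pi.add_apply, ← h m]
  push_cast
  field_simp
  ring

/-- Relative boundedness of a multiplication operator with respect to the form. -/
theorem HRel.norm_sq_le {u g y : Ell2 ι} (h : HRel d B u g) (hy : MRel c u y) {C : ℝ} (hC : 0 ≤ C)
    (hc : ∀ m, c m ^ 2 ≤ C * d m) : ‖y‖ ^ 2 ≤ C * ((inner ℂ u g).re + ‖B‖ * ‖u‖ ^ 2) := by
  have e1 := Complex.hasSum_re (lp.hasSum_inner (𝕜 := ℂ) u (g - B u))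
  have e2 : HasSum (fun m => ‖y m‖ ^ 2) (‖y‖ ^ 2) := by
    have := lp.hasSum_norm (p := 2) (by norm_num) y
    simpa using this
  have e3 : ‖y‖ ^ 2 ≤ C * (inner ℂ u (g - B u)).re := by
    refine hasSum_le (fun m => ?_) e2 (e1.mul_left C)
    rw [hy, lp.coeFn_sub, Pi.sub_apply, ← h m, add_sub_cancel_right, RCLike.inner_apply, norm_mul,
      mul_pow, Complex.norm_real, Real.norm_eq_abs, sq_abs, mul_assoc, Complex.mul_conj,
      Complex.normSq_eq_norm_sq, ← Complex.ofReal_mul, Complex.ofReal_re, ← mul_assoc]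
    exact mul_le_mul_of_nonneg_right (hc m) (sq_nonneg _)
  refine e3.trans (mul_le_mul_of_nonneg_left ?_ hC)
  rw [inner_sub_right, Complex.sub_re]
  have e4 : -(inner ℂ u (B u)).re ≤ ‖B‖ * ‖u‖ ^ 2 := by
    refine (neg_le_abs _).trans ((Complex.abs_re_le_norm _).trans ((norm_inner_le_norm _ _).trans ?_))
    have := B.le_opNorm u
    nlinarith [norm_nonneg u]
  linarith

/-- The coordinates with d below M + ‖B‖ + 1 are finitely many, and on their common kernel the form
exceeds M. -/
theorem rank_seqSpan_lt_aleph0 (hB : B.IsSymmetric)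
    (hd : Filter.Tendsto d Filter.cofinite Filter.atTop) (M : ℝ) :
    Module.rank ℂ (seqSpan d B (Set.Iic M)) < Cardinal.aleph0 := by
  have hfin : {m | ¬ M + ‖B‖ + 1 ≤ d m}.Finite :=
    Filter.eventually_cofinite.1 (hd.eventually_ge_atTop (M + ‖B‖ + 1))
  set s := hfin.toFinset
  let L : Ell2 ι →ₗ[ℂ] (Fin s.card → ℂ) :=
    { toFun := fun u i => u (s.equivFin.symm i : ι), map_add' := fun _ _ => rfl,
      map_smul' := fun _ _ => rfl }
  refine (rank_seqSpan_le hB L fun u v huv hL hne => ?_).trans_lt Cardinal.natCast_lt_aleph0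
  have h := huv.le_re_inner (c := M + ‖B‖ + 1) fun m hm => by
    by_contra hlt
    have hmem : m ∈ s := hfin.mem_toFinset.2 hlt
    refine hm ?_
    have : u (s.equivFin.symm (s.equivFin ⟨m, hmem⟩) : ι) = 0 := congrFun hL _
    rwa [Equiv.symm_apply_apply] at this
  have : 0 < ‖u‖ ^ 2 := by positivity
  nlinarith

/-- The form of `d + B` is bounded below by `μ₁` on the orthogonal complement of a space that
contains all eigenvectors with eigenvalue at most `μ₁`. -/
theorem HRel.le_re_inner_of_orthogonal (hB : B.IsSymmetric)
    (hd : Filter.Tendsto d Filter.cofinite Filter.atTop) (hd0 : ∀ m, 0 ≤ d m) {n : ℕ}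
    {f : Fin n → Ell2 ι} (hf : Orthonormal ℂ f) {μ μ₁ : ℝ} (hμ : μ ≤ μ₁)
    (hmem : ∀ j, f j ∈ seqEigenspace d B μ)
    (hgap : seqSpan d B (Set.Iic μ₁) ≤ Submodule.span ℂ (Set.range f)) {w w' : Ell2 ι}
    (hw : HRel d B w w') (ho : ∀ j, inner ℂ (f j) w = 0) :
    μ₁ * ‖w‖ ^ 2 ≤ (inner ℂ w w').re := by
  by_contra! hlt
  have hw0 : w ≠ 0 := fun h => by rw [h] at hlt; simp at hlt
  have hEmem : ∀ e ∈ Submodule.span ℂ (Set.range f), e ∈ seqEigenspace d B μ := fun e he =>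
    (Submodule.span_le.2 (by rintro _ ⟨j, rfl⟩; exact hmem j) :
      Submodule.span ℂ (Set.range f) ≤ seqEigenspace d B μ) he
  have hEo : ∀ e ∈ Submodule.span ℂ (Set.range f), inner ℂ e w = 0 := fun e he => by
    induction he using Submodule.span_induction with
    | mem x hx => obtain ⟨j, rfl⟩ := hx; exact ho j
    | zero => exact inner_zero_left _
    | add x y _ _ h1 h2 => rw [inner_add_left, h1, h2, add_zero]
    | smul c x _ h1 => rw [inner_smul_left, h1, mul_zero]
  -- A violating w together with the n vectors of `f` spans trial vectors with form at most μ₁,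
  -- giving n + 1 eigenvalues where the gap hypothesis allows n.
  have hli : LinearIndependent ℂ (Fin.cons w f : Fin (n + 1) → Ell2 ι) := by
    refine linearIndependent_finCons.2 ⟨hf.linearIndependent, fun h => hw0 ?_⟩
    exact inner_self_eq_zero.1 (hEo w h)
  set U := Submodule.span ℂ (Set.range (Fin.cons w f : Fin (n + 1) → Ell2 ι)) with hU
  have hfd : FiniteDimensional ℂ U := FiniteDimensional.span_of_finite ℂ (Set.finite_range _)
  have hrank := le_rank_seqSpan hB hd hd0 (μ := μ₁) U fun u hu => by
    rw [hU, Fin.range_cons, Submodule.mem_span_insert] at hu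
    obtain ⟨t, e, he, rfl⟩ := hu
    refine ⟨t • w' + (μ : ℂ) • e, (hw.smul t).add (hEmem e he), ?_⟩
    have h1 : inner ℂ e w = 0 := hEo e he
    have h2 : inner ℂ w e = 0 := inner_eq_zero_symm.1 h1
    have h3 : inner ℂ e w' = 0 := by
      rw [HRel.inner_eq hB (hEmem e he) hw, inner_smul_left, h1, mul_zero]
    have e1 : inner ℂ (t • w + e) (t • w' + (μ : ℂ) • e) =
        ((‖t‖ ^ 2 : ℝ) : ℂ) * inner ℂ w w' + ((μ * ‖e‖ ^ 2 : ℝ) : ℂ) := by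
      simp only [inner_add_left, inner_add_right, inner_smul_left, inner_smul_right, h2, h3,
        inner_self_eq_norm_sq_to_K]
      have : (starRingEnd ℂ) t * t = ((‖t‖ ^ 2 : ℝ) : ℂ) := by
        rw [mul_comm, Complex.mul_conj, Complex.normSq_eq_norm_sq]
      push_cast at this ⊢
      rw [← this]
      simp only [Complex.coe_algebraMap]
      ring
    have e2 : ‖t • w + e‖ ^ 2 = ‖t‖ ^ 2 * ‖w‖ ^ 2 + ‖e‖ ^ 2 := by
      have := norm_add_sq_eq_norm_sq_add_norm_sq_of_inner_eq_zero (𝕜 := ℂ) (t • w) e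
        (by rw [inner_smul_left, h2, mul_zero])
      rw [norm_smul] at this
      nlinarith
    rw [e1, e2, Complex.add_re, Complex.re_ofReal_mul, Complex.ofReal_re]
    have e3 : ‖t‖ ^ 2 * (inner ℂ w w').re ≤ ‖t‖ ^ 2 * (μ₁ * ‖w‖ ^ 2) := by gcongr
    have e4 : μ * ‖e‖ ^ 2 ≤ μ₁ * ‖e‖ ^ 2 := by gcongr
    linarith
  rw [hU, finrank_span_eq_card hli, Fintype.card_fin] at hrank
  have h2 : Module.rank ℂ (seqSpan d B (Set.Iic μ₁)) ≤ n := by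
    refine (Submodule.rank_mono hgap).trans ?_
    have : FiniteDimensional ℂ (Submodule.span ℂ (Set.range f)) :=
      FiniteDimensional.span_of_finite ℂ (Set.finite_range _)
    rw [← Module.finrank_eq_rank, finrank_span_eq_card hf.linearIndependent, Fintype.card_fin]
  have h3 := hrank.trans h2
  have h4 : n + 1 ≤ n := by exact_mod_cast h3
  omega

end Multiplication

end

section

/-! ### Norms and diagonal forms of finite combinations -/

section Diagonal

variable {ι α : Type*} [Fintype α] {d : ι → ℝ} {B : Ell2 ι →L[ℂ] Ell2 ι} {c : ι → ℝ}

theorem norm_sq_sum_smul {φ : α → Ell2 ι} (hφ : Orthonormal ℂ φ) (t : α → ℂ) :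
    ‖∑ i, t i • φ i‖ ^ 2 = ∑ i, ‖t i‖ ^ 2 := by
  have h := hφ.inner_sum t t Finset.univ
  rw [inner_self_eq_norm_sq_to_K] at h
  have h2 : ∀ i, (starRingEnd ℂ) (t i) * t i = ((‖t i‖ ^ 2 : ℝ) : ℂ) := fun i => by
    rw [mul_comm, Complex.mul_conj, Complex.normSq_eq_norm_sq]
  simp only [h2] at h
  rw [← Complex.ofReal_sum] at h
  refine Complex.ofReal_injective ?_
  rw [Complex.ofReal_pow]
  exact h

theorem inner_sum_smul_diag {φ y : α → Ell2 ι} {l : α → ℝ} [DecidableEq α]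
    (hd : ∀ i k, inner ℂ (φ i) (y k) = if i = k then (l i : ℂ) else 0) (t : α → ℂ) :
    inner ℂ (∑ i, t i • φ i) (∑ i, t i • y i) = ((∑ i, ‖t i‖ ^ 2 * l i : ℝ) : ℂ) := by
  rw [sum_inner, Complex.ofReal_sum]
  refine Finset.sum_congr rfl fun i _ => ?_
  rw [inner_sum, Finset.sum_eq_single i]
  · rw [inner_smul_left, inner_smul_right, hd, if_pos rfl, ← mul_assoc, mul_comm _ (t i),
      Complex.mul_conj, Complex.normSq_eq_norm_sq]
    push_cast; rfl
  · intro k _ hk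
    rw [inner_smul_left, inner_smul_right, hd, if_neg hk.symm, mul_zero, mul_zero]
  · intro h; exact absurd (Finset.mem_univ i) h

end Diagonal

/-! ### Moving the quasi-momentum away from K -/

section Shift

variable {a : ℝ} {κ : E3}

theorem mom_add (a : ℝ) (k κ : E3) (m : Idx) : mom a (k + κ) m = mom a k m + κ := by
  rw [mom, mom]; abel

theorem kin_add (a : ℝ) (k κ : E3) (m : Idx) :
    kin a (k + κ) m = kin a k m + 2 * inner ℝ κ (mom a k m) + ‖κ‖ ^ 2 := by
  rw [kin, kin, mom_add, norm_add_sq_real, real_inner_comm]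

/-- The expansion |p + κ|² = |p|² + 2κ·p + |κ|² as a statement about graphs: the vector y = (κ·p)u
makes the domains at both quasi-momenta agree. -/
theorem hRel_add_iff {B : Ell2 Idx →L[ℂ] Ell2 Idx} {k κ : E3} {u g y : Ell2 Idx}
    (hy : MRel (fun m => inner ℝ κ (mom a k m)) u y) :
    HRel (kin a (k + κ)) B u (g + (2 : ℂ) • y + ((‖κ‖ ^ 2 : ℝ) : ℂ) • u) ↔
      HRel (kin a k) B u g := by
  refine forall_congr' fun m => ?_
  rw [kin_add, lp.coeFn_add, lp.coeFn_add, lp.coeFn_smul, lp.coeFn_smul, Pi.add_apply, Pi.add_apply,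
    Pi.smul_apply, Pi.smul_apply, smul_eq_mul, smul_eq_mul, hy m]
  push_cast
  constructor <;> intro h <;> linear_combination h

theorem abs_inner_le (a : ℝ) (k κ : E3) (m : Idx) :
    |inner ℝ κ (mom a k m)| ≤ ‖κ‖ * (1 + kin a k m) := by
  refine (abs_real_inner_le_norm _ _).trans ?_
  have : ‖mom a k m‖ ≤ 1 + kin a k m := by
    rw [kin]; nlinarith [sq_nonneg (‖mom a k m‖ - 1)]
  gcongr

theorem HRel.exists_inner_mom {B : Ell2 Idx →L[ℂ] Ell2 Idx} {k : E3} {u g : Ell2 Idx}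
    (h : HRel (kin a (k + κ)) B u g) : ∃ y, MRel (fun m => inner ℝ κ (mom a k m)) u y := by
  -- The term |κ|² compensates for writing κ·p as κ·(p + κ) - |κ|², since the weight at hand belongs
  -- to the shifted momentum.
  refine h.exists_mRel (C := ‖κ‖ + ‖κ‖ ^ 2) (fun m => sq_nonneg _) fun m => ?_
  have h1 := abs_inner_le a (k + κ) κ m
  rw [mom_add, inner_add_right, real_inner_self_eq_norm_sq] at h1
  have h2 : |inner ℝ κ (mom a k m)| ≤ |inner ℝ κ (mom a k m) + ‖κ‖ ^ 2| + ‖κ‖ ^ 2 := by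
    have := abs_sub (inner ℝ κ (mom a k m) + ‖κ‖ ^ 2) (‖κ‖ ^ 2)
    rwa [add_sub_cancel_right, abs_of_nonneg (sq_nonneg ‖κ‖)] at this
  have h3 : 0 ≤ kin a (k + κ) m := sq_nonneg _
  have h4 : 0 ≤ ‖κ‖ ^ 2 * kin a (k + κ) m := by positivity
  nlinarith

theorem HRel.norm_inner_mom_sq_le {B : Ell2 Idx →L[ℂ] Ell2 Idx} {k : E3} {u g y : Ell2 Idx}
    (h : HRel (kin a k) B u g) (hy : MRel (fun m => inner ℝ κ (mom a k m)) u y) :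
    ‖y‖ ^ 2 ≤ ‖κ‖ ^ 2 * ((inner ℂ u g).re + ‖B‖ * ‖u‖ ^ 2) := by
  refine h.norm_sq_le hy (sq_nonneg _) fun m => ?_
  rw [kin, ← mul_pow, ← sq_abs]
  exact pow_le_pow_left₀ (abs_nonneg _) (abs_real_inner_le_norm _ _) 2

end Shift

/-! ### Degenerate perturbation theory on the triple eigenspace -/

section Rotated

variable {a : ℝ} {ha : 0 < a} {V : E3 → ℝ} {hV : IsAdmissible a V} {ε : ℝ}
  {f : Fin 3 → Ell2 Idx} {μ v : ℝ} {κ : E3}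

/-- κ·p is a combination of the three momentum components. Each pair i ≠ k sees exactly one of them,
the direction different from both, and always with the same value v/2. -/
theorem IsWeylData.inner_mom (h : IsWeylData ha hV ε f μ v) (hκ : κ ≠ 0) {i k : Fin 3}
    {y : Ell2 Idx} (hy : MRel (fun m => inner ℝ κ (mom a (ptK a) m)) (f k) y) :
    inner ℂ (f i) y = ((v / 2 * ‖κ‖ * coneMatrix κ i k : ℝ) : ℂ) := by
  have hs : ∀ j, HasSum (fun m => mom a (ptK a) m j * ((f i m).re * (f k m).re))
      (momEl a (f i) (f k) j) := fun j => (summable_momEl hV (h.mem i) j).hasSum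
  have h1 := (((hs 0).mul_left (κ 0)).add ((hs 1).mul_left (κ 1))).add ((hs 2).mul_left (κ 2))
  have h2 := lp.hasSum_inner (𝕜 := ℂ) (f i) y
  have h3 := (Complex.hasSum_ofReal.2 h1)
  refine (h2.unique (h3.congr_fun ?_)).trans ?_
  · intro m
    have hi : inner ℝ κ (mom a (ptK a) m) = κ 0 * mom a (ptK a) m 0 + κ 1 * mom a (ptK a) m 1 +
        κ 2 * mom a (ptK a) m 2 := by
      rw [PiLp.inner_apply, Fin.sum_univ_three]
      simp only [RCLike.inner_apply, RCLike.conj_to_real]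
      ring
    rw [hy, ← h.real i, ← h.real k, RCLike.inner_apply, Complex.conj_ofReal]
    change ((inner ℝ κ (mom a (ptK a) m) : ℝ) : ℂ) * _ * _ = _
    rw [hi]
    simp only [Complex.ofReal_re]
    push_cast
    ring
  · congr 1
    have hn : ‖κ‖ ≠ 0 := norm_ne_zero_iff.2 hκ
    rw [h.momEl_eq, h.momEl_eq, h.momEl_eq]
    fin_cases i <;> fin_cases k <;> simp [coneMatrix] <;> field_simp

/-- Eigenvectors at `K` that diagonalize the effective Hamiltonian in direction `κ`. -/
theorem IsWeylData.exists_rotated (h : IsWeylData ha hV ε f μ v) (hκ : κ ≠ 0) :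
    ∃ (ξ : Fin 3 → ℝ) (φ y : Fin 3 → Ell2 Idx), IsConeRoots (-1) κ ξ ∧ Orthonormal ℂ φ ∧
      Submodule.span ℂ (Set.range φ) = Submodule.span ℂ (Set.range f) ∧
      (∀ i, MRel (fun m => inner ℝ κ (mom a (ptK a) m)) (φ i) (y i)) ∧
      ∀ i k, inner ℂ (φ i) (y k) = if i = k then ((v / 2 * ‖κ‖ * ξ i : ℝ) : ℂ) else 0 := by
  obtain ⟨ξ, g, hξ, hg⟩ := exists_isConeRoots hκ
  have hex : ∀ b, ∃ y, MRel (fun m => inner ℝ κ (mom a (ptK a) m)) (f b) y := fun b =>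
    HRel.exists_mRel (h.mem b) (fun m => sq_nonneg _) fun m => abs_inner_le a (ptK a) κ m
  choose z hz using hex
  have hgg : ∀ i k, ∑ b, g i b * g k b = if i = k then 1 else 0 := fun i k => by
    have := orthonormal_iff_ite.1 g.orthonormal i k
    rw [PiLp.inner_apply] at this
    simpa [mul_comm] using this
  have hon : Orthonormal ℂ fun i => ∑ b, (g i b : ℂ) • f b := by
    rw [orthonormal_iff_ite]
    intro i k
    rw [h.orthonormal.inner_sum]
    simp only [Complex.conj_ofReal]
    have := congrArg (fun x : ℝ => (x : ℂ)) (hgg i k)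
    push_cast at this
    rw [this]
    split_ifs <;> simp
  refine ⟨ξ, fun i => ∑ b, (g i b : ℂ) • f b, fun i => ∑ b, (g i b : ℂ) • z b, hξ, hon, ?_,
    fun i => MRel.sum _ fun b _ => (hz b).smul _, fun i k => ?_⟩
  · have : FiniteDimensional ℂ (Submodule.span ℂ (Set.range f)) :=
      FiniteDimensional.span_of_finite ℂ (Set.finite_range _)
    refine Submodule.eq_of_le_of_finrank_eq (Submodule.span_le.2 ?_) ?_
    · rintro _ ⟨i, rfl⟩
      exact Submodule.sum_mem _ fun b _ => Submodule.smul_mem _ _ (Submodule.subset_span ⟨b, rfl⟩)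
    · rw [finrank_span_eq_card hon.linearIndependent,
        finrank_span_eq_card h.orthonormal.linearIndependent]
  · have e1 : ∀ b, inner ℂ (f b) (∑ c, (g k c : ℂ) • z c) =
        ((v / 2 * ‖κ‖ * (ξ k * g k b) : ℝ) : ℂ) := fun b => by
      rw [inner_sum, ← hg k b, Finset.mul_sum, Complex.ofReal_sum]
      refine Finset.sum_congr rfl fun c _ => ?_
      rw [inner_smul_right, h.inner_mom hκ (hz c)]
      push_cast; ring
    have e2 : ∑ b, g i b * (v / 2 * ‖κ‖ * (ξ k * g k b)) =
        v / 2 * ‖κ‖ * ξ k * if i = k then 1 else 0 := by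
      rw [← hgg, Finset.mul_sum]
      refine Finset.sum_congr rfl fun c _ => ?_
      ring
    have e3 : inner ℂ (∑ b, (g i b : ℂ) • f b) (∑ c, (g k c : ℂ) • z c) =
        ((∑ b, g i b * (v / 2 * ‖κ‖ * (ξ k * g k b)) : ℝ) : ℂ) := by
      rw [sum_inner, Complex.ofReal_sum]
      refine Finset.sum_congr rfl fun b _ => ?_
      rw [inner_smul_left, Complex.conj_ofReal, e1, ← Complex.ofReal_mul]
    rw [e3, e2]
    by_cases hik : i = k
    · subst hik; simp
    · simp [hik]

end Rotated

end

section

/-! ### Upper and lower bounds for the bands near K -/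

section Bands

variable {a : ℝ} {ha : 0 < a} {V : E3 → ℝ} {hV : IsAdmissible a V} {ε : ℝ}
  {f φ y : Fin 3 → Ell2 Idx} {μ v : ℝ} {κ : E3} {ξ : Fin 3 → ℝ}

/-- Rayleigh-Ritz with the first j + 1 rotated eigenvectors, on which the form at K + κ is diagonal
and known exactly. -/
theorem IsWeylData.le_rank (h : IsWeylData ha hV ε f μ v) (hξ : Monotone ξ)
    (hφ : Orthonormal ℂ φ) (hspan : Submodule.span ℂ (Set.range φ) = Submodule.span ℂ (Set.range f))
    (hy : ∀ i, MRel (fun m => inner ℝ κ (mom a (ptK a) m)) (φ i) (y i))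
    (hdiag : ∀ i k, inner ℂ (φ i) (y k) = if i = k then ((v / 2 * ‖κ‖ * ξ i : ℝ) : ℂ) else 0)
    (j : Fin 3) : ((1 + j : ℕ) : Cardinal) ≤
      Module.rank ℂ (seqSpan (kin a (ptK a + κ)) ((ε : ℂ) • potOp ha hV)
        (Set.Iic (μ + v * ‖κ‖ * ξ j + ‖κ‖ ^ 2))) := by
  classical
  have hle : 1 + (j : ℕ) ≤ 3 := by omega
  set s : Fin (1 + j) → Fin 3 := Fin.castLE hle with hs
  have hsinj : Function.Injective s := Fin.castLE_injective hle
  have hφs : Orthonormal ℂ (φ ∘ s) := hφ.comp s hsinj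
  set U := Submodule.span ℂ (Set.range (φ ∘ s)) with hU
  have hfd : FiniteDimensional ℂ U := FiniteDimensional.span_of_finite ℂ (Set.finite_range _)
  have hrank := le_rank_seqSpan (isSymmetric_smul_potOp ha hV ε) (tendsto_mom ha (ptK a + κ))
    (fun m => sq_nonneg _) (μ := μ + v * ‖κ‖ * ξ j + ‖κ‖ ^ 2) U fun u hu => by
      obtain ⟨t, rfl⟩ := Submodule.mem_span_range_iff_exists_fun ℂ |>.1 hu
      have hm : ∑ i, t i • (φ ∘ s) i ∈
          seqEigenspace (kin a (ptK a)) ((ε : ℂ) • potOp ha hV) μ := by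
        rw [h.seqEigenspace_eq, ← hspan]
        exact Submodule.sum_mem _ fun i _ => Submodule.smul_mem _ _ (Submodule.subset_span ⟨s i, rfl⟩)
      have hyu : MRel (fun m => inner ℝ κ (mom a (ptK a) m)) (∑ i, t i • (φ ∘ s) i)
          (∑ i, t i • (y ∘ s) i) := MRel.sum _ fun i _ => (hy (s i)).smul _
      refine ⟨_, (hRel_add_iff hyu).2 hm, ?_⟩
      have e1 := norm_sq_sum_smul hφs t
      have e2 := inner_sum_smul_diag (φ := φ ∘ s) (y := y ∘ s)
        (l := fun i => v / 2 * ‖κ‖ * ξ (s i)) (fun i k => by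
          rw [Function.comp_apply, Function.comp_apply, hdiag]
          simp only [hsinj.eq_iff]) t
      set u := ∑ i, t i • (φ ∘ s) i
      have e3 : (inner ℂ u ((μ : ℂ) • u + (2 : ℂ) • ∑ i, t i • (y ∘ s) i +
          ((‖κ‖ ^ 2 : ℝ) : ℂ) • u)).re = μ * ‖u‖ ^ 2 +
            2 * ∑ i, ‖t i‖ ^ 2 * (v / 2 * ‖κ‖ * ξ (s i)) + ‖κ‖ ^ 2 * ‖u‖ ^ 2 := by
        have e4 : inner ℂ u u = ((‖u‖ ^ 2 : ℝ) : ℂ) := by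
          rw [inner_self_eq_norm_sq_to_K]; push_cast; rfl
        rw [inner_add_right, inner_add_right, inner_smul_right, inner_smul_right, inner_smul_right,
          e2, e4, Complex.add_re, Complex.add_re, Complex.re_ofReal_mul, Complex.re_ofReal_mul,
          Complex.ofReal_re, ← Complex.ofReal_ofNat, Complex.re_ofReal_mul, Complex.ofReal_re]
      rw [e3]
      have e5 : ∑ i, ‖t i‖ ^ 2 * (v / 2 * ‖κ‖ * ξ (s i)) ≤ v / 2 * ‖κ‖ * ξ j * ‖u‖ ^ 2 := by
        rw [e1, Finset.mul_sum]
        refine Finset.sum_le_sum fun i _ => ?_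
        have h1 : ξ (s i) ≤ ξ j := hξ (by
          rw [Fin.le_def, hs, Fin.val_castLE]; omega)
        have h2 : 0 ≤ v / 2 * ‖κ‖ := by have := h.pos; positivity
        have h3 := mul_le_mul_of_nonneg_left h1 (mul_nonneg h2 (sq_nonneg ‖t i‖))
        linarith
      linarith
  rwa [hU, finrank_span_eq_card hφs.linearIndependent, Fintype.card_fin] at hrank

/-- Here x and y are the norms of the parts inside and outside the triple eigenspace. Half of the
gap pays for the perturbation of the outer part. The other half and ηkx² absorb the cross term
4kCxy, whose discriminant condition is 8kC² ≤ η(μ₁ - μ). Strictness comes from k²(x² + y²). -/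
theorem form_lower_bound {μ μ₁ b C v k ξ η x y W A : ℝ} (hk : 0 < k) (hk1 : k ≤ 1)
    (hv : 0 < v) (hη : 0 < η) (hξ : |ξ| ≤ 2)
    (hW : μ₁ * y ^ 2 ≤ W) (hx : 0 < x ^ 2 + y ^ 2)
    (h1 : k * (|μ₁| + 1 + b + 2 * v) ≤ (μ₁ - μ) / 2) (h2 : 8 * k * C ^ 2 ≤ η * (μ₁ - μ))
    (hA : μ * x ^ 2 + W - k * (1 + b) * y ^ 2 - k * W + v * k * ξ * x ^ 2 - 4 * k * C * x * y +
      k ^ 2 * (x ^ 2 + y ^ 2) ≤ A) :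
    (μ + v * k * ξ - η * k) * (x ^ 2 + y ^ 2) < A := by
  refine lt_of_lt_of_le ?_ hA
  have hk2 : 0 < k ^ 2 * (x ^ 2 + y ^ 2) := by positivity
  have h3 : (1 - k) * (μ₁ * y ^ 2) ≤ (1 - k) * W := mul_le_mul_of_nonneg_left hW (by linarith)
  have h4 : (μ₁ - μ) / 2 * y ^ 2 ≤
      ((1 - k) * μ₁ - k * (1 + b) - μ - v * k * ξ + η * k) * y ^ 2 := by
    refine mul_le_mul_of_nonneg_right ?_ (sq_nonneg y)
    have h5 : k * μ₁ ≤ k * |μ₁| := mul_le_mul_of_nonneg_left (le_abs_self _) hk.le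
    have h6 : v * k * ξ ≤ v * k * 2 :=
      mul_le_mul_of_nonneg_left ((le_abs_self _).trans hξ) (by positivity)
    have h7 : 0 < η * k := by positivity
    nlinarith
  have h5 : 0 ≤ η * k * x ^ 2 - 4 * k * C * x * y + (μ₁ - μ) / 2 * y ^ 2 := by
    have h6 : 0 ≤ (η * k) * (η * k * x ^ 2 - 4 * k * C * x * y + (μ₁ - μ) / 2 * y ^ 2) := by
      have h7 : 0 ≤ (k / 2 * (η * (μ₁ - μ) - 8 * k * C ^ 2)) * y ^ 2 := by
        have : 0 ≤ η * (μ₁ - μ) - 8 * k * C ^ 2 := by linarith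
        positivity
      have h8 := sq_nonneg (η * k * x - 2 * k * C * y)
      nlinarith
    exact (mul_nonneg_iff_of_pos_left (by positivity)).1 h6
  nlinarith

/-- Young's inequality 2yz ≤ ky² + z²/k, with the weight chosen so that both terms are of order k.
-/
theorem two_mul_le_of_sq_le {k y z b W : ℝ} (hk : 0 < k) (h : z ^ 2 ≤ k ^ 2 * (W + b * y ^ 2)) :
    2 * (y * z) ≤ k * ((1 + b) * y ^ 2 + W) := by
  have h1 : k * (2 * (y * z)) ≤ k * (k * ((1 + b) * y ^ 2 + W)) := by
    nlinarith [sq_nonneg (k * y - z)]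
  exact le_of_mul_le_mul_left h1 hk

/-- The functionals are the inner products with the first j rotated vectors. On their kernel a
vector splits into e in the triple eigenspace and w orthogonal to it: e only sees the roots ξ_i with
i ≥ j, w has energy at least μ₁, and the coupling between them is of order |κ|. -/
theorem IsWeylData.rank_le (h : IsWeylData ha hV ε f μ v) (hκ : κ ≠ 0) (hξ : Monotone ξ)
    (hξb : ∀ i, |ξ i| ≤ 2)
    (hφ : Orthonormal ℂ φ) (hspan : Submodule.span ℂ (Set.range φ) = Submodule.span ℂ (Set.range f))
    (hy : ∀ i, MRel (fun m => inner ℝ κ (mom a (ptK a) m)) (φ i) (y i))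
    (hdiag : ∀ i k, inner ℂ (φ i) (y k) = if i = k then ((v / 2 * ‖κ‖ * ξ i : ℝ) : ℂ) else 0)
    {μ₁ η : ℝ} (hμ : μ ≤ μ₁) (hη : 0 < η)
    (hgap : seqSpan (kin a (ptK a)) ((ε : ℂ) • potOp ha hV) (Set.Iic μ₁) ≤
      Submodule.span ℂ (Set.range f)) (hk1 : ‖κ‖ ≤ 1)
    (h1 : ‖κ‖ * (|μ₁| + 1 + ‖(ε : ℂ) • potOp ha hV‖ + 2 * v) ≤ (μ₁ - μ) / 2)
    (h2 : 8 * ‖κ‖ * (|μ| + ‖(ε : ℂ) • potOp ha hV‖ + 1) ^ 2 ≤ η * (μ₁ - μ)) (j : Fin 3) :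
    Module.rank ℂ (seqSpan (kin a (ptK a + κ)) ((ε : ℂ) • potOp ha hV)
      (Set.Iic (μ + v * ‖κ‖ * ξ j - η * ‖κ‖))) ≤ (j : ℕ) := by
  classical
  set B := (ε : ℂ) • potOp ha hV with hBdef
  have hB : B.IsSymmetric := isSymmetric_smul_potOp ha hV ε
  have hb : 0 ≤ ‖B‖ := norm_nonneg _
  have hk : 0 < ‖κ‖ := norm_pos_iff.2 hκ
  have hmem : ∀ i, φ i ∈ seqEigenspace (kin a (ptK a)) B μ := fun i => by
    rw [h.seqEigenspace_eq, ← hspan]; exact Submodule.subset_span ⟨i, rfl⟩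
  let L : Ell2 Idx →ₗ[ℂ] (Fin j → ℂ) :=
    LinearMap.pi fun i => (innerSL ℂ (φ (Fin.castLE j.2.le i))).toLinearMap
  refine rank_seqSpan_le hB L fun u g hug hL hne => ?_
  have ht0 : ∀ i : Fin 3, i < j → inner ℂ (φ i) u = 0 := fun i hi =>
    congrFun hL ⟨i, hi⟩
  obtain ⟨yu, hyu⟩ := hug.exists_inner_mom
  set t : Fin 3 → ℂ := fun i => inner ℂ (φ i) u with ht
  set e := ∑ i, t i • φ i with he
  set ye := ∑ i, t i • y i with hye
  have hrel : HRel (kin a (ptK a)) B u (g - (2 : ℂ) • yu - ((‖κ‖ ^ 2 : ℝ) : ℂ) • u) := by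
    refine (hRel_add_iff hyu).1 ?_
    convert! hug using 1
    abel
  set Hu := g - (2 : ℂ) • yu - ((‖κ‖ ^ 2 : ℝ) : ℂ) • u with hHu
  have heE : e ∈ seqEigenspace (kin a (ptK a)) B μ :=
    Submodule.sum_mem _ fun i _ => Submodule.smul_mem _ _ (hmem i)
  have hMe : MRel (fun m => inner ℝ κ (mom a (ptK a) m)) e ye :=
    MRel.sum _ fun i _ => (hy i).smul _
  set w := u - e with hw
  set Hw := Hu - (μ : ℂ) • e with hHw
  set yw := yu - ye with hyw
  have hwrel : HRel (kin a (ptK a)) B w Hw := hrel.sub heE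
  have hMw : MRel (fun m => inner ℝ κ (mom a (ptK a) m)) w yw := by
    have := hyu.add (hMe.smul (-1))
    rwa [neg_one_smul, neg_one_smul, ← sub_eq_add_neg, ← sub_eq_add_neg] at this
  have how : ∀ i, inner ℂ (φ i) w = 0 := fun i => by
    rw [hw, inner_sub_right, he, hφ.inner_right_fintype, sub_self]
  have hew : inner ℂ e w = 0 := by
    rw [he, sum_inner]
    exact Finset.sum_eq_zero fun i _ => by rw [inner_smul_left, how, mul_zero]
  have hwe : inner ℂ w e = 0 := inner_eq_zero_symm.1 hew
  have hW := hwrel.le_re_inner_of_orthogonal hB (tendsto_mom ha (ptK a)) (fun m => sq_nonneg _)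
    hφ hμ hmem (hgap.trans hspan.ge) how
  have hu : u = e + w := by rw [hw]; abel
  have hnu : ‖u‖ ^ 2 = ‖e‖ ^ 2 + ‖w‖ ^ 2 := by
    rw [hu, sq, sq, sq]
    exact norm_add_sq_eq_norm_sq_add_norm_sq_of_inner_eq_zero (𝕜 := ℂ) e w hew
  have hee : inner ℂ e e = ((‖e‖ ^ 2 : ℝ) : ℂ) := by
    rw [inner_self_eq_norm_sq_to_K]; push_cast; rfl
  have huu : inner ℂ u u = ((‖u‖ ^ 2 : ℝ) : ℂ) := by
    rw [inner_self_eq_norm_sq_to_K]; push_cast; rfl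
  have heHw : inner ℂ e Hw = 0 := by
    rw [HRel.inner_eq hB heE hwrel, inner_smul_left, hew, mul_zero]
  have e1 : (inner ℂ u Hu).re = μ * ‖e‖ ^ 2 + (inner ℂ w Hw).re := by
    have : Hu = (μ : ℂ) • e + Hw := by rw [hHw]; abel
    rw [this, hu, inner_add_left, inner_add_right, inner_add_right, inner_smul_right,
      inner_smul_right, hwe, heHw, hee, Complex.add_re, Complex.add_re, Complex.add_re,
      Complex.re_ofReal_mul, Complex.ofReal_re]
    simp
  have e2 : (inner ℂ u g).re = (inner ℂ u Hu).re + 2 * (inner ℂ u yu).re +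
      ‖κ‖ ^ 2 * ‖u‖ ^ 2 := by
    have : g = Hu + (2 : ℂ) • yu + ((‖κ‖ ^ 2 : ℝ) : ℂ) • u := by rw [hHu]; abel
    conv_lhs => rw [this]
    rw [inner_add_right, inner_add_right, inner_smul_right, inner_smul_right, huu, Complex.add_re,
      Complex.add_re, Complex.re_ofReal_mul, Complex.ofReal_re, ← Complex.ofReal_ofNat,
      Complex.re_ofReal_mul]
  have e3 : (inner ℂ u yu).re = (inner ℂ e ye).re + 2 * (inner ℂ w ye).re + (inner ℂ w yw).re := by
    have h3 : yu = ye + yw := by rw [hyw]; abel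
    have h4 : inner ℂ e yw = inner ℂ ye w := hMe.inner_eq hMw
    have h5 : (inner ℂ ye w).re = (inner ℂ w ye).re := inner_re_symm (𝕜 := ℂ) _ _
    rw [h3, hu, inner_add_left, inner_add_right, inner_add_right, h4, Complex.add_re,
      Complex.add_re, Complex.add_re, h5]
    ring
  have e4 : v * ‖κ‖ * ξ j * ‖e‖ ^ 2 ≤ 2 * (inner ℂ e ye).re := by
    rw [he, hye, inner_sum_smul_diag (l := fun i => v / 2 * ‖κ‖ * ξ i) hdiag, Complex.ofReal_re,
      norm_sq_sum_smul hφ, Finset.mul_sum, Finset.mul_sum]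
    refine Finset.sum_le_sum fun i _ => ?_
    by_cases hij : i < j
    · rw [ht]; simp [ht0 i hij]
    · have h3 : ξ j ≤ ξ i := hξ (not_lt.1 hij)
      have h4 : 0 ≤ v * ‖κ‖ * ‖t i‖ ^ 2 := by have := h.pos; positivity
      nlinarith [mul_le_mul_of_nonneg_left h3 h4]
  set C := |μ| + ‖B‖ + 1 with hC
  have hC1 : 1 ≤ C := by have := abs_nonneg μ; linarith
  have hYe : ‖ye‖ ≤ ‖κ‖ * C * ‖e‖ := by
    have h3 := HRel.norm_inner_mom_sq_le heE hMe
    rw [inner_smul_right, hee, Complex.re_ofReal_mul, Complex.ofReal_re] at h3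
    have h4 : μ * ‖e‖ ^ 2 + ‖B‖ * ‖e‖ ^ 2 ≤ C ^ 2 * ‖e‖ ^ 2 := by
      rw [← add_mul]
      refine mul_le_mul_of_nonneg_right ?_ (sq_nonneg _)
      have := le_abs_self μ
      nlinarith
    have h5 : ‖ye‖ ^ 2 ≤ (‖κ‖ * C * ‖e‖) ^ 2 := by
      refine h3.trans ?_
      calc ‖κ‖ ^ 2 * (μ * ‖e‖ ^ 2 + ‖B‖ * ‖e‖ ^ 2) ≤ ‖κ‖ ^ 2 * (C ^ 2 * ‖e‖ ^ 2) := by gcongr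
        _ = _ := by ring
    exact (pow_le_pow_iff_left₀ (norm_nonneg _) (by positivity) two_ne_zero).1 h5
  have e5 : -(‖κ‖ * C * ‖e‖ * ‖w‖) ≤ (inner ℂ w ye).re := by
    have h3 : |(inner ℂ w ye).re| ≤ ‖w‖ * ‖ye‖ :=
      (Complex.abs_re_le_norm _).trans (norm_inner_le_norm _ _)
    have h4 := mul_le_mul_of_nonneg_left hYe (norm_nonneg w)
    have h5 := neg_abs_le (inner ℂ w ye).re
    linarith
  -- κ·p is not bounded on the outer part, so it is estimated relative to the form; a small fraction
  -- |κ| of the energy of w is given up.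
  have e6 : -(‖κ‖ * ((1 + ‖B‖) * ‖w‖ ^ 2 + (inner ℂ w Hw).re)) ≤ 2 * (inner ℂ w yw).re := by
    have h3 : |(inner ℂ w yw).re| ≤ ‖w‖ * ‖yw‖ :=
      (Complex.abs_re_le_norm _).trans (norm_inner_le_norm _ _)
    have h4 := HRel.norm_inner_mom_sq_le hwrel hMw
    have h5 := two_mul_le_of_sq_le hk h4
    have h6 := neg_abs_le (inner ℂ w yw).re
    linarith
  have hupos : 0 < ‖e‖ ^ 2 + ‖w‖ ^ 2 := by rw [← hnu]; positivity
  have := form_lower_bound (A := (inner ℂ u g).re) hk hk1 h.pos hη (hξb j) hW hupos h1 h2 (by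
      rw [e2, e1, e3, hnu]
      linarith)
  rwa [hnu]

theorem IsWeylData.isThreefoldWeylPoint (h : IsWeylData ha hV ε f μ v) :
    IsThreefoldWeylPoint a (fun x => ε * V x) (-1) 1 μ v := by
  refine ⟨h.pos, h.isBandValue, fun η hη => ?_⟩
  obtain ⟨μ₁, hμ, hgap⟩ := h.gap
  have hv := h.pos
  set b := ‖(ε : ℂ) • potOp ha hV‖ with hb
  have hb0 : 0 ≤ b := norm_nonneg _
  have hG : 0 < μ₁ - μ := sub_pos.2 hμ
  have hp1 : 0 < |μ₁| + 1 + b + 2 * v := by positivity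
  have hp2 : 0 < 8 * (|μ| + b + 1) ^ 2 := by positivity
  -- The entries ensure, in order, |κ| ≤ 1, |κ|² ≤ η|κ| for the upper bound, and the two smallness
  -- conditions of the lower bound.
  refine ⟨min (min 1 η) (min ((μ₁ - μ) / 2 / (|μ₁| + 1 + b + 2 * v))
    (η * (μ₁ - μ) / (8 * (|μ| + b + 1) ^ 2))), by positivity, fun κ hκ hlt => ?_⟩
  rw [lt_min_iff, lt_min_iff, lt_min_iff, lt_div_iff₀ hp1, lt_div_iff₀ hp2] at hlt
  obtain ⟨⟨hk1, hk2⟩, hk3, hk4⟩ := hlt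
  have hk : 0 < ‖κ‖ := norm_pos_iff.2 hκ
  obtain ⟨ξ, φ, y, hξ, hφ, hspan, hy, hdiag⟩ := h.exists_rotated hκ
  have hband : ∀ j : Fin 3, ∃ m, IsBandValue a (fun x => ε * V x) (ptK a + κ) (1 + j) m ∧
      |m - (μ + ξ j * v * ‖κ‖)| ≤ η * ‖κ‖ := fun j => by
    have h1 := h.le_rank hξ.1 hφ hspan hy hdiag j
    have h2 := h.rank_le hκ hξ.1 (hξ.abs_le hκ) hφ hspan hy hdiag hμ.le hη hgap hk1.le hk3.le
      (by linarith) j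
    obtain ⟨m, hm, h3, h4⟩ := exists_band (isSymmetric_smul_potOp ha hV ε) (by omega) h1
      (rank_seqSpan_lt_aleph0 (isSymmetric_smul_potOp ha hV ε) (tendsto_mom ha _) _)
    refine ⟨m, (isBandValue_iff ha hV).2 ⟨h3, h4⟩, ?_⟩
    -- Otherwise at least j + 1 eigenvalues would lie where at most j are allowed.
    have h5 : μ + v * ‖κ‖ * ξ j - η * ‖κ‖ < m := by
      by_contra! hle
      have h6 := (h4.trans (Submodule.rank_mono (seqSpan_mono (Set.Iic_subset_Iic.2 hle)))).trans h2
      have h7 : 1 + (j : ℕ) ≤ j := by exact_mod_cast h6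
      omega
    have h6 : ‖κ‖ ^ 2 ≤ η * ‖κ‖ := by nlinarith
    rw [abs_le]
    constructor <;> linarith
  choose m hm using hband
  exact ⟨ξ, m, hξ, hm⟩

end Bands

end

section

/-! ### Invariance of the cell inner product under R -/

section CellInvariance

variable {a : ℝ}

/-- The lattice basis. -/
def latBasis (ha : 0 < a) : Module.Basis (Fin 3) ℝ E3 :=
  (Pi.basisFun ℝ (Fin 3)).map (latMap a ha).toLinearEquiv

theorem latBasis_apply (ha : 0 < a) (j : Fin 3) : latBasis ha j = latVec a j := by
  rw [latBasis, Module.Basis.map_apply, Pi.basisFun_apply]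
  change latMap a ha _ = _
  rw [latMap_apply, Finset.sum_eq_single j]
  · simp
  · intro i _ hi; simp [hi]
  · intro h; exact absurd (Finset.mem_univ j) h

theorem cell_eq_parallelepiped (ha : 0 < a) : cell a = parallelepiped (latBasis ha) := by
  ext x
  rw [mem_parallelepiped_iff]
  simp only [latBasis_apply]
  constructor
  · rintro ⟨t, ht, rfl⟩
    exact ⟨t, ⟨fun j => (ht j).1, fun j => (ht j).2⟩, rfl⟩
  · rintro ⟨t, ⟨h0, h1⟩, rfl⟩
    exact ⟨t, fun j => ⟨h0 j, h1 j⟩, rfl⟩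

theorem mem_lattice_of_mem_span (ha : 0 < a) {v : E3}
    (hv : v ∈ Submodule.span ℤ (Set.range (latBasis ha))) : v ∈ lattice a := by
  obtain ⟨n, rfl⟩ := (Submodule.mem_span_range_iff_exists_fun ℤ).1 hv
  refine ⟨n, Finset.sum_congr rfl fun j _ => ?_⟩
  rw [latBasis_apply, Int.cast_smul_eq_zsmul]

theorem toEuclideanLin_matR_transpose (x : E3) :
    Matrix.toEuclideanLin matRᵀ x = !₂[x 1, -x 0, -x 2] := by
  ext j
  fin_cases j <;> simp [matR, Matrix.toLpLin_apply, Matrix.mulVec, dotProduct,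
    Fin.sum_univ_three]

/-- The inverse rotation as an isometry. -/
def isoR : E3 ≃ₗᵢ[ℝ] E3 where
  toFun := Matrix.toEuclideanLin matRᵀ
  invFun := Matrix.toEuclideanLin matR
  map_add' := map_add _
  map_smul' := map_smul _
  left_inv x := by
    rw [toEuclideanLin_matR_transpose, toEuclideanLin_matR]
    ext j; fin_cases j <;> simp
  right_inv x := by
    rw [toEuclideanLin_matR, toEuclideanLin_matR_transpose]
    ext j; fin_cases j <;> simp
  norm_map' x := by
    change ‖Matrix.toEuclideanLin matRᵀ x‖ = ‖x‖
    rw [toEuclideanLin_matR_transpose, EuclideanSpace.norm_eq, EuclideanSpace.norm_eq]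
    congr 1
    simp [Fin.sum_univ_three]; ring

theorem isoR_apply (x : E3) : isoR x = !₂[x 1, -x 0, -x 2] := toEuclideanLin_matR_transpose x

theorem isoR_latVec (a : ℝ) : isoR (latVec a 1) = latVec a 0 ∧ isoR (latVec a 2) = latVec a 1 ∧
    isoR (latVec a 0) = -(latVec a 0 + latVec a 1 + latVec a 2) := by
  refine ⟨?_, ?_, ?_⟩ <;> rw [isoR_apply] <;> ext j <;> fin_cases j <;> simp [latVec]

theorem span_latBasis_isoR (ha : 0 < a) :
    Submodule.span ℤ (Set.range ((latBasis ha).map isoR.toLinearEquiv)) =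
      Submodule.span ℤ (Set.range (latBasis ha)) := by
  obtain ⟨h1, h2, h0⟩ := isoR_latVec a
  have e : ∀ j, (latBasis ha).map isoR.toLinearEquiv j = isoR (latVec a j) := fun j => by
    rw [Module.Basis.map_apply, latBasis_apply]; rfl
  have m : ∀ j, latVec a j ∈ Submodule.span ℤ (Set.range (latBasis ha)) := fun j =>
    Submodule.subset_span ⟨j, latBasis_apply ha j⟩
  have m' : ∀ j, isoR (latVec a j) ∈
      Submodule.span ℤ (Set.range ((latBasis ha).map isoR.toLinearEquiv)) := fun j =>
    Submodule.subset_span ⟨j, e j⟩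
  refine le_antisymm (Submodule.span_le.2 ?_) (Submodule.span_le.2 ?_)
  · rintro _ ⟨j, rfl⟩
    rw [SetLike.mem_coe, e]
    fin_cases j
    · exact h0 ▸ Submodule.neg_mem _ (Submodule.add_mem _ (Submodule.add_mem _ (m 0) (m 1)) (m 2))
    · exact h1 ▸ m 0
    · exact h2 ▸ m 1
  · rintro _ ⟨j, rfl⟩
    rw [SetLike.mem_coe, latBasis_apply]
    fin_cases j
    · exact h1 ▸ m' 1
    · exact h2 ▸ m' 2
    · have h3 : latVec a 2 = -(isoR (latVec a 0) + isoR (latVec a 1) + isoR (latVec a 2)) := by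
        rw [h0, h1, h2]; abel
      exact h3 ▸ Submodule.neg_mem _ (Submodule.add_mem _ (Submodule.add_mem _ (m' 0) (m' 1)) (m' 2))

/-- The rotated cell is another fundamental domain of the same lattice, and a periodic function has
equal integrals over both. A change of variables is needed because H1 concerns all locally square
integrable functions, not only continuous ones. -/
theorem setIntegral_cell_isoR (ha : 0 < a) {h : E3 → ℂ} (hp : IsLatPeriodic a h) :
    ∫ x in cell a, h (isoR x) = ∫ x in cell a, h x := by
  have hmp : MeasurePreserving isoR volume volume := isoR.measurePreserving
  have hcell : cell a =ᵐ[volume] ZSpan.fundamentalDomain (latBasis ha) := by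
    rw [cell_eq_parallelepiped ha]
    exact (ZSpan.fundamentalDomain_ae_parallelepiped (latBasis ha) volume).symm
  have : Countable (Submodule.span ℤ (Set.range (latBasis ha))).toAddSubgroup :=
    inferInstanceAs (Countable (Submodule.span ℤ (Set.range (latBasis ha))))
  have hdom := ZSpan.isAddFundamentalDomain' (latBasis ha) (volume : Measure E3)
  have hdom' : IsAddFundamentalDomain (Submodule.span ℤ (Set.range (latBasis ha))).toAddSubgroup
      (ZSpan.fundamentalDomain ((latBasis ha).map isoR.toLinearEquiv)) (volume : Measure E3) := by
    have := ZSpan.isAddFundamentalDomain' ((latBasis ha).map isoR.toLinearEquiv)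
      (volume : Measure E3)
    rwa [span_latBasis_isoR ha] at this
  have hpre : isoR ⁻¹' ZSpan.fundamentalDomain ((latBasis ha).map isoR.toLinearEquiv) =
      ZSpan.fundamentalDomain (latBasis ha) := by
    rw [← ZSpan.map_fundamentalDomain]
    exact Set.preimage_image_eq _ isoR.injective
  calc ∫ x in cell a, h (isoR x)
      = ∫ x in ZSpan.fundamentalDomain (latBasis ha), h (isoR x) := setIntegral_congr_set hcell
    _ = ∫ x in ZSpan.fundamentalDomain ((latBasis ha).map isoR.toLinearEquiv), h x := by
        rw [← hpre]
        exact hmp.setIntegral_preimage_emb isoR.toHomeomorph.measurableEmbedding h _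
    _ = ∫ x in ZSpan.fundamentalDomain (latBasis ha), h x :=
        hdom'.setIntegral_eq hdom fun g x => by
          rw [AddSubgroup.vadd_def, vadd_eq_add, add_comm]
          exact hp x g (mem_lattice_of_mem_span ha g.2)
    _ = ∫ x in cell a, h x := (setIntegral_congr_set hcell).symm

theorem cellInner_pull_matR (ha : 0 < a) {k : E3} {F G : E3 → ℂ} (hF : IsPseudoPeriodic a k F)
    (hG : IsPseudoPeriodic a k G) : cellInner a (pull matR F) (pull matR G) = cellInner a F G :=
  setIntegral_cell_isoR ha (hF.conj_mul hG)

theorem memLp_of_continuous {F : E3 → ℂ} (hF : Continuous F) {s : Set E3} (hs : IsCompact s) :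
    MemLp F 2 (volume.restrict s) := by
  have : IsFiniteMeasure (volume.restrict s) := ⟨by
    rw [Measure.restrict_apply_univ]; exact hs.measure_lt_top⟩
  obtain ⟨C, hC⟩ := hs.exists_bound_of_continuousOn hF.continuousOn
  exact MemLp.of_bound hF.aestronglyMeasurable C ((ae_restrict_iff' hs.measurableSet).2
    (Filter.Eventually.of_forall hC))

theorem integrable_conj_mul {F G : E3 → ℂ} {s : Set E3} (hF : MemLp F 2 (volume.restrict s))
    (hG : MemLp G 2 (volume.restrict s)) :
    Integrable (fun x => (starRingEnd ℂ) (F x) * G x) (volume.restrict s) :=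
  MemLp.integrable_mul (p := 2) (q := 2) hF.star hG

theorem cellInner_sum_left (ha : 0 < a) {F : Fin 3 → E3 → ℂ} {G : E3 → ℂ}
    (hF : ∀ j, Continuous (F j)) (hG : ∀ s, IsCompact s → MemLp G 2 (volume.restrict s))
    (c : Fin 3 → ℂ) : cellInner a (∑ j, c j • F j) G =
      ∑ j, (starRingEnd ℂ) (c j) * cellInner a (F j) G := by
  have hi : ∀ j, Integrable (fun x => (starRingEnd ℂ) (F j x) * G x) (volume.restrict (cell a)) :=
    fun j => integrable_conj_mul (memLp_of_continuous (hF j) (isCompact_cell ha))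
      (hG _ (isCompact_cell ha))
  simp only [cellInner, ← integral_const_mul]
  rw [← integral_finsetSum _ fun j _ => (hi j).const_mul _]
  congr 1; ext x
  rw [Finset.sum_apply, map_sum, Finset.sum_mul]
  refine Finset.sum_congr rfl fun j _ => ?_
  rw [Pi.smul_apply, smul_eq_mul, map_mul, mul_assoc]

end CellInvariance

end

section

/-! ### The eigenspace in coordinates -/

section Eigenfunctions

/-- The function at `K` with coefficients `c` with respect to the modes given by `f`. -/
def modeSum (a : ℝ) (f : Fin 3 → Ell2 Idx) (c : Fin 3 → ℂ) : E3 → ℂ :=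
  ∑ j, c j • syn a (ptK a) (f j)

theorem modeSum_eq (a : ℝ) (f : Fin 3 → Ell2 Idx) (c : Fin 3 → ℂ) : modeSum a f c =
    c 0 • syn a (ptK a) (f 0) + c 1 • syn a (ptK a) (f 1) + c 2 • syn a (ptK a) (f 2) :=
  Fin.sum_univ_three _

theorem modeSum_smul (a : ℝ) (f : Fin 3 → Ell2 Idx) (s : ℂ) (c : Fin 3 → ℂ) :
    modeSum a f (s • c) = s • modeSum a f c := by
  simp only [modeSum, Finset.smul_sum, smul_smul, Pi.smul_apply, smul_eq_mul]

variable {a : ℝ} {ha : 0 < a} {V : E3 → ℝ} {hV : IsAdmissible a V} {ε : ℝ}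
  {f : Fin 3 → Ell2 Idx} {μ v : ℝ}

theorem IsWeylData.summable (h : IsWeylData ha hV ε f μ v) (j : Fin 3) :
    Summable fun m => ‖f j m‖ :=
  summable_norm_of_weight (summable_of_mem_seqEigenspace ha hV (h.mem j))

theorem IsWeylData.syn_mem (h : IsWeylData ha hV ε f μ v) (j : Fin 3) :
    syn a (ptK a) (f j) ∈ contPP a (ptK a) := syn_mem_contPP (h.summable j) ha _

theorem IsWeylData.modeSum_mem_contPP (h : IsWeylData ha hV ε f μ v) (c : Fin 3 → ℂ) :
    modeSum a f c ∈ contPP a (ptK a) :=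
  Submodule.sum_mem _ fun j _ => Submodule.smul_mem _ _ (h.syn_mem j)

theorem IsWeylData.modeSum_mem_eigenspace (h : IsWeylData ha hV ε f μ v) (c : Fin 3 → ℂ) :
    modeSum a f c ∈ eigenspace a (fun x => ε * V x) (ptK a) μ :=
  Submodule.sum_mem _ fun j _ => Submodule.smul_mem _ _ (syn_mem_eigenspace ha hV (h.mem j))

theorem IsWeylData.ft_modeSum (h : IsWeylData ha hV ε f μ v) (c : Fin 3 → ℂ) :
    ft ha (ptK a) ⟨modeSum a f c, h.modeSum_mem_contPP c⟩ = ∑ j, c j • f j := by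
  have e : (⟨modeSum a f c, h.modeSum_mem_contPP c⟩ : contPP a (ptK a)) =
      ∑ j, c j • ⟨syn a (ptK a) (f j), h.syn_mem j⟩ := by
    apply Subtype.ext
    rw [AddSubmonoidClass.coe_finsetSum]
    rfl
  have e2 : ∀ j, ft ha (ptK a) ⟨syn a (ptK a) (f j), h.syn_mem j⟩ = f j := fun j => by
    ext m
    exact ft_syn ha (h.summable j) m
  rw [e, map_sum]
  refine Finset.sum_congr rfl fun j _ => ?_
  rw [map_smul, e2]

theorem IsWeylData.exists_modeSum (h : IsWeylData ha hV ε f μ v) {F : E3 → ℂ}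
    (hF : F ∈ eigenspace a (fun x => ε * V x) (ptK a) μ) : ∃ c, F = modeSum a f c := by
  have h1 := ft_mem_seqEigenspace ha hV ⟨F, eigenspace_le_contPP hF⟩ hF
  rw [h.seqEigenspace_eq] at h1
  obtain ⟨c, hc⟩ := (Submodule.mem_span_range_iff_exists_fun ℂ).1 h1
  refine ⟨c, ?_⟩
  have := ft_injective ha (hc.symm.trans (h.ft_modeSum c).symm)
  exact congrArg Subtype.val this

theorem IsWeylData.modeSum_injective (h : IsWeylData ha hV ε f μ v) :
    Function.Injective (modeSum a f) := fun c d hcd => by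
  have h1 : ∑ j, c j • f j = ∑ j, d j • f j := by
    rw [← h.ft_modeSum, ← h.ft_modeSum]
    congr 1
    exact Subtype.ext hcd
  ext j
  have h2 := congrArg (fun u => inner ℂ (f j) u) h1
  simpa only [h.orthonormal.inner_right_fintype] using h2

theorem IsWeylData.cellInner_modeSum (h : IsWeylData ha hV ε f μ v) (c d : Fin 3 → ℂ) :
    cellInner a (modeSum a f c) (modeSum a f d) =
      volume.real (cell a) * ∑ j, (starRingEnd ℂ) (c j) * d j := by
  have := cellInner_eq ha (⟨_, h.modeSum_mem_contPP c⟩ : contPP a (ptK a))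
    ⟨_, h.modeSum_mem_contPP d⟩
  rw [h.ft_modeSum, h.ft_modeSum, h.orthonormal.inner_sum] at this
  exact this

/-- On the Fourier side 2i∇ is multiplication by -2p, and p has matrix elements v/2 between distinct
modes in the third direction; this gives the factor -|Ω|v. -/
theorem IsWeylData.gradInner_modeSum (h : IsWeylData ha hV ε f μ v) (c d : Fin 3 → ℂ) :
    gradInner a (modeSum a f c) (modeSum a f d) = (-(volume.real (cell a) * v : ℝ) : ℂ) •
      ![(starRingEnd ℂ) (c 1) * d 2 + (starRingEnd ℂ) (c 2) * d 1,
        (starRingEnd ℂ) (c 0) * d 2 + (starRingEnd ℂ) (c 2) * d 0,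
        (starRingEnd ℂ) (c 0) * d 1 + (starRingEnd ℂ) (c 1) * d 0] := by
  ext j
  have hm := h.modeSum_mem_eigenspace d
  have hC : ContDiff ℝ 1 (modeSum a f d) := hm.1.of_le (by norm_num)
  set κ : E3 := EuclideanSpace.single j 1 with hκ
  have hκ0 : κ ≠ 0 := by
    rw [hκ, Ne, ← norm_eq_zero]; simp
  have hκn : ‖κ‖ = 1 := by rw [hκ]; simp
  have hex : ∀ b, ∃ y, MRel (fun m => inner ℝ κ (mom a (ptK a) m)) (f b) y := fun b =>
    HRel.exists_mRel (h.mem b) (fun m => sq_nonneg _) fun m => abs_inner_le a (ptK a) κ m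
  choose y hy using hex
  have e1 : ft ha (ptK a) ⟨_, fderiv_mem_contPP hC hm.2.1 κ⟩ = Complex.I • ∑ k, d k • y k := by
    ext m
    rw [ft_fderiv ha hC hm.2.1 κ m]
    have h1 : ft ha (ptK a) ⟨modeSum a f d, hC.continuous, hm.2.1⟩ = ∑ k, d k • f k :=
      h.ft_modeSum d
    have h2 := MRel.sum Finset.univ (fun k _ => (hy k).smul (d k)) m
    rw [h1, lp.coeFn_smul, Pi.smul_apply, smul_eq_mul, h2, real_inner_comm]
    exact mul_assoc _ _ _
  have e2 := cellInner_eq ha (⟨_, h.modeSum_mem_contPP c⟩ : contPP a (ptK a))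
    ((2 * Complex.I) • ⟨_, fderiv_mem_contPP hC hm.2.1 κ⟩)
  rw [map_smul, e1, h.ft_modeSum, inner_smul_right, inner_smul_right] at e2
  have e3 : inner ℂ (∑ j, c j • f j) (∑ k, d k • y k) =
      ∑ i, ∑ k, (starRingEnd ℂ) (c i) * d k * ((v / 2 * coneMatrix κ i k : ℝ) : ℂ) := by
    rw [sum_inner]
    refine Finset.sum_congr rfl fun i _ => ?_
    rw [inner_sum]
    refine Finset.sum_congr rfl fun k _ => ?_
    rw [inner_smul_left, inner_smul_right, h.inner_mom hκ0 (hy k), hκn, mul_one, mul_assoc]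
  rw [e3] at e2
  have e4 : gradInner a (modeSum a f c) (modeSum a f d) j =
      volume.real (cell a) * (2 * Complex.I * (Complex.I *
        ∑ i, ∑ k, (starRingEnd ℂ) (c i) * d k * ((v / 2 * coneMatrix κ i k : ℝ) : ℂ))) := e2
  have hI : ∀ z : ℂ, 2 * Complex.I * (Complex.I * z) = -2 * z := fun z => by
    linear_combination 2 * z * Complex.I_mul_I
  rw [e4, hI, Pi.smul_apply, smul_eq_mul]
  simp only [Fin.sum_univ_three, coneMatrix, hκn]
  fin_cases j <;> simp [hκ] <;> ring

/-- In coordinates R is a quarter turn of the first two entries and a sign on the third. Its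
eigenvalues are i, -i, -1, and the absence of 1 is the heart of H1. -/
theorem IsWeylData.pull_modeSum (h : IsWeylData ha hV ε f μ v) (c : Fin 3 → ℂ) :
    pull matR (modeSum a f c) = modeSum a f ![-c 1, c 0, -c 2] := by
  have hp : ∀ j, pull matR (syn a (ptK a) (f j)) =
      (![1, -1, -1] j : ℂ) • syn a (ptK a) (f (![1, 0, 2] j)) := fun j => by
    rw [(isSymPerm_R a).pull_syn]
    have e : (fun m => f j (permR.symm m)) = fun m => (![1, -1, -1] j : ℂ) * f (![1, 0, 2] j) m := by
      ext m
      rw [← permOp_apply, h.permR_eq]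
      rfl
    rw [e]
    ext x
    rw [syn, Pi.smul_apply, syn, smul_eq_mul, ← tsum_mul_left]
    simp only [mul_assoc]
  have hl : pull matR (modeSum a f c) = ∑ j, c j • pull matR (syn a (ptK a) (f j)) := by
    ext x
    simp only [pull, modeSum, Finset.sum_apply, Pi.smul_apply]
  rw [hl, modeSum_eq, Fin.sum_univ_three, hp, hp, hp]
  simp only [Matrix.cons_val, one_smul, neg_smul, smul_neg]
  abel

/-- Conjugation combined with x ↦ -x fixes every plane wave, and the entries of `f` are real, so
only the coordinates are conjugated. -/
theorem IsWeylData.conj_modeSum_neg (h : IsWeylData ha hV ε f μ v) (c : Fin 3 → ℂ) (x : E3) :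
    (starRingEnd ℂ) (modeSum a f c (-x)) = modeSum a f (fun j => (starRingEnd ℂ) (c j)) x := by
  have hs : ∀ j, (starRingEnd ℂ) (syn a (ptK a) (f j) (-x)) = syn a (ptK a) (f j) x := fun j => by
    rw [syn, syn, Complex.conj_tsum]
    congr 1; ext m
    rw [map_mul, ← wave_neg, wave, wave, inner_neg_neg, ← h.real j m, Complex.conj_ofReal]
  simp only [modeSum, Finset.sum_apply, Pi.smul_apply, smul_eq_mul, map_sum, map_mul, hs]

theorem IsWeylData.modeSum_mem_pseudoL2 (h : IsWeylData ha hV ε f μ v) (c : Fin 3 → ℂ) :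
    modeSum a f c ∈ pseudoL2 a (ptK a) :=
  ⟨fun _ hs => memLp_of_continuous (h.modeSum_mem_contPP c).1 hs, (h.modeSum_mem_contPP c).2⟩

theorem IsWeylData.modeSum_mem_sector_iff (h : IsWeylData ha hV ε f μ v) (c : Fin 3 → ℂ) (σ : ℂ) :
    modeSum a f c ∈ sector a σ ↔ -c 1 = σ * c 0 ∧ c 0 = σ * c 1 ∧ -c 2 = σ * c 2 := by
  have h1 : modeSum a f c ∈ sector a σ ↔ pull matR (modeSum a f c) = σ • modeSum a f c :=
    ⟨fun H => H.2, fun H => ⟨h.modeSum_mem_pseudoL2 c, H⟩⟩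
  rw [h1, h.pull_modeSum, ← modeSum_smul, h.modeSum_injective.eq_iff, funext_iff]
  simp [Fin.forall_fin_succ]

end Eigenfunctions

end

section

/-! ### Verification of H1, H2 and the Fermi velocity -/

section FermiVelocity

variable {a : ℝ} {ha : 0 < a} {V : E3 → ℝ} {hV : IsAdmissible a V} {ε : ℝ}
  {f : Fin 3 → Ell2 Idx} {μ v : ℝ}

theorem IsWeylData.finrank_eigenspace (h : IsWeylData ha hV ε f μ v) :
    Module.finrank ℂ (eigenspace a (fun x => ε * V x) (ptK a) μ) = 3 := by
  let L : (Fin 3 → ℂ) →ₗ[ℂ] (E3 → ℂ) :=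
    Fintype.linearCombination ℂ fun j => syn a (ptK a) (f j)
  have hL : Function.Injective L := h.modeSum_injective
  have hr : L.range = eigenspace a (fun x => ε * V x) (ptK a) μ := by
    ext F
    constructor
    · rintro ⟨c, rfl⟩
      exact h.modeSum_mem_eigenspace c
    · intro hF
      obtain ⟨c, rfl⟩ := h.exists_modeSum hF
      exact ⟨c, rfl⟩
  rw [← hr, LinearMap.finrank_range_of_inj hL, Module.finrank_fin_fun]

/-- A mode in a sector `σ ≠ -1` has coefficients proportional to `(1, -σ, 0)`. -/
theorem IsWeylData.eq_of_mem_sector (h : IsWeylData ha hV ε f μ v) {c : Fin 3 → ℂ} {σ : ℂ}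
    (hσ : σ + 1 ≠ 0) (hc : modeSum a f c ∈ sector a σ) : c = c 0 • ![1, -σ, 0] := by
  obtain ⟨h1, -, h3⟩ := (h.modeSum_mem_sector_iff c σ).1 hc
  have h4 : c 2 = 0 := by
    have : (σ + 1) * c 2 = 0 := by linear_combination -h3
    exact (mul_eq_zero.1 this).resolve_left hσ
  have h5 : c 1 = c 0 * -σ := by linear_combination -h1
  ext j
  fin_cases j
  · simp
  · simpa using h5
  · simpa using h4

/-- A mode in the sector `-1` has coefficients proportional to `(0, 0, 1)`. -/
theorem IsWeylData.eq_of_mem_sector_neg_one (h : IsWeylData ha hV ε f μ v) {c : Fin 3 → ℂ}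
    (hc : modeSum a f c ∈ sector a (-1)) : c = c 2 • ![0, 0, 1] := by
  obtain ⟨h1, h2, -⟩ := (h.modeSum_mem_sector_iff c (-1)).1 hc
  have h3 : c 0 = 0 := by linear_combination (h1 + h2) / 2
  have h4 : c 1 = 0 := by linear_combination (-h1 + h2) / 2
  ext j
  fin_cases j
  · simpa using h3
  · simpa using h4
  · simp

theorem I_add_one_ne_zero : Complex.I + 1 ≠ 0 := fun h => by
  have := congrArg Complex.re h
  simp at this

theorem neg_I_add_one_ne_zero : -Complex.I + 1 ≠ 0 := fun h => by
  have := congrArg Complex.re h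
  simp at this

theorem IsWeylData.finrank_sector_I (h : IsWeylData ha hV ε f μ v) :
    Module.finrank ℂ ↥(eigenspace a (fun x => ε * V x) (ptK a) μ ⊓ sector a Complex.I) = 1 := by
  have hs : eigenspace a (fun x => ε * V x) (ptK a) μ ⊓ sector a Complex.I =
      Submodule.span ℂ {modeSum a f ![1, -Complex.I, 0]} := by
    ext F
    rw [Submodule.mem_span_singleton]
    constructor
    · rintro ⟨hF, hF2⟩
      obtain ⟨c, rfl⟩ := h.exists_modeSum hF
      refine ⟨c 0, ?_⟩
      rw [← modeSum_smul, ← h.eq_of_mem_sector I_add_one_ne_zero hF2]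
    · rintro ⟨s, rfl⟩
      refine Submodule.smul_mem _ _ ⟨h.modeSum_mem_eigenspace _, ?_⟩
      exact (h.modeSum_mem_sector_iff _ _).2 ⟨by simp, by simp, by simp⟩
  rw [hs, finrank_span_singleton]
  intro h0
  have h1 : modeSum a f ![1, -Complex.I, 0] = modeSum a f 0 := by
    rw [h0]; simp [modeSum]
  have h2 := congrFun (h.modeSum_injective h1) 0
  simp at h2

/-- R preserves the inner product and fixes G, so pairing with G is an invariant functional on the
eigenspace. Since R has no eigenvalue 1 there, the functional is zero. -/
theorem IsWeylData.cellInner_eq_zero (h : IsWeylData ha hV ε f μ v) {F G : E3 → ℂ}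
    (hF : F ∈ eigenspace a (fun x => ε * V x) (ptK a) μ) (hG : G ∈ sector a 1) :
    cellInner a F G = 0 := by
  obtain ⟨c, rfl⟩ := h.exists_modeSum hF
  have hlin : ∀ c, cellInner a (modeSum a f c) G =
      ∑ j, (starRingEnd ℂ) (c j) * cellInner a (syn a (ptK a) (f j)) G := fun c =>
    cellInner_sum_left ha (fun j => (h.syn_mem j).1) hG.1.1 c
  have hinv : ∀ c, cellInner a (modeSum a f ![-c 1, c 0, -c 2]) G =
      cellInner a (modeSum a f c) G := fun c => by
    have hG2 : pull matR G = G := by simpa using hG.2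
    have := cellInner_pull_matR ha (h.modeSum_mem_pseudoL2 c).2 hG.1.2
    rwa [h.pull_modeSum, hG2] at this
  simp only [hlin, Fin.sum_univ_three] at hinv
  have e0 := hinv ![1, 0, 0]
  have e1 := hinv ![0, 1, 0]
  have e2 := hinv ![0, 0, 1]
  simp at e0 e1 e2
  set z0 := cellInner a (syn a (ptK a) (f 0)) G
  set z1 := cellInner a (syn a (ptK a) (f 1)) G
  set z2 := cellInner a (syn a (ptK a) (f 2)) G
  have h0 : z0 = 0 := by linear_combination (-e0 - e1) / 2
  have h1 : z1 = 0 := by linear_combination (e0 - e1) / 2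
  have h2 : z2 = 0 := by linear_combination -e2 / 2
  rw [hlin, Fin.sum_univ_three]
  simp only [z0, z1, z2] at h0 h1 h2
  rw [h0, h1, h2]
  simp

theorem IsWeylData.assumptionH1 (h : IsWeylData ha hV ε f μ v) :
    AssumptionH1 a (fun x => ε * V x) μ where
  threefold := h.finrank_eigenspace
  orthogonal _ hF _ hG := h.cellInner_eq_zero hF hG
  simple := h.finrank_sector_I

theorem IsWeylData.exists_isAdaptedBasis (h : IsWeylData ha hV ε f μ v) :
    ∃ Φ, IsAdaptedBasis a (fun x => ε * V x) μ Φ := by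
  have hvol := volume_real_cell_pos ha
  set w := volume.real (cell a) with hw
  -- The coordinate vectors (1, -i, 0), (0, 0, 1), (1, i, 0) have squared norms 2, 1, 2, and the
  -- cell inner product adds a factor |Ω|.
  set s : ℝ := √(2 * w)⁻¹ with hs
  set t : ℝ := √w⁻¹ with ht
  have hs2 : (w : ℂ) * ((s : ℂ) * s) * 2 = 1 := by
    have : w * (s * s) * 2 = 1 := by
      rw [hs, Real.mul_self_sqrt (by positivity)]; field_simp
    exact_mod_cast this
  have ht2 : (w : ℂ) * ((t : ℂ) * t) = 1 := by
    have : w * (t * t) = 1 := by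
      rw [ht, Real.mul_self_sqrt (by positivity)]; field_simp
    exact_mod_cast this
  have hs0 : (s : ℂ) ≠ 0 := fun h0 => by simp [h0] at hs2
  have ht0 : (t : ℂ) ≠ 0 := fun h0 => by simp [h0] at ht2
  have hI := Complex.I_mul_I
  let C : Fin 3 → Fin 3 → ℂ :=
    ![![(s : ℂ), -Complex.I * s, 0], ![0, 0, (t : ℂ)], ![(s : ℂ), Complex.I * s, 0]]
  refine ⟨fun ℓ => modeSum a f (C ℓ), ?_, ?_, ?_, ?_⟩
  · intro ℓ
    rw [h.modeSum_mem_sector_iff]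
    fin_cases ℓ
    · refine ⟨?_, ?_, ?_⟩ <;> simp [C]
      linear_combination (s : ℂ) * hI
    · refine ⟨?_, ?_, ?_⟩ <;> simp [C]
    · refine ⟨?_, ?_, ?_⟩ <;> simp [C, Complex.I_pow_three]
      linear_combination (s : ℂ) * hI
  · apply le_antisymm
    · rw [Submodule.span_le]
      rintro _ ⟨ℓ, rfl⟩
      exact h.modeSum_mem_eigenspace _
    · intro F hF
      obtain ⟨c, rfl⟩ := h.exists_modeSum hF
      rw [Submodule.mem_span_range_iff_exists_fun]
      refine ⟨![(c 0 + Complex.I * c 1) / (2 * s), c 2 / t, (c 0 - Complex.I * c 1) / (2 * s)], ?_⟩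
      simp only [← modeSum_smul, Fin.sum_univ_three]
      have hadd : ∀ p r : Fin 3 → ℂ, modeSum a f p + modeSum a f r = modeSum a f (p + r) :=
        fun p r => by simp only [modeSum, Pi.add_apply, add_smul, Finset.sum_add_distrib]
      rw [hadd, hadd]
      congr 1
      ext j
      fin_cases j
      · simp [C]; field_simp; ring
      · simp [C]; field_simp; linear_combination (-2 * c 1) * hI
      · simp [C]; field_simp
  · intro ℓ m
    rw [h.cellInner_modeSum, Fin.sum_univ_three]
    fin_cases ℓ <;> fin_cases m <;> simp [C]
    · linear_combination hs2 - (w : ℂ) * s * s * hI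
    · right; linear_combination (s : ℂ) * s * hI
    · linear_combination ht2
    · right; linear_combination (s : ℂ) * s * hI
    · linear_combination hs2 - (w : ℂ) * s * s * hI
  · intro x
    rw [h.conj_modeSum_neg]
    congr 1
    ext j
    fin_cases j <;> simp [C]

/-- Each sector meets the eigenspace in a line, so an adapted basis is fixed up to three scalars
whose moduli are determined by normalization. The three velocities are products of these scalars
with |Ω|v, and their moduli all reduce to v. -/
theorem IsWeylData.isFermiVelocity (h : IsWeylData ha hV ε f μ v) :
    IsFermiVelocity a (fun x => ε * V x) μ v := by
  refine ⟨h.exists_isAdaptedBasis, fun Φ hΦ => ?_⟩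
  have hvol := volume_real_cell_pos ha
  set w := volume.real (cell a) with hw
  have hmem : ∀ ℓ, ∃ c, Φ ℓ = modeSum a f c := fun ℓ =>
    h.exists_modeSum (hΦ.span_eq ▸ Submodule.subset_span ⟨ℓ, rfl⟩)
  choose c hc using hmem
  have k0 : c 0 = c 0 0 • ![1, -Complex.I, 0] := by
    refine h.eq_of_mem_sector I_add_one_ne_zero ?_
    rw [← hc]; simpa using hΦ.mem_sector 0
  have k1 : c 1 = c 1 2 • ![0, 0, 1] := by
    refine h.eq_of_mem_sector_neg_one ?_
    rw [← hc]; simpa using hΦ.mem_sector 1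
  have k2 : c 2 = c 2 0 • ![1, - -Complex.I, 0] := by
    refine h.eq_of_mem_sector neg_I_add_one_ne_zero ?_
    rw [← hc]; simpa [Complex.I_pow_three] using hΦ.mem_sector 2
  have hn : ∀ ℓ, w * ∑ j, ‖c ℓ j‖ ^ 2 = 1 := fun ℓ => by
    have := hΦ.orthonormal ℓ ℓ
    rw [hc, h.cellInner_modeSum, if_pos rfl] at this
    simp only [Complex.conj_mul'] at this
    exact_mod_cast this
  set α := c 0 0
  set β := c 1 2
  set γ := c 2 0
  have n0 := hn 0
  have n1 := hn 1
  have n2 := hn 2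
  rw [k0, Fin.sum_univ_three] at n0
  rw [k1, Fin.sum_univ_three] at n1
  rw [k2, Fin.sum_univ_three] at n2
  simp at n0 n1 n2
  have hr2 : √2 * √2 = (2 : ℝ) := Real.mul_self_sqrt (by norm_num)
  have hr2c : ((√2 : ℝ) : ℂ) * ((√2 : ℝ) : ℂ) = 2 := by exact_mod_cast hr2
  have hr0 : ((√2 : ℝ) : ℂ) ≠ 0 := fun h0 => by simp [h0] at hr2c
  have hI := Complex.I_mul_I
  have hv := h.pos
  have m0 : √2 * √w * ‖α‖ = 1 := by
    refine (sq_eq_sq₀ (by positivity) one_pos.le).1 ?_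
    rw [mul_pow, mul_pow, Real.sq_sqrt hvol.le, Real.sq_sqrt (by norm_num)]
    linear_combination n0
  have m1 : √w * ‖β‖ = 1 := by
    refine (sq_eq_sq₀ (by positivity) one_pos.le).1 ?_
    rw [mul_pow, Real.sq_sqrt hvol.le]
    linear_combination n1
  have m2 : √2 * √w * ‖γ‖ = 1 := by
    refine (sq_eq_sq₀ (by positivity) one_pos.le).1 ?_
    rw [mul_pow, mul_pow, Real.sq_sqrt hvol.le, Real.sq_sqrt (by norm_num)]
    linear_combination n2
  have hww : √w * √w = w := Real.mul_self_sqrt hvol.le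
  -- Read off from the gradient formula: the vector (i, 1, 0) is i(1, -i, 0), and √2 undoes the
  -- normalization of ω₁. In the third product the two equal terms add up to the factor 2.
  refine ⟨-Complex.I * (√2 : ℝ) * (w * v : ℝ) * ((starRingEnd ℂ) α * β),
    -Complex.I * (√2 : ℝ) * (w * v : ℝ) * ((starRingEnd ℂ) β * γ),
    2 * Complex.I * (w * v : ℝ) * ((starRingEnd ℂ) γ * α), ?_, ?_, ?_, ?_, ?_, ?_⟩
  · rw [hc, hc, h.gradInner_modeSum, k0, k1, ← hw]
    ext j
    fin_cases j <;> simp [omega1] <;> field_simp <;> ring_nf <;> simp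
  · rw [hc, hc, h.gradInner_modeSum, k1, k2, ← hw]
    ext j
    fin_cases j <;> simp [omega1] <;> field_simp <;> ring_nf <;> simp
  · rw [hc, hc, h.gradInner_modeSum, k2, k0, ← hw]
    ext j
    fin_cases j <;> simp [omega2]; ring_nf
  · simp only [norm_mul, norm_neg, Complex.norm_I, Complex.norm_real, RCLike.norm_conj,
      Real.norm_eq_abs, abs_of_pos hv, abs_of_pos hvol, abs_of_nonneg (Real.sqrt_nonneg 2)]
    linear_combination v * m0 * (√w * ‖β‖) + v * m1 - √2 * v * ‖α‖ * ‖β‖ * hww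
  · simp only [norm_mul, norm_neg, Complex.norm_I, Complex.norm_real, RCLike.norm_conj,
      Real.norm_eq_abs, abs_of_pos hv, abs_of_pos hvol, abs_of_nonneg (Real.sqrt_nonneg 2)]
    linear_combination v * m2 * (√w * ‖β‖) + v * m1 - √2 * v * ‖γ‖ * ‖β‖ * hww
  · simp only [norm_mul, Complex.norm_I, Complex.norm_real, RCLike.norm_conj, Complex.norm_ofNat,
      Real.norm_eq_abs, abs_of_pos hv, abs_of_pos hvol]
    linear_combination v * m0 * (√2 * √w * ‖γ‖) + v * m2 - √2 * √2 * v * ‖γ‖ * ‖α‖ * hww -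
      w * v * ‖γ‖ * ‖α‖ * hr2

theorem IsWeylData.assumptionH2 (h : IsWeylData ha hV ε f μ v) :
    AssumptionH2 a (fun x => ε * V x) μ :=
  ⟨v, h.isFermiVelocity, h.pos.ne'⟩

end FermiVelocity

theorem norm_ptK_sq (a : ℝ) : ‖ptK a‖ ^ 2 = 3 / 4 * qScale a ^ 2 := by
  rw [EuclideanSpace.real_norm_sq_eq, Fin.sum_univ_three]
  simp [ptK, dualVec]
  ring

end

end ThreefoldWeyl

end

/-! ### Assembly of the theorem -/

theorem mainTheorem2 (a : ℝ) (ha : 0 < a) (V : ThreefoldWeyl.E3 → ℝ)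
    (hV : ThreefoldWeyl.IsAdmissible a V)
    (hV100 : 0 < (ThreefoldWeyl.fourierCoeff a V ![1, 0, 0]).re) :
    ∃ ε₀ > 0, ∃ C : ℝ, ∀ ε : ℝ, 0 < ε → ε < ε₀ → ∃ μ v : ℝ,
      ThreefoldWeyl.AssumptionH1 a (fun x => ε * V x) μ ∧
      ThreefoldWeyl.AssumptionH2 a (fun x => ε * V x) μ ∧
      ThreefoldWeyl.IsFermiVelocity a (fun x => ε * V x) μ v ∧
      |μ - (‖ThreefoldWeyl.ptK a‖ ^ 2 +
        ε * ((ThreefoldWeyl.fourierCoeff a V ![0, 0, 0]).re -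
          (ThreefoldWeyl.fourierCoeff a V ![1, 0, 0]).re))| ≤ C * ε ^ 2 ∧
      |v - ThreefoldWeyl.qScale a| ≤ C * ε ∧
      ThreefoldWeyl.IsThreefoldWeylPoint a (fun x => ε * V x) (-1) 1 μ v := by
  rw [ThreefoldWeyl.fourierCoeff_eq_vhat ha hV] at hV100
  obtain ⟨ε₀, hε₀, C, hC⟩ := ThreefoldWeyl.exists_isWeylData ha hV hV100
  refine ⟨ε₀, hε₀, C, fun ε h0 h1 => ?_⟩
  obtain ⟨f, μ, v, h, hμ, hv⟩ := hC ε h0 h1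
  refine ⟨μ, v, h.assumptionH1, h.assumptionH2, h.isFermiVelocity, ?_, hv,
    h.isThreefoldWeylPoint⟩
  rwa [ThreefoldWeyl.fourierCoeff_eq_vhat ha hV, ThreefoldWeyl.fourierCoeff_eq_vhat ha hV,
    ThreefoldWeyl.norm_ptK_sq]
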